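/- Let $F_2=\langle x,y\mid-\rangle$ be the free group on $x,y$, and write $\overline{u}=u^{-1}$. An element $u\in F_2$ is \emph{primitive} if there is $v\in F_2$ such that $\{u,v\}$ is a basis of $F_2$, and it is a \emph{power} if $u=w^k$ for some nontrivial $w\in F_2$ and some integer $k\ge 2$. For integers $n,p,q$ put \[c_0'(n,p,q)=x^p\,(x^{p+1}yx^py^{q+1}x^py)^n,\] \[c_0''(n,p,q)=x^pyxy\,(\overline{y}x^pyx^py^qx^pyx^p\overline{y}\,\overline{x}^{\,p})^n,\] \[c_1'(n,p,q)=y\overline{x}^{\,p}\overline{y}\,\overline{x}^{\,p}\overline{y}^{\,q}\,(y^{q+1}x^pyx^{p+1}yx^p)^n,\] \[c_1''(n,p,q)=\overline{y}^{\,q}\overline{x}^{\,p}\overline{y}\,\overline{x}^{\,p}\,(x^pyx^py^qx^pyx^p\overline{y}\,\overline{x}^{\,p}\overline{y})^n.\] Let $n,p,q$ be integers with $p\neq 0$. In the lists below, a letter $n$, $p$ or $q$ inside a triple means that this entry is arbitrary (subject to $p\ne0$). (a) $c_0'(n,p,q)$ is primitive if and only if $(n,p,q)$ is $(0,\pm1,q)$,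 $(1,-2,0)$, $(1,-1,1)$, $(1,p,-1)$, $(-1,2,0)$, $(-1,1,1)$, $(2,-1,0)$, $(-2,1,0)$ or $(n,1,-1)$. It is a power if and only if $(n,p,q)$ is $(0,p,q)$ with $|p|\ge2$, $(1,-1,0)$ or $(-1,1,0)$. (b) $c_0''(n,p,q)$ is primitive if and only if $(n,p,q)$ is $(0,2,q)$, $(1,p,0)$, $(1,-1,2)$ or $(1,-2,1)$. It is a power if and only if $(n,p,q)$ is $(0,1,q)$ or $(1,-1,1)$. (c) $c_1'(n,p,q)$ is primitive if and only if $(n,p,q)$ is $(0,p,1)$, $(0,\pm1,3)$, $(-1,2,0)$, $(-1,-1,2)$ or $(-1,p,1)$. It is a power if and only if $(n,p,q)$ is $(-1,1,0)$ or $(0,p,2)$. (d) $c_1''(n,p,q)$ is primitive if and only if $(n,p,q)$ is $(0,\pm1,2)$ or $(0,p,0)$. It is a power if and only if $(n,p,q)$ is $(0,p,1)$. -/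

import Mathlib

namespace KleinWords

/-- The free group of rank two with basis `x`, `y`. -/
abbrev F₂ : Type := FreeGroup (Fin 2)

/-- The first generator of `F₂`. -/
def x : F₂ := FreeGroup.of 0

/-- The second generator of `F₂`. -/
def y : F₂ := FreeGroup.of 1

/-- `u` is primitive if there is `v` such that `{u, v}` is a basis of `F₂`. -/
def IsPrimitive (u : F₂) : Prop :=
  ∃ (v : F₂) (b : FreeGroupBasis (Fin 2) F₂), b 0 = u ∧ b 1 = v

/-- `u` is a power if `u = w ^ k` for some nontrivial `w` and some integer `k ≥ 2`. -/
def IsPower (u : F₂) : Prop :=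
  ∃ (w : F₂) (k : ℕ), w ≠ 1 ∧ 2 ≤ k ∧ u = w ^ k

/-- The word `c₀'(n,p,q)`. -/
def c₀' (n p q : ℤ) : F₂ :=
  x ^ p * (x ^ (p + 1) * y * x ^ p * y ^ (q + 1) * x ^ p * y) ^ n

/-- The word `c₀''(n,p,q)`. -/
def c₀'' (n p q : ℤ) : F₂ :=
  x ^ p * y * x * y *
    (y⁻¹ * x ^ p * y * x ^ p * y ^ q * x ^ p * y * x ^ p * y⁻¹ * x ^ (-p)) ^ n

/-- The word `c₁'(n,p,q)`. -/
def c₁' (n p q : ℤ) : F₂ :=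
  y * x ^ (-p) * y⁻¹ * x ^ (-p) * y ^ (-q) *
    (y ^ (q + 1) * x ^ p * y * x ^ (p + 1) * y * x ^ p) ^ n

/-- The word `c₁''(n,p,q)`. -/
def c₁'' (n p q : ℤ) : F₂ :=
  y ^ (-q) * x ^ (-p) * y⁻¹ * x ^ (-p) *
    (x ^ p * y * x ^ p * y ^ q * x ^ p * y * x ^ p * y⁻¹ * x ^ (-p) * y⁻¹) ^ n

end KleinWords

/-! A primitive element is never a power: the homomorphism to the integers sending it to 1 and the
other basis element to 0 shows this. So for each family it suffices to see that the listed triples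
give primitive elements, respectively powers, and that every other triple gives neither
(`isPrimitive_iff_and_isPower_iff`).

Primitivity of the listed words is explicit: except for powers of x, they become g h^k for some
basis (g, h) after conjugation and possibly inversion.

Non-primitivity rests on Whitehead's cut-vertex lemma. The Whitehead graph of u has the four letters
as vertices and an edge from the inverse of s to t for each pair of cyclically consecutive letters
s, t. If u belongs to a basis, let A be the set of elements whose reduced word in that basis begins
with the other basis element. Then A is invariant under right multiplication by u, almost invariant
under every right translation, and both it and its complement are infinite. If the graph remains
connected after deleting any vertex, then at each vertex of the Cayley tree the axes of conjugates
of u link all outgoing branches, and each axis has the same colour at its two ends. Induction from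
the leaves inward then makes A finite or cofinite, a contradiction
(`not_isPrimitive_of_noCutVertex`). In rank two it is enough to find a 4-cycle in the graph. Three
tests on exponents yield one: exponents of one generator with both signs; exponents of absolute
value at least two for both generators; or, when all exponents of h are 1, exponents of g differing
by at least two (`not_isPrimitive_of_spread`, after the change of basis h ↦ g^k h).

Non-powers are detected by counting. A cyclically reduced word that is a k-th power has a k-periodic
list of syllables, so k divides the number of syllables of every type; two coprime counts exclude
powers (`not_isPower_of_coprime_countP`).

It remains to write each word, up to conjugacy and inversion, as an initial segment, a repeated
block and a final segment, in a basis where both tests apply. Degenerate parameters make syllables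
vanish or counts share a factor, which forces the case distinctions. -/

namespace KleinWords

open FreeGroup

set_option linter.unusedSimpArgs false

/-! ### Almost invariant sets and Whitehead's cut-vertex lemma -/

/-- A letter `x`, `y` or the inverse of one. -/
abbrev Letter : Type := Fin 2 × Bool

/-- The inverse letter. -/
def bar (s : Letter) : Letter := (s.1, !s.2)

/-- The elements whose reduced word begins with `l`. -/
def cone (l : List Letter) : Set F₂ := {z | l <+: z.toWord}

/-- `A` has finite symmetric difference with each of its right translates. -/
def AlmostInvariant (A : Set F₂) : Prop := ∀ w, {z | ¬ (z * w ∈ A ↔ z ∈ A)}.Finite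

/-- Up to finitely many elements, `S` lies in `A` (if `c`) or in its complement (if not `c`). -/
def AlmostColour (A S : Set F₂) (c : Bool) : Prop := {z ∈ S | ¬ (z ∈ A ↔ c = true)}.Finite

/-- Some cyclic conjugate of `u` is a cyclically reduced word ending in `s` and beginning with `t`;
that is, `s`, `t` are consecutive in `u` read cyclically. -/
def HasTurn (u : F₂) (s t : Letter) : Prop :=
  ∃ (M : List Letter) (c : F₂), M.head? = some t ∧ M.getLast? = some s ∧
    IsCyclicallyReduced M ∧ u = c * mk M * c⁻¹

/-- Right multiplication by a single letter changes membership in `A` only at finitely many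
elements. Beyond the largest of their lengths, extending a reduced word letter by letter can no
longer change its colour. -/
theorem eventually_constant {A : Set F₂} (hA : AlmostInvariant A) :
    ∃ N : ℕ, ∀ l, IsReduced l → N ≤ l.length → ∃ c : Bool, ∀ z ∈ cone l, (z ∈ A ↔ c = true) := by
  have hF : (⋃ s : Letter, {z | ¬ (z * mk [s] ∈ A ↔ z ∈ A)}).Finite :=
    Set.finite_iUnion fun s => hA _
  obtain ⟨N, hN⟩ := (hF.image fun z => z.toWord.length).bddAbove
  refine ⟨N + 1, fun l hl hlen => ?_⟩
  classical
  refine ⟨decide (mk l ∈ A), ?_⟩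
  have key : ∀ m, IsReduced (l ++ m) → (mk (l ++ m) ∈ A ↔ mk l ∈ A) := by
    intro m
    induction m using List.reverseRecOn with
    | nil => simp
    | append_singleton m s ih =>
      intro h
      rw [← List.append_assoc] at h
      have h' : IsReduced (l ++ m) := List.IsChain.left_of_append h
      rw [← ih h', ← List.append_assoc, ← mul_mk]
      by_contra hc
      have : mk (l ++ m) ∈ ⋃ s : Letter, {z | ¬ (z * mk [s] ∈ A ↔ z ∈ A)} :=
        Set.mem_iUnion.2 ⟨s, hc⟩
      have := hN ⟨_, this, rfl⟩
      simp only [toWord_mk, h'.reduce_eq, List.length_append] at this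
      omega
  rintro z ⟨m, hm⟩
  have hz : z = mk (l ++ m) := by rw [hm, mk_toWord]
  have := key m (hm ▸ isReduced_toWord)
  rw [hz, this]
  simp

theorem mk_ne_one {M : List Letter} (hM : IsReduced M) (h : M ≠ []) : mk M ≠ 1 := by
  intro h1
  apply h
  rw [← hM.reduce_eq, ← toWord_mk, h1, toWord_one]

/-- The points g v^k c⁻¹ = (g c⁻¹) u^k all have one colour by invariance under u. Dropping the
factor c⁻¹ changes the colour finitely often, because F₂ is torsion-free and distinct k give
distinct points. -/
theorem finite_not_colour {A : Set F₂} (hA : AlmostInvariant A) {u : F₂}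
    (hu : ∀ z, z * u ∈ A ↔ z ∈ A) {v c : F₂} (hv : v ≠ 1) (huc : u = c * v * c⁻¹) (g : F₂) :
    {k : ℤ | ¬ (g * v ^ k ∈ A ↔ g * c⁻¹ ∈ A)}.Finite := by
  have hz : ∀ (k : ℤ) z, z * u ^ k ∈ A ↔ z ∈ A := by
    intro k
    induction k using Int.induction_on with
    | zero => simp
    | succ k ih => intro z; rw [zpow_add_one, ← mul_assoc, hu, ih]
    | pred k ih => intro z; rw [← hu, mul_assoc, ← zpow_add_one]; simpa using ih z
  have hinj : Function.Injective fun k : ℤ => g * v ^ k := by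
    refine (mul_right_injective g).comp ?_
    rw [injective_zpow_iff_not_isOfFinOrder]
    intro h
    obtain ⟨n, hn, h1⟩ := isOfFinOrder_iff_pow_eq_one.1 h
    exact hv ((pow_eq_one_iff_left hn.ne').1 h1)
  refine ((hA c⁻¹).preimage hinj.injOn).subset ?_
  intro k hk
  simp only [Set.mem_preimage, Set.mem_ofPred_eq] at hk ⊢
  have : g * v ^ k * c⁻¹ = g * c⁻¹ * u ^ k := by
    rw [huc, conj_zpow]; group
  rw [this, hz]
  tauto

/-- Powers of a cyclically reduced word concatenate without cancellation, so cancellation could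
occur only where `l` meets the first letter of `M`; `hl` forbids it there. -/
theorem mul_pow_mem_cone {l M : List Letter} {t : Letter} (hl : IsReduced (l ++ [t]))
    (hM : IsCyclicallyReduced M) (ht : M.head? = some t) {k : ℕ} (hk : k ≠ 0) :
    mk l * mk M ^ k ∈ cone (l ++ [t]) := by
  obtain ⟨M', rfl⟩ : ∃ M', M = t :: M' := by
    cases M <;> simp_all
  obtain ⟨k, rfl⟩ := Nat.exists_eq_succ_of_ne_zero hk
  have h := (hM.flatten_replicate (k + 1)).isReduced
  rw [List.replicate_succ, List.flatten_cons, List.cons_append] at h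
  have h2 : IsReduced (l ++ [t] ++ (M' ++ (List.replicate k (t :: M')).flatten)) :=
    IsReduced.append_overlap hl h (by simp)
  have : mk l * mk (t :: M') ^ (k + 1) =
      mk (l ++ [t] ++ (M' ++ (List.replicate k (t :: M')).flatten)) := by
    rw [pow_mk, mul_mk, List.replicate_succ]
    simp
  refine ⟨M' ++ (List.replicate k (t :: M')).flatten, ?_⟩
  rw [Nat.succ_eq_add_one, this, toWord_mk, h2.reduce_eq]

theorem isCyclicallyReduced_invRev {M : List Letter} (hM : IsCyclicallyReduced M) :
    IsCyclicallyReduced (invRev M) := by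
  refine ⟨?_, ?_⟩
  · rw [isReduced_iff_reduce_eq, reduce_invRev, hM.isReduced.reduce_eq]
  · intro a ha b hb hab
    simp only [invRev, Option.mem_def, List.getLast?_reverse, List.head?_reverse, List.head?_map,
      List.getLast?_map, Option.map_eq_some_iff] at ha hb
    obtain ⟨a', ha', rfl⟩ := ha
    obtain ⟨b', hb', rfl⟩ := hb
    simpa using (hM.2 b' hb' a' ha' hab.symm).symm

/-- The points mk l · M^k run along an axis through the vertex `mk l`. Positive powers enter the
branch of `t`, negative ones the branch of `bar s`, and by `finite_not_colour` both ends carry the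
same colour. -/
theorem colour_eq_of_hasTurn {A : Set F₂} (hA : AlmostInvariant A) {u : F₂}
    (hu : ∀ z, z * u ∈ A ↔ z ∈ A) {s t : Letter} (h : HasTurn u s t) {l : List Letter}
    (ht : IsReduced (l ++ [t])) (hs : IsReduced (l ++ [bar s])) {c d : Bool}
    (hc : AlmostColour A (cone (l ++ [bar s])) c) (hd : AlmostColour A (cone (l ++ [t])) d) :
    c = d := by
  obtain ⟨M, g, hMt, hMs, hM, hug⟩ := h
  have hne : M ≠ [] := by rintro rfl; simp at hMt
  have hv := mk_ne_one hM.isReduced hne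
  have hk := finite_not_colour hA hu hv hug (mk l)
  have hinj : Function.Injective fun k : ℤ => mk l * mk M ^ k := by
    refine (mul_right_injective _).comp ?_
    rw [injective_zpow_iff_not_isOfFinOrder]
    intro h
    obtain ⟨n, hn, h1⟩ := isOfFinOrder_iff_pow_eq_one.1 h
    exact hv ((pow_eq_one_iff_left hn.ne').1 h1)
  have h1 : ∀ k : ℕ, k ≠ 0 → mk l * mk M ^ (k : ℤ) ∈ cone (l ++ [t]) := by
    intro k hk
    rw [zpow_natCast]
    exact mul_pow_mem_cone ht hM hMt hk
  have h2 : ∀ k : ℕ, k ≠ 0 → mk l * mk M ^ (-(k : ℤ)) ∈ cone (l ++ [bar s]) := by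
    intro k hk
    rw [zpow_neg, ← inv_zpow, zpow_natCast, inv_mk]
    refine mul_pow_mem_cone hs (isCyclicallyReduced_invRev hM) ?_ hk
    simp [invRev, hMs, bar]
  have hfin : ({k : ℤ | ¬ (mk l * mk M ^ k ∈ A ↔ mk l * g⁻¹ ∈ A)} ∪
      ((fun k : ℤ => mk l * mk M ^ k) ⁻¹' {z ∈ cone (l ++ [bar s]) | ¬ (z ∈ A ↔ c = true)} ∪
      (fun k : ℤ => mk l * mk M ^ k) ⁻¹' {z ∈ cone (l ++ [t]) | ¬ (z ∈ A ↔ d = true)})).Finite :=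
    hk.union ((hc.preimage hinj.injOn).union (hd.preimage hinj.injOn))
  -- A single k > 0 is wanted for which neither k nor −k is exceptional; only finitely many k are
  -- excluded.
  have hfin2 := (hfin.preimage (f := fun k : ℕ => (k : ℤ)) Nat.cast_injective.injOn).union
    (((hfin.preimage (f := fun k : ℕ => -(k : ℤ))
      (neg_injective.comp Nat.cast_injective).injOn)).union (Set.finite_singleton 0))
  obtain ⟨k, hk⟩ := hfin2.infinite_compl.nonempty
  simp only [Set.mem_compl_iff, Set.mem_union, Set.mem_preimage, Set.mem_ofPred_eq, not_or,
    Set.mem_singleton_iff, not_and, not_not] at hk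
  obtain ⟨⟨a1, -, a3⟩, ⟨b1, b2, -⟩, k0⟩ := hk
  have e1 := a3 (h1 k k0)
  have e2 := b2 (h2 k k0)
  cases c <;> cases d <;> simp_all

theorem cone_subset (l : List Letter) :
    cone l ⊆ {mk l} ∪ ⋃ t ∈ {t : Letter | IsReduced (l ++ [t])}, cone (l ++ [t]) := by
  rintro z ⟨m, hm⟩
  cases m with
  | nil => left; simp only [List.append_nil] at hm; simp [hm, mk_toWord]
  | cons t m =>
    right
    have hr : IsReduced (l ++ t :: m) := hm ▸ isReduced_toWord
    simp only [Set.mem_iUnion]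
    exact ⟨t, by
      rw [List.append_cons] at hr
      exact List.IsChain.left_of_append hr, m, by simpa using hm⟩

/-- The Whitehead graph of `u` is connected and has no cut vertex. -/
def NoCutVertex (u : F₂) : Prop :=
  ∀ (r : Letter) (f : Letter → Bool),
    (∀ s t, s ≠ r → t ≠ r → HasTurn u (bar s) t → f s = f t) → ∀ s t, s ≠ r → t ≠ r → f s = f t

theorem bar_bar (s : Letter) : bar (bar s) = s := by simp [bar]

/-- Induction on how far `l` falls short of the length `N` beyond which cones are monochromatic. The
branches at `l` are its cone's children; Whitehead edges force equal colours on joined branches, and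
connectedness after deleting the backward letter makes all of them agree. -/
theorem exists_almostColour {A : Set F₂} (hA : AlmostInvariant A) {u : F₂}
    (hu : ∀ z, z * u ∈ A ↔ z ∈ A) (h : NoCutVertex u) : ∃ c, AlmostColour A Set.univ c := by
  obtain ⟨N, hN⟩ := eventually_constant hA
  have key : ∀ d l, IsReduced l → N ≤ l.length + d → ∃ c, AlmostColour A (cone l) c := by
    intro d
    induction d with
    | zero =>
      intro l hl hd
      obtain ⟨c, hc⟩ := hN l hl hd
      refine ⟨c, ?_⟩
      have : {z ∈ cone l | ¬ (z ∈ A ↔ c = true)} = ∅ := by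
        ext z
        simp only [Set.mem_ofPred_eq, Set.mem_empty_iff_false, iff_false, not_and, not_not]
        exact hc z
      rw [AlmostColour, this]
      exact Set.finite_empty
    | succ d ih =>
      intro l hl hd
      have h1 : ∀ t : Letter, ∃ c, IsReduced (l ++ [t]) → AlmostColour A (cone (l ++ [t])) c := by
        intro t
        by_cases ht : IsReduced (l ++ [t])
        · obtain ⟨c, hc⟩ := ih _ ht (by simp; omega)
          exact ⟨c, fun _ => hc⟩
        · exact ⟨true, fun h => absurd h ht⟩
      choose f hf using h1
      have h2 : ∀ s t, IsReduced (l ++ [s]) → IsReduced (l ++ [t]) → f s = f t := by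
        -- `R` holds the only letter that cannot follow `l`, the inverse of its last letter; it is
        -- empty when `l` is.
        have red : ∃ R : List Letter, R.length ≤ 1 ∧ ∀ t, IsReduced (l ++ [t]) ↔ t ∉ R := by
          rcases List.eq_nil_or_concat l with rfl | ⟨l', a, rfl⟩
          · exact ⟨[], by simp, by simp⟩
          · refine ⟨[bar a], by simp, fun t => ?_⟩
            have : IsReduced (l' ++ [a] ++ [t]) ↔ (a.1 = t.1 → a.2 = t.2) := by
              unfold FreeGroup.IsReduced
              rw [List.isChain_append]
              constructor
              · rintro ⟨-, -, h3⟩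
                exact h3 a (by simp) t (by simp)
              · intro h3
                refine ⟨by rw [List.concat_eq_append] at hl; exact hl, by simp, ?_⟩
                intro b hb c hc
                simp only [List.getLast?_concat, Option.mem_def, Option.some.injEq] at hb
                simp only [List.head?_cons, Option.mem_def, Option.some.injEq] at hc
                subst hb; subst hc; exact h3
            rw [List.concat_eq_append, this]
            obtain ⟨i, b⟩ := a
            obtain ⟨j, c⟩ := t
            simp only [bar, List.mem_singleton, Prod.mk.injEq]
            cases b <;> cases c <;> simp [eq_comm]
        obtain ⟨R, hR, hRt⟩ := red
        intro s t hs ht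
        -- At the root no letter is forbidden, so any letter other than s and t may play the deleted
        -- vertex.
        obtain ⟨r, hr, hsr, htr⟩ : ∃ r : Letter, (∀ b ∈ R, b = r) ∧ s ≠ r ∧ t ≠ r := by
          match R, hR with
          | [], _ =>
            have : ∀ s t : Letter, ∃ r, s ≠ r ∧ t ≠ r := by decide
            obtain ⟨r, h1, h2⟩ := this s t
            exact ⟨r, by simp, h1, h2⟩
          | [b], _ =>
            have h1 := (hRt s).1 hs
            have h2 := (hRt t).1 ht
            exact ⟨b, by simp, by simpa using h1, by simpa using h2⟩
        refine h r f ?_ s t hsr htr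
        intro s' t' hs' ht' hturn
        have hs2 : IsReduced (l ++ [s']) := (hRt s').2 fun hm => hs' (hr _ hm)
        have ht2 : IsReduced (l ++ [t']) := (hRt t').2 fun hm => ht' (hr _ hm)
        have := colour_eq_of_hasTurn hA hu hturn ht2 (by rwa [bar_bar])
          (by rw [bar_bar]; exact hf s' hs2) (hf t' ht2)
        exact this
      obtain ⟨c, hc⟩ : ∃ c, ∀ t, IsReduced (l ++ [t]) → f t = c := by
        by_cases hex : ∃ t, IsReduced (l ++ [t])
        · obtain ⟨t0, h0⟩ := hex
          exact ⟨f t0, fun t ht => h2 t t0 ht h0⟩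
        · exact ⟨true, fun t ht => absurd ⟨t, ht⟩ hex⟩
      refine ⟨c, ?_⟩
      have hfin : ({mk l} ∪ ⋃ t ∈ {t : Letter | IsReduced (l ++ [t])},
          {z ∈ cone (l ++ [t]) | ¬ (z ∈ A ↔ c = true)}).Finite := by
        refine (Set.finite_singleton _).union (Set.Finite.biUnion (Set.toFinite _) ?_)
        intro t ht
        rw [← hc t ht]
        exact hf t ht
      refine hfin.subset ?_
      rintro z ⟨hz, hzc⟩
      rcases cone_subset l hz with h | h
      · left; exact h
      · right
        simp only [Set.mem_iUnion] at h ⊢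
        obtain ⟨t, ht, htz⟩ := h
        exact ⟨t, ht, htz, hzc⟩
  obtain ⟨c, hc⟩ := key N [] (by simp) (by simp)
  have : cone [] = Set.univ := by ext; simp [cone]
  exact ⟨c, this ▸ hc⟩

theorem almostInvariant_of_generators {A : Set F₂}
    (h : ∀ i, {z | ¬ (z * of i ∈ A ↔ z ∈ A)}.Finite) : AlmostInvariant A := by
  have hinv : ∀ w, {z | ¬ (z * w ∈ A ↔ z ∈ A)}.Finite → {z | ¬ (z * w⁻¹ ∈ A ↔ z ∈ A)}.Finite := by
    intro w hw
    refine (hw.preimage (mul_left_injective w⁻¹).injOn).subset ?_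
    intro z hz
    simp only [Set.mem_preimage, Set.mem_ofPred_eq, inv_mul_cancel_right] at hz ⊢
    tauto
  intro w
  induction w using FreeGroup.induction_on with
  | C1 => simp
  | of i => exact h i
  | inv_of i hi => exact hinv _ hi
  | mul v w hv hw =>
    refine (hv.union (hw.preimage (mul_left_injective v).injOn)).subset ?_
    intro z hz
    simp only [Set.mem_union, Set.mem_preimage, Set.mem_ofPred_eq, ← mul_assoc] at hz ⊢
    tauto

/-- Right multiplication by a letter alters only the last letter of the reduced word, so the first
letter survives unless the word before or after is empty. -/
theorem mul_mem_cone_iff {z : F₂} {s t : Letter} (h1 : z ≠ 1) (h2 : z * mk [s] ≠ 1) :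
    z * mk [s] ∈ cone [t] ↔ z ∈ cone [t] := by
  have hz : z = mk z.toWord := mk_toWord.symm
  have hr : IsReduced z.toWord := isReduced_toWord
  generalize z.toWord = l at hz hr
  subst hz
  have hl : l ≠ [] := by rintro rfl; exact h1 rfl
  by_cases hs : IsReduced (l ++ [s])
  · simp only [cone, Set.mem_ofPred_eq, mul_mk, toWord_mk, hr.reduce_eq, hs.reduce_eq]
    cases l <;> simp_all
  · rcases List.eq_nil_or_concat l with rfl | ⟨l', a, rfl⟩
    · exact absurd rfl hl
    rw [List.concat_eq_append] at *
    have ha : a = bar s := by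
      by_contra hne
      apply hs
      unfold FreeGroup.IsReduced
      rw [List.isChain_append]
      refine ⟨hr, by simp, ?_⟩
      intro b hb c hc
      simp only [List.getLast?_concat, Option.mem_def, Option.some.injEq] at hb
      simp only [List.head?_cons, Option.mem_def, Option.some.injEq] at hc
      subst hb; subst hc
      intro hab
      by_contra hab'
      apply hne
      obtain ⟨i, b⟩ := a
      obtain ⟨j, c⟩ := s
      simp only at hab hab'
      subst hab
      cases b <;> cases c <;> simp_all [bar]
    have hr' : IsReduced l' := List.IsChain.left_of_append hr
    have e : mk (l' ++ [a]) * mk [s] = mk l' := by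
      rw [ha, ← mul_mk, mul_assoc]
      have : mk [bar s] = (mk [s])⁻¹ := by rw [inv_mk]; simp [invRev, bar]
      rw [this, inv_mul_cancel, mul_one]
    rw [e] at h2 ⊢
    have hl' : l' ≠ [] := by rintro rfl; exact h2 rfl
    simp only [cone, Set.mem_ofPred_eq, toWord_mk, hr.reduce_eq, hr'.reduce_eq]
    cases l' <;> simp_all

/-- The half-tree of words beginning with y is invariant under right multiplication by x.
Transported to a basis beginning with u it contradicts `exists_almostColour`: positive powers of the
second basis element lie inside, the others outside. -/
theorem not_isPrimitive_of_noCutVertex {u : F₂} (h : NoCutVertex u) : ¬ IsPrimitive u := by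
  rintro ⟨v, b, rfl, -⟩
  set A₀ : Set F₂ := cone [(1, true)]
  have hone : (1 : F₂) ∉ A₀ := by simp [A₀, cone]
  have hx : ∀ z, z * of 0 ∈ A₀ ↔ z ∈ A₀ := by
    intro z
    by_cases h1 : z = 1
    · subst h1
      simp [A₀, cone]
    by_cases h2 : z * of 0 = 1
    · have : z = (of 0)⁻¹ := eq_inv_of_mul_eq_one_left h2
      subst this
      simp [A₀, cone, toWord_inv, invRev]
    exact mul_mem_cone_iff h1 h2
  have hA₀ : AlmostInvariant A₀ := by
    apply almostInvariant_of_generators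
    intro i
    fin_cases i
    · have : {z : F₂ | ¬ (z * of 0 ∈ A₀ ↔ z ∈ A₀)} = ∅ := by ext z; simp [hx]
      change {z : F₂ | ¬ (z * of 0 ∈ A₀ ↔ z ∈ A₀)}.Finite
      rw [this]; exact Set.finite_empty
    · refine (Set.toFinite {1, (of 1)⁻¹}).subset ?_
      intro z hz
      by_contra hc
      simp only [Set.mem_insert_iff, Set.mem_singleton_iff, not_or] at hc
      refine hz (mul_mem_cone_iff hc.1 ?_)
      intro h2
      exact hc.2 (eq_inv_of_mul_eq_one_left h2)
  -- Almost invariance concerns translations by all group elements, so it survives the passage from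
  -- the basis `b` to the standard one, in which the Whitehead graph is formed.
  set A : Set F₂ := b.repr ⁻¹' A₀
  have hA : AlmostInvariant A := by
    intro w
    refine ((hA₀ (b.repr w)).preimage b.repr.injective.injOn).subset ?_
    intro z hz
    simpa [A] using hz
  obtain ⟨c, hc⟩ := exists_almostColour hA (u := b 0) (fun z => by simp [A, hx]) h
  have hinj : Function.Injective fun k : ℤ => b.repr.symm (of 1 ^ k) := by
    refine b.repr.symm.injective.comp ?_
    rw [injective_zpow_iff_not_isOfFinOrder]
    intro h
    obtain ⟨n, hn, h1⟩ := isOfFinOrder_iff_pow_eq_one.1 h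
    exact of_ne_one _ ((pow_eq_one_iff_left hn.ne').1 h1)
  have hfin := hc.preimage hinj.injOn
  have hpos : ∀ k : ℕ, k ≠ 0 → b.repr.symm (of 1 ^ (k : ℤ)) ∈ A := by
    intro k hk
    obtain ⟨k, rfl⟩ := Nat.exists_eq_succ_of_ne_zero hk
    simp only [A, Set.mem_preimage, MulEquiv.apply_symm_apply, zpow_natCast, A₀, cone,
      Set.mem_ofPred_eq, toWord_of_pow]
    simp [List.replicate_succ]
  have hneg : ∀ k : ℕ, b.repr.symm (of 1 ^ (-(k : ℤ))) ∉ A := by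
    intro k
    simp only [A, Set.mem_preimage, MulEquiv.apply_symm_apply, zpow_neg, zpow_natCast, A₀, cone,
      Set.mem_ofPred_eq, toWord_inv, toWord_of_pow]
    cases k <;> simp [List.replicate_succ', invRev]
  have hfin2 := (hfin.preimage (f := fun k : ℕ => (k : ℤ)) Nat.cast_injective.injOn).union
    (((hfin.preimage (f := fun k : ℕ => -(k : ℤ))
      (neg_injective.comp Nat.cast_injective).injOn)).union (Set.finite_singleton 0))
  obtain ⟨k, hk⟩ := hfin2.infinite_compl.nonempty
  simp only [Set.mem_compl_iff, Set.mem_union, Set.mem_preimage, Set.mem_ofPred_eq, not_or,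
    Set.mem_singleton_iff, not_not, Set.mem_univ, true_and] at hk
  obtain ⟨h1, h2, h0⟩ := hk
  have e1 := h1.1 (hpos k h0)
  exact hneg k (h2.2 e1)

/-! ### Bases, primitive elements and powers -/

/-- `g`, `h` form a basis of `F₂`. -/
def IsBasisPair (g h : F₂) : Prop := ∃ b : FreeGroupBasis (Fin 2) F₂, b 0 = g ∧ b 1 = h

theorem isBasisPair_x_y : IsBasisPair x y := ⟨FreeGroupBasis.ofFreeGroup _, rfl, rfl⟩

/-- All elementary moves on bases come from this: an automorphism written in x, y may be evaluated
at any basis pair. -/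
theorem IsBasisPair.comp {g h : F₂} (hb : IsBasisPair g h) (e : F₂ ≃* F₂) :
    IsBasisPair (lift ![g, h] (e x)) (lift ![g, h] (e y)) := by
  obtain ⟨b, rfl, rfl⟩ := hb
  have : (b.repr.symm : F₂ →* F₂) = lift ![b 0, b 1] := by
    ext i
    fin_cases i <;> simp <;> rfl
  refine ⟨⟨b.repr.trans e.symm⟩, ?_, ?_⟩
  · rw [← this]; rfl
  · rw [← this]; rfl

theorem IsBasisPair.swap {g h : F₂} (hb : IsBasisPair g h) : IsBasisPair h g := by
  have hi : (lift ![y, x] : F₂ →* F₂).comp (lift ![y, x]) = MonoidHom.id _ := by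
    ext i
    fin_cases i <;> simp [x, y]
  simpa [x, y] using hb.comp (MonoidHom.toMulEquiv _ _ hi hi)

theorem IsBasisPair.inv_left {g h : F₂} (hb : IsBasisPair g h) : IsBasisPair g⁻¹ h := by
  have hi : (lift ![x⁻¹, y] : F₂ →* F₂).comp (lift ![x⁻¹, y]) = MonoidHom.id _ := by
    ext i
    fin_cases i <;> simp [x, y]
  simpa [x, y] using hb.comp (MonoidHom.toMulEquiv _ _ hi hi)

theorem IsBasisPair.inv_right {g h : F₂} (hb : IsBasisPair g h) : IsBasisPair g h⁻¹ :=
  hb.swap.inv_left.swap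

theorem IsBasisPair.zpow_mul {g h : F₂} (hb : IsBasisPair g h) (k : ℤ) :
    IsBasisPair g (g ^ k * h) := by
  have hi : ∀ k : ℤ, (lift ![x, x ^ k * y] : F₂ →* F₂).comp (lift ![x, x ^ (-k) * y]) =
      MonoidHom.id _ := by
    intro k
    ext i
    fin_cases i <;> simp [x, y]
  have hi' := hi (-k)
  rw [neg_neg] at hi'
  simpa [x, y] using hb.comp (MonoidHom.toMulEquiv _ _ hi' (hi k))

theorem IsBasisPair.mul_zpow {g h : F₂} (hb : IsBasisPair g h) (k : ℤ) :
    IsBasisPair g (h * g ^ k) := by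
  simpa using (hb.inv_right.zpow_mul (-k)).inv_right

theorem IsBasisPair.exists_equiv {g h : F₂} (hb : IsBasisPair g h) :
    ∃ e : F₂ ≃* F₂, e x = g ∧ e y = h := by
  obtain ⟨b, rfl, rfl⟩ := hb
  exact ⟨b.repr.symm, rfl, rfl⟩

theorem IsBasisPair.isPrimitive_left {g h : F₂} (hb : IsBasisPair g h) : IsPrimitive g := by
  obtain ⟨b, rfl, rfl⟩ := hb
  exact ⟨_, b, rfl, rfl⟩

theorem IsBasisPair.isPrimitive_right {g h : F₂} (hb : IsBasisPair g h) : IsPrimitive h :=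
  hb.swap.isPrimitive_left

theorem isPrimitive_iff_exists_isBasisPair {u : F₂} :
    IsPrimitive u ↔ ∃ v, IsBasisPair u v := Iff.rfl

theorem IsPrimitive.map {u : F₂} (hu : IsPrimitive u) (e : F₂ ≃* F₂) : IsPrimitive (e u) := by
  obtain ⟨v, b, rfl, rfl⟩ := hu
  exact ⟨_, b.map e, rfl, rfl⟩

theorem IsPrimitive.inv {u : F₂} (hu : IsPrimitive u) : IsPrimitive u⁻¹ := by
  obtain ⟨v, hv⟩ := isPrimitive_iff_exists_isBasisPair.1 hu
  exact hv.inv_left.isPrimitive_left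

theorem IsPrimitive.of_isConj {u v : F₂} (hu : IsPrimitive u) (h : IsConj u v) :
    IsPrimitive v := by
  obtain ⟨c, rfl⟩ := isConj_iff.1 h
  exact hu.map (MulAut.conj c)

theorem IsPower.map {u : F₂} (hu : IsPower u) (e : F₂ ≃* F₂) : IsPower (e u) := by
  obtain ⟨w, k, hw, hk, rfl⟩ := hu
  exact ⟨e w, k, by simpa using hw, hk, by simp⟩

theorem IsPower.inv {u : F₂} (hu : IsPower u) : IsPower u⁻¹ := by
  obtain ⟨w, k, hw, hk, rfl⟩ := hu
  exact ⟨w⁻¹, k, by simpa using hw, hk, by simp⟩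

theorem IsPower.of_isConj {u v : F₂} (hu : IsPower u) (h : IsConj u v) : IsPower v := by
  obtain ⟨c, rfl⟩ := isConj_iff.1 h
  exact hu.map (MulAut.conj c)

/-- The homomorphism to ℤ with value 1 on u and 0 on the second basis element would make 1 divisible
by k. -/
theorem IsPrimitive.not_isPower {u : F₂} (hu : IsPrimitive u) : ¬ IsPower u := by
  obtain ⟨v, b, rfl, -⟩ := hu
  rintro ⟨w, k, -, hk, h⟩
  let f : F₂ →* Multiplicative ℤ :=
    (lift ![Multiplicative.ofAdd 1, 1]).comp (b.repr : F₂ →* F₂)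
  have h1 : f (b 0) = Multiplicative.ofAdd 1 := by simp [f]
  rw [h, map_pow] at h1
  have h2 : (k : ℤ) * (f w).toAdd = 1 := by
    simpa using congrArg Multiplicative.toAdd h1
  have := Int.eq_one_or_neg_one_of_mul_eq_one h2
  omega

/-! ### Cyclic words encoded by exponent lists -/

/-- The word `s ^ a` for the generator `s` with index `i`. -/
def syllable (i : Fin 2) (a : ℤ) : List Letter := List.replicate a.natAbs (i, decide (0 < a))

/-- The word `x ^ a₁ y ^ b₁ x ^ a₂ y ^ b₂ ⋯`. -/
def expand (L : List (ℤ × ℤ)) : List Letter :=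
  L.flatMap fun e => syllable 0 e.1 ++ syllable 1 e.2

/-- The product `g ^ a₁ h ^ b₁ g ^ a₂ h ^ b₂ ⋯`. -/
def W (g h : F₂) (L : List (ℤ × ℤ)) : F₂ := (L.map fun e => g ^ e.1 * h ^ e.2).prod

@[simp] theorem W_nil (g h : F₂) : W g h [] = 1 := rfl

@[simp] theorem W_cons (g h : F₂) (e : ℤ × ℤ) (L : List (ℤ × ℤ)) :
    W g h (e :: L) = g ^ e.1 * h ^ e.2 * W g h L := by simp [W]

@[simp] theorem W_append (g h : F₂) (L M : List (ℤ × ℤ)) :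
    W g h (L ++ M) = W g h L * W g h M := by simp [W]

@[simp] theorem W_flatten_replicate (g h : F₂) (m : ℕ) (L : List (ℤ × ℤ)) :
    W g h (List.replicate m L).flatten = W g h L ^ m := by
  induction m with
  | zero => simp
  | succ m ih => simp [List.replicate_succ, ih, pow_succ']

theorem map_W (e : F₂ ≃* F₂) (g h : F₂) (L : List (ℤ × ℤ)) : e (W g h L) = W (e g) (e h) L := by
  simp [W, map_list_prod, Function.comp_def]

theorem mk_syllable (i : Fin 2) (a : ℤ) : mk (syllable i a) = of i ^ a := by
  have hp : ∀ (n : ℕ) (c : Bool), mk (List.replicate n (i, c)) = mk [(i, c)] ^ n := by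
    intro n c
    rw [pow_mk]; simp
  unfold syllable
  rw [hp]
  by_cases h : 0 < a
  · obtain ⟨n, rfl⟩ := Int.eq_ofNat_of_zero_le h.le
    simp only [h, decide_true, Int.natAbs_natCast, zpow_natCast]
    rfl
  · obtain ⟨n, hn⟩ := Int.eq_ofNat_of_zero_le (by omega : 0 ≤ -a)
    obtain rfl : a = -n := by omega
    have : mk [(i, false)] = (of i)⁻¹ := rfl
    simp only [h, decide_false, Int.natAbs_neg, Int.natAbs_natCast, zpow_neg, zpow_natCast, this,
      inv_pow]

theorem mk_expand (L : List (ℤ × ℤ)) : mk (expand L) = W x y L := by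
  induction L with
  | nil => rfl
  | cons e L ih =>
    rw [W_cons, ← ih, x, y, ← mk_syllable, ← mk_syllable, mul_mk, mul_mk]
    rfl

theorem expand_cons (e : ℤ × ℤ) (L : List (ℤ × ℤ)) :
    expand (e :: L) = syllable 0 e.1 ++ syllable 1 e.2 ++ expand L := rfl

theorem syllable_head? {i : Fin 2} {a : ℤ} (ha : a ≠ 0) :
    (syllable i a).head? = some (i, decide (0 < a)) := by
  unfold syllable
  rw [List.head?_replicate, if_neg (by simpa using ha)]

theorem syllable_getLast? {i : Fin 2} {a : ℤ} (ha : a ≠ 0) :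
    (syllable i a).getLast? = some (i, decide (0 < a)) := by
  unfold syllable
  rw [List.getLast?_replicate, if_neg (by simpa using ha)]

theorem syllable_ne_nil {i : Fin 2} {a : ℤ} (ha : a ≠ 0) : syllable i a ≠ [] := by
  simpa [syllable] using ha

theorem isReduced_syllable (i : Fin 2) (a : ℤ) : FreeGroup.IsReduced (syllable i a) := by
  rw [isReduced_iff_reduce_eq, syllable, reduce_replicate]

/-- The syllable pair `f` can follow `e` without cancellation. -/
def Compat (e f : ℤ × ℤ) : Prop := e.2 ≠ 0 ∧ f.2 ≠ 0 ∧ (f.1 ≠ 0 ∨ (0 < e.2 ∧ 0 < f.2))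

theorem block_getLast? {e : ℤ × ℤ} (he : e.2 ≠ 0) :
    (syllable 0 e.1 ++ syllable 1 e.2).getLast? = some (1, decide (0 < e.2)) := by
  rw [List.getLast?_append, syllable_getLast? he]; rfl

/-- Compatibility is required of all ordered pairs, not merely of neighbours. The order of the list
then does not matter, and the closing junction is handled like every other one. -/
theorem isCyclicallyReduced_expand {L : List (ℤ × ℤ)} (hL : ∀ e ∈ L, ∀ f ∈ L, Compat e f) :
    IsCyclicallyReduced (expand L) := by
  have hjoin : ∀ e ∈ L, ∀ f ∈ L, ∀ a ∈ (syllable 0 e.1 ++ syllable 1 e.2).getLast?,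
      ∀ b ∈ (syllable 0 f.1 ++ syllable 1 f.2).head?, a.1 = b.1 → a.2 = b.2 := by
    intro e he f hf a ha b hb
    obtain ⟨h1, h2, h3⟩ := hL e he f hf
    rw [block_getLast? h1, Option.mem_def, Option.some.injEq] at ha
    subst ha
    by_cases h0 : f.1 = 0
    · have h3 := h3.resolve_left (by simpa using h0)
      rw [h0, List.head?_append, syllable_head? h2] at hb
      simp only [syllable, Int.natAbs_zero, List.replicate_zero, List.head?_nil, Option.none_or,
        Option.mem_def, Option.some.injEq] at hb
      subst hb
      simp [h3.1, h3.2]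
    · rw [List.head?_append, syllable_head? h0] at hb
      simp only [Option.some_or, Option.mem_def, Option.some.injEq] at hb
      subst hb
      simp
  have hne : ∀ e ∈ L, syllable 0 e.1 ++ syllable 1 e.2 ≠ [] := by
    intro e he
    simp [syllable_ne_nil (hL e he e he).1]
  refine ⟨?_, ?_⟩
  · unfold FreeGroup.IsReduced expand
    rw [List.flatMap_def, List.isChain_flatten]
    · refine ⟨?_, ?_⟩
      · intro l hl
        obtain ⟨e, he, rfl⟩ := List.mem_map.1 hl
        rw [List.isChain_append]
        refine ⟨isReduced_syllable _ _, isReduced_syllable _ _, ?_⟩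
        intro a ha b hb hab
        have h1 := List.mem_of_mem_getLast? ha
        have h2 := List.mem_of_mem_head? hb
        simp only [syllable, List.mem_replicate] at h1 h2
        rw [h1.2, h2.2] at hab
        simp at hab
      · rw [List.isChain_map]
        refine List.Pairwise.isChain (List.Pairwise.imp_of_mem ?_ (List.pairwise_of_forall
          (R := fun _ _ => True) (l := L) (by simp)))
        intro e f he hf _
        exact hjoin e he f hf
    · simp only [List.mem_map, not_exists, not_and]
      exact hne
  · intro a ha b hb
    rcases List.eq_nil_or_concat L with rfl | ⟨L', e, hLe⟩
    · simp [expand] at ha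
    rw [List.concat_eq_append] at hLe
    have he : e ∈ L := by simp [hLe]
    cases hL2 : L with
    | nil => simp [hL2, expand] at ha
    | cons f L2 =>
      have hf : f ∈ L := by simp [hL2]
      refine hjoin e he f hf a ?_ b ?_
      · rw [hLe] at ha
        unfold expand at ha
        rw [List.flatMap_append, List.getLast?_append] at ha
        simpa [block_getLast? (hL e he e he).1] using ha
      · rw [hL2, expand_cons, List.head?_append] at hb
        cases hh : (syllable 0 f.1 ++ syllable 1 f.2).head? with
        | none => rw [List.head?_eq_none_iff] at hh; exact absurd hh (hne f hf)
        | some c => rw [hh] at hb; simpa using hb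

theorem IsCyclicallyReduced.swap_append {A B : List Letter} (h : IsCyclicallyReduced (A ++ B)) :
    IsCyclicallyReduced (B ++ A) := by
  rcases eq_or_ne A [] with rfl | hA
  · simpa using h
  rcases eq_or_ne B [] with rfl | hB
  · simpa using h
  obtain ⟨h1, h2⟩ := h
  unfold FreeGroup.IsReduced at h1
  rw [List.isChain_append] at h1
  rw [List.getLast?_append_of_ne_nil _ hB, List.head?_append_of_ne_nil _ hA] at h2
  refine ⟨?_, ?_⟩
  · unfold FreeGroup.IsReduced
    rw [List.isChain_append]
    exact ⟨h1.2.1, h1.1, h2⟩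
  · rw [List.getLast?_append_of_ne_nil _ hA, List.head?_append_of_ne_nil _ hB]
    exact h1.2.2

theorem hasTurn_of_append {A B : List Letter} (h : IsCyclicallyReduced (A ++ B)) {s t : Letter}
    (hs : A.getLast? = some s) (ht : B.head? = some t) {u : F₂} (hu : IsConj (mk (A ++ B)) u) :
    HasTurn u s t := by
  obtain ⟨c, rfl⟩ := isConj_iff.1 hu
  refine ⟨B ++ A, c * mk A, ?_, ?_, IsCyclicallyReduced.swap_append h, ?_⟩
  · rw [List.head?_append, ht]; rfl
  · rw [List.getLast?_append, hs]; rfl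
  · rw [← mul_mk, ← mul_mk]; group

/-- `u` is conjugate to the cyclically reduced word with exponent list `L`. -/
structure CycRep (L : List (ℤ × ℤ)) (u : F₂) : Prop where
  compat : ∀ e ∈ L, ∀ f ∈ L, Compat e f
  conj : IsConj (W x y L) u

theorem isConj_W_rotated (g h : F₂) {L M : List (ℤ × ℤ)} (hr : L ~r M) :
    IsConj (W g h L) (W g h M) := by
  obtain ⟨n, rfl⟩ := hr
  rw [List.rotate_eq_drop_append_take_mod]
  conv_lhs => rw [← List.take_append_drop (n % L.length) L]
  rw [W_append, W_append]
  exact isConj_iff.2 ⟨(W g h (List.take (n % L.length) L))⁻¹, by group⟩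

theorem CycRep.rotate {L M : List (ℤ × ℤ)} {u : F₂} (h : CycRep L u) (hr : L ~r M) :
    CycRep M u :=
  ⟨fun e he f hf => h.compat e (hr.mem_iff.2 he) f (hr.mem_iff.2 hf),
    (isConj_W_rotated x y hr.symm).trans h.conj⟩

theorem exists_rotated_cons {L : List (ℤ × ℤ)} {e : ℤ × ℤ} (he : e ∈ L) :
    ∃ M, L ~r (e :: M) := by
  obtain ⟨A, B, rfl⟩ := List.append_of_mem he
  exact ⟨B ++ A, List.isRotated_append⟩

theorem CycRep.hasTurn_xy {L : List (ℤ × ℤ)} {u : F₂} (h : CycRep L u) {e : ℤ × ℤ} (he : e ∈ L)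
    (h0 : e.1 ≠ 0) : HasTurn u (0, decide (0 < e.1)) (1, decide (0 < e.2)) := by
  obtain ⟨M, hr⟩ := exists_rotated_cons he
  have h' := h.rotate hr
  have hc := isCyclicallyReduced_expand h'.compat
  have h2 : e.2 ≠ 0 := (h.compat e he e he).1
  have hu := h'.conj
  rw [← mk_expand] at hu
  rw [expand_cons, List.append_assoc] at hc hu
  refine hasTurn_of_append hc (syllable_getLast? h0) ?_ hu
  rw [List.head?_append, syllable_head? h2]; rfl

theorem CycRep.hasTurn_yx {e f : ℤ × ℤ} {M : List (ℤ × ℤ)} {u : F₂}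
    (h : CycRep (f :: (M ++ [e])) u) (h0 : f.1 ≠ 0) :
    HasTurn u (1, decide (0 < e.2)) (0, decide (0 < f.1)) := by
  have h' := h.rotate (M := [e] ++ (f :: M)) (by
    have := List.isRotated_append (l := f :: M) (l' := [e])
    simpa using this)
  have hc := isCyclicallyReduced_expand h'.compat
  have he : e ∈ f :: (M ++ [e]) := by simp
  have h2 : e.2 ≠ 0 := (h.compat e he e he).1
  have hu := h'.conj
  rw [← mk_expand] at hu
  rw [List.singleton_append, expand_cons] at hc hu
  refine hasTurn_of_append hc (block_getLast? h2) ?_ hu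
  rw [expand_cons, List.append_assoc, List.head?_append, syllable_head? h0]; rfl

theorem CycRep.exists_hasTurn_yx {L : List (ℤ × ℤ)} {u : F₂} (h : CycRep L u) {f : ℤ × ℤ}
    (hf : f ∈ L) (h0 : f.1 ≠ 0) :
    ∃ e ∈ L, HasTurn u (1, decide (0 < e.2)) (0, decide (0 < f.1)) := by
  obtain ⟨M, hr⟩ := exists_rotated_cons hf
  rcases List.eq_nil_or_concat M with rfl | ⟨M', e, rfl⟩
  -- With a single pair the cyclic predecessor of `f` is `f` itself.
  · have h' : CycRep [f] u := h.rotate hr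
    refine ⟨f, hf, ?_⟩
    have hc := isCyclicallyReduced_expand h'.compat
    have h2 : f.2 ≠ 0 := (h.compat f hf f hf).1
    obtain ⟨c, hc'⟩ := isConj_iff.1 h'.conj
    refine ⟨expand [f], c, ?_, ?_, hc, by rw [mk_expand, hc']⟩
    · simp [expand, syllable_head? h0]
    · simp [expand, syllable_getLast? h2]
  · rw [List.concat_eq_append] at hr
    exact ⟨e, hr.mem_iff.2 (by simp), (h.rotate hr).hasTurn_yx h0⟩

theorem CycRep.hasTurn_xx {L : List (ℤ × ℤ)} {u : F₂} (h : CycRep L u) {e : ℤ × ℤ} (he : e ∈ L)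
    (h0 : 2 ≤ e.1) : HasTurn u (0, true) (0, true) := by
  obtain ⟨M, hr⟩ := exists_rotated_cons he
  have h' := h.rotate hr
  have hc := isCyclicallyReduced_expand h'.compat
  have hu := h'.conj
  rw [← mk_expand] at hu
  obtain ⟨n, hn⟩ := Int.eq_ofNat_of_zero_le (by omega : 0 ≤ e.1 - 2)
  have hs : syllable 0 e.1 = [(0, true)] ++ (0, true) :: List.replicate n (0, true) := by
    have h1 : e.1.natAbs = n + 2 := by omega
    have h2 : 0 < e.1 := by omega
    simp [syllable, h1, h2, List.replicate_succ]
  rw [expand_cons, hs, List.append_assoc, List.append_assoc] at hc hu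
  exact hasTurn_of_append hc rfl rfl hu

theorem CycRep.hasTurn_yy {L : List (ℤ × ℤ)} {u : F₂} (h : CycRep L u) {e : ℤ × ℤ} (he : e ∈ L)
    (h0 : 2 ≤ e.2) : HasTurn u (1, true) (1, true) := by
  obtain ⟨M, hr⟩ := exists_rotated_cons he
  have h' := h.rotate hr
  have hc := isCyclicallyReduced_expand h'.compat
  have hu := h'.conj
  rw [← mk_expand] at hu
  obtain ⟨n, hn⟩ := Int.eq_ofNat_of_zero_le (by omega : 0 ≤ e.2 - 2)
  have hs : syllable 1 e.2 = [(1, true)] ++ (1, true) :: List.replicate n (1, true) := by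
    have h1 : e.2.natAbs = n + 2 := by omega
    have h2 : 0 < e.2 := by omega
    simp [syllable, h1, h2, List.replicate_succ]
  rw [expand_cons, hs] at hc hu
  rw [show syllable 0 e.1 ++ ([(1, true)] ++ (1, true) :: List.replicate n (1, true)) ++ expand M =
    (syllable 0 e.1 ++ [(1, true)]) ++ ((1, true) :: List.replicate n (1, true) ++ expand M) by
      simp] at hc hu
  exact hasTurn_of_append hc (by simp) rfl hu

/-! ### Sign and square patterns that exclude a cut vertex -/

/-- The hypothesis joins each of x, x⁻¹ to each of y, y⁻¹. This is a 4-cycle, and deleting a vertex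
leaves a path. -/
theorem noCutVertex_of_alternating {u : F₂}
    (h : ∀ a b, HasTurn u (bar (0, a)) (1, b) ∨ HasTurn u (bar (1, b)) (0, a)) :
    NoCutVertex u := by
  intro r f hf
  have hE : ∀ a b, (0, a) ≠ r → (1, b) ≠ r → f (0, a) = f (1, b) := by
    intro a b ha hb
    rcases h a b with h | h
    · exact hf _ _ ha hb h
    · exact (hf _ _ hb ha h).symm
  clear hf h
  revert r f
  decide

/-- The four turns give the edges of the 4-cycle x⁻¹, x, y⁻¹, y. -/
theorem noCutVertex_of_squares {u : F₂} (hxx : HasTurn u (0, true) (0, true))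
    (hyy : HasTurn u (1, true) (1, true)) (hxy : HasTurn u (0, true) (1, true))
    (hyx : HasTurn u (1, true) (0, true)) : NoCutVertex u := by
  intro r f hf s t hs ht
  have h1 := hf (0, false) (0, true)
  have h2 := hf (1, false) (1, true)
  have h3 := hf (0, false) (1, true)
  have h4 := hf (1, false) (0, true)
  simp only [bar, Bool.not_false, hxx, hyy, hxy, hyx, forall_true_left] at h1 h2 h3 h4
  clear hf hxx hyy hxy hyx
  have key : ∀ s : Letter, s = (0, false) ∨ s = (0, true) ∨ s = (1, false) ∨ s = (1, true) := by
    decide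
  rcases key r with rfl | rfl | rfl | rfl <;> rcases key s with rfl | rfl | rfl | rfl <;>
    rcases key t with rfl | rfl | rfl | rfl <;> simp_all

theorem exists_last_of_mem {α : Type*} {P : α → Prop} {L : List α} (h : ∃ e ∈ L, P e) :
    ∃ A e B, L = A ++ e :: B ∧ P e ∧ ∀ b ∈ B, ¬ P b := by
  induction L with
  | nil => simp at h
  | cons a L ih =>
    by_cases hL : ∃ e ∈ L, P e
    · obtain ⟨A, e, B, rfl, he, hB⟩ := ih hL
      exact ⟨a :: A, e, B, rfl, he, hB⟩
    · refine ⟨[], a, L, rfl, ?_, fun b hb hb' => hL ⟨b, hb, hb'⟩⟩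
      obtain ⟨e, he, hPe⟩ := h
      rcases List.mem_cons.1 he with rfl | he
      · exact hPe
      · exact absurd ⟨e, he, hPe⟩ hL

/-- Start the cycle at an element failing P and take the last one satisfying it. Its cyclic
successor fails P, being either the next entry or the starting one. -/
theorem exists_rotated_transition {P : ℤ × ℤ → Prop} {L : List (ℤ × ℤ)} (h1 : ∃ e ∈ L, P e)
    (h2 : ∃ f ∈ L, ¬ P f) : ∃ e f M, L ~r (f :: (M ++ [e])) ∧ P e ∧ ¬ P f := by
  obtain ⟨f, hf, hPf⟩ := h2
  obtain ⟨T, hT⟩ := exists_rotated_cons hf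
  obtain ⟨e, he, hPe⟩ := h1
  have heT : e ∈ T := by
    rcases List.mem_cons.1 (hT.mem_iff.1 he) with rfl | h
    · exact absurd hPe hPf
    · exact h
  obtain ⟨A, e', B, rfl, he', hB⟩ := exists_last_of_mem ⟨e, heT, hPe⟩
  cases B with
  | nil => exact ⟨e', f, A, hT, he', hPf⟩
  | cons b B =>
    refine ⟨e', b, B ++ f :: A, hT.trans ?_, he', hB b (by simp)⟩
    have := List.isRotated_append (l := f :: A ++ [e']) (l' := b :: B)
    simpa using this

/-- Where the sign of the x-exponent changes from that of x^{-ε} to that of x^ε, the y-syllable in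
between is entered and left so that x^ε becomes adjacent to both y and y⁻¹. Both kinds of change
occur on a cycle. -/
theorem CycRep.noCutVertex_of_mixed_fst {L : List (ℤ × ℤ)} {u : F₂} (h : CycRep L u)
    (hL : ∀ e ∈ L, e.1 ≠ 0) (h1 : ∃ e ∈ L, 0 < e.1) (h2 : ∃ e ∈ L, e.1 < 0) :
    NoCutVertex u := by
  have hb : ∀ (b c : Bool), b ≠ c → b = !c := by decide
  obtain ⟨f, hf, hf0⟩ := h2
  obtain ⟨f₁, hf₁, hf₁0⟩ := h1
  apply noCutVertex_of_alternating
  have key : ∀ a : Bool, ∀ b, HasTurn u (bar (0, a)) (1, b) ∨ HasTurn u (bar (1, b)) (0, a) := by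
    intro a b
    obtain ⟨e, g, M, hr, he, hg⟩ : ∃ (e g : ℤ × ℤ) (M : _), L ~r (g :: (M ++ [e])) ∧
        decide (0 < e.1) = (!a) ∧ decide (0 < g.1) = a := by
      obtain ⟨e, g, M, hr, he, hg⟩ := exists_rotated_transition
        (P := fun e : ℤ × ℤ => decide (0 < e.1) = !a) (L := L)
        (by cases a
            · exact ⟨f₁, hf₁, by simpa using hf₁0⟩
            · exact ⟨f, hf, by simpa using hf0.le⟩)
        (by cases a
            · exact ⟨f, hf, by simpa using hf0.le⟩
            · exact ⟨f₁, hf₁, by simpa using hf₁0⟩)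
      exact ⟨e, g, M, hr, he, by simpa using hb _ _ hg⟩
    have he' : e ∈ L := hr.mem_iff.2 (by simp)
    have hg' : g ∈ L := hr.mem_iff.2 (by simp)
    have t1 := h.hasTurn_xy he' (hL e he')
    have t2 := (h.rotate hr).hasTurn_yx (hL g hg')
    rw [he] at t1
    rw [hg] at t2
    by_cases hbe : b = decide (0 < e.2)
    · left; rw [hbe]; exact t1
    · right
      rw [hb _ _ hbe]
      simpa [bar] using t2
  exact key

theorem CycRep.noCutVertex_of_mixed_snd {L : List (ℤ × ℤ)} {u : F₂} (h : CycRep L u)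
    (hL : ∀ e ∈ L, e.1 ≠ 0) (h1 : ∃ e ∈ L, 0 < e.2) (h2 : ∃ e ∈ L, e.2 < 0) :
    NoCutVertex u := by
  have hb : ∀ (b c : Bool), b ≠ c → b = !c := by decide
  obtain ⟨f, hf, hf0⟩ := h2
  obtain ⟨f₁, hf₁, hf₁0⟩ := h1
  apply noCutVertex_of_alternating
  intro a b
  obtain ⟨e, g, M, hr, he, hg⟩ : ∃ (e g : ℤ × ℤ) (M : _), L ~r (g :: (M ++ [e])) ∧
      decide (0 < e.2) = (!b) ∧ decide (0 < g.2) = b := by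
    obtain ⟨e, g, M, hr, he, hg⟩ := exists_rotated_transition
      (P := fun e : ℤ × ℤ => decide (0 < e.2) = !b) (L := L)
      (by cases b
          · exact ⟨f₁, hf₁, by simpa using hf₁0⟩
          · exact ⟨f, hf, by simpa using hf0.le⟩)
      (by cases b
          · exact ⟨f, hf, by simpa using hf0.le⟩
          · exact ⟨f₁, hf₁, by simpa using hf₁0⟩)
    exact ⟨e, g, M, hr, he, by simpa using hb _ _ hg⟩
  have hg' : g ∈ L := hr.mem_iff.2 (by simp)
  have t1 := h.hasTurn_xy hg' (hL g hg')
  have t2 := (h.rotate hr).hasTurn_yx (hL g hg')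
  rw [he] at t2
  rw [hg] at t1
  by_cases hbe : a = decide (0 < g.1)
  · right; rw [hbe]; exact t2
  · left
    rw [hb _ _ hbe]
    simpa [bar] using t1

/-- Vanishing x-exponents are allowed here: since every y-exponent is positive, one x-syllable of
each sign, with its two neighbouring y-syllables, already supplies all four edges. -/
theorem CycRep.noCutVertex_of_pos_snd {L : List (ℤ × ℤ)} {u : F₂} (h : CycRep L u)
    (hL : ∀ e ∈ L, 0 < e.2) (h1 : ∃ e ∈ L, 0 < e.1) (h2 : ∃ e ∈ L, e.1 < 0) :
    NoCutVertex u := by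
  apply noCutVertex_of_alternating
  intro a b
  obtain ⟨e, he, he0, hea⟩ : ∃ e ∈ L, e.1 ≠ 0 ∧ decide (0 < e.1) = if b then !a else a := by
    obtain ⟨e, he, he0⟩ := h1
    obtain ⟨f, hf, hf0⟩ := h2
    cases a <;> cases b
    · exact ⟨f, hf, hf0.ne, by simpa using hf0.le⟩
    · exact ⟨e, he, he0.ne', by simpa using he0⟩
    · exact ⟨e, he, he0.ne', by simpa using he0⟩
    · exact ⟨f, hf, hf0.ne, by simpa using hf0.le⟩
  cases b
  · right
    obtain ⟨g, hg, ht⟩ := h.exists_hasTurn_yx he he0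
    rw [hea, decide_eq_true (hL g hg)] at ht
    simpa [bar] using ht
  · left
    have ht := h.hasTurn_xy he he0
    rw [hea, decide_eq_true (hL e he)] at ht
    simpa [bar] using ht

theorem CycRep.noCutVertex_of_squares {L : List (ℤ × ℤ)} {u : F₂} (h : CycRep L u)
    (hL : ∀ e ∈ L, 0 < e.1 ∧ 0 < e.2) (h1 : ∃ e ∈ L, 2 ≤ e.1) (h2 : ∃ e ∈ L, 2 ≤ e.2) :
    NoCutVertex u := by
  obtain ⟨e, he, he1⟩ := h1
  obtain ⟨f, hf, hf1⟩ := h2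
  have t1 := h.hasTurn_xy he (hL e he).1.ne'
  rw [decide_eq_true (hL e he).1, decide_eq_true (hL e he).2] at t1
  obtain ⟨g, hg, t2⟩ := h.exists_hasTurn_yx he (hL e he).1.ne'
  rw [decide_eq_true (hL e he).1, decide_eq_true (hL g hg).2] at t2
  exact KleinWords.noCutVertex_of_squares (h.hasTurn_xx he he1) (h.hasTurn_yy hf hf1) t1 t2

/-! ### Uniqueness of syllables and roots of cyclic words -/

theorem syllable_injective {i : Fin 2} {a b : ℤ} (ha : a ≠ 0) (hb : b ≠ 0)
    (h : syllable i a = syllable i b) : a = b := by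
  have h1 : a.natAbs = b.natAbs := by simpa [syllable] using congrArg List.length h
  have h2 := syllable_head? (i := i) ha
  rw [h, syllable_head? hb] at h2
  simp only [Option.some.injEq, Prod.mk.injEq, true_and] at h2
  by_cases h3 : 0 < a <;> by_cases h4 : 0 < b <;> simp_all <;> omega

theorem exists_syllable_append {D : List Letter} (hD : FreeGroup.IsReduced D) {s : Letter}
    (hs : D.head? = some s) : ∃ (a : ℤ) (E : List Letter), a ≠ 0 ∧ D = syllable s.1 a ++ E ∧
      ∀ t, E.head? = some t → t.1 ≠ s.1 := by
  induction D generalizing s with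
  | nil => simp at hs
  | cons c D ih =>
    obtain rfl : c = s := by simpa using hs
    have hsingle : ∃ e : ℤ, e ≠ 0 ∧ [c] = syllable c.1 e ∧ (e = 1 ∨ e = -1) ∧
        decide (0 < e) = c.2 := by
      obtain ⟨i, b⟩ := c
      cases b
      · exact ⟨-1, by decide, rfl, by decide, rfl⟩
      · exact ⟨1, by decide, rfl, by decide, rfl⟩
    obtain ⟨e, he0, he, he1, hec⟩ := hsingle
    by_cases hd : ∃ d, D.head? = some d ∧ d.1 = c.1
    · obtain ⟨d, hd, hdc⟩ := hd
      obtain ⟨a, E, ha, hDE, hE⟩ := ih (List.IsChain.right_of_append (l₁ := [c]) hD) hd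
      have hcd : c = d := by
        obtain ⟨D', rfl⟩ : ∃ D', D = d :: D' := by
          cases D with
          | nil => simp at hd
          | cons d' D' =>
            simp only [List.head?_cons, Option.some.injEq] at hd
            exact ⟨D', by rw [hd]⟩
        have := (List.isChain_cons_cons.1 hD).1 hdc.symm
        exact Prod.ext hdc.symm this
      subst hcd
      have hsgn : decide (0 < a) = decide (0 < e) := by
        rw [hDE, List.head?_append, syllable_head? ha] at hd
        simp only [Option.some_or, Option.some.injEq] at hd
        rw [hec, ← hd]
      refine ⟨a + e, E, ?_, ?_, hE⟩
      · rcases he1 with rfl | rfl <;> simp at hsgn <;> omega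
      · rw [hDE]
        have hn : (a + e).natAbs = a.natAbs + 1 := by
          rcases he1 with rfl | rfl <;> simp at hsgn <;> omega
        have hs2 : decide (0 < a + e) = decide (0 < a) := by
          rcases he1 with rfl | rfl <;> simp at hsgn ⊢ <;> omega
        have hc2 : decide (0 < a) = c.2 := by rw [hsgn, hec]
        rw [syllable, syllable, hn, hs2, hc2, List.replicate_succ]
        rfl
    · refine ⟨e, D, he0, ?_, ?_⟩
      · rw [← he]; rfl
      · intro t ht htc
        exact hd ⟨t, ht, htc⟩

theorem exists_expand_eq {D : List Letter} (hD : FreeGroup.IsReduced D)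
    (h0 : ∀ s, D.head? = some s → s.1 = 0) (h1 : ∀ s, D.getLast? = some s → s.1 = 1) :
    ∃ L, (∀ e ∈ L, e.1 ≠ 0 ∧ e.2 ≠ 0) ∧ expand L = D := by
  induction hn : D.length using Nat.strong_induction_on generalizing D with
  | _ n ih =>
    cases hs : D.head? with
    | none => exact ⟨[], by simp, by rw [List.head?_eq_none_iff.1 hs]; rfl⟩
    | some s =>
      obtain ⟨i, β⟩ := s
      obtain rfl : i = 0 := h0 _ hs
      obtain ⟨a, E, ha, rfl, hE⟩ := exists_syllable_append hD hs
      dsimp only at *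
      cases ht : E.head? with
      | none =>
        rw [List.head?_eq_none_iff.1 ht, List.append_nil] at h1
        have := h1 _ (syllable_getLast? ha)
        simp at this
      | some t =>
        have ht1 : t.1 = 1 := by
          have := hE t ht
          generalize t.1 = i at this
          revert i; decide
        obtain ⟨b, E', hb, rfl, hE'⟩ := exists_syllable_append
          (List.IsChain.right_of_append hD) ht
        obtain ⟨j, γ⟩ := t
        obtain rfl : j = 1 := ht1
        dsimp only at *
        obtain ⟨L, hL, hLE⟩ := ih E'.length (by
          have := List.length_pos_iff.2 (syllable_ne_nil (i := 0) ha)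
          simp only [List.length_append] at hn
          omega) (D := E') (List.IsChain.right_of_append (List.IsChain.right_of_append hD))
          (by
            intro s hs
            have := hE' s hs
            generalize s.1 = i at this
            revert i; decide)
          (by
            intro s hs
            apply h1
            rw [List.getLast?_append, List.getLast?_append, hs]; rfl) rfl
        refine ⟨(a, b) :: L, ?_, ?_⟩
        · intro e he
          rcases List.mem_cons.1 he with rfl | he
          · exact ⟨ha, hb⟩
          · exact hL e he
        · rw [expand_cons, hLE, List.append_assoc]

theorem append_inj_of_syllable {i : Fin 2} {a b : ℤ} {E F : List Letter} (ha : a ≠ 0) (hb : b ≠ 0)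
    (hE : ∀ t, E.head? = some t → t.1 ≠ i) (hF : ∀ t, F.head? = some t → t.1 ≠ i)
    (h : syllable i a ++ E = syllable i b ++ F) : a = b ∧ E = F := by
  have key : ∀ (a : ℤ) (E : List Letter), (∀ t, E.head? = some t → t.1 ≠ i) →
      (syllable i a ++ E).takeWhile (fun t => t.1 = i) = syllable i a := by
    intro a E hE
    rw [List.takeWhile_append_of_pos]
    · cases E with
      | nil => simp
      | cons t E => simp [hE t rfl]
    · intro t ht
      simp only [syllable, List.mem_replicate] at ht
      simp [ht.2]
  have h1 : syllable i a = syllable i b := by rw [← key a E hE, h, key b F hF]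
  rw [h1, List.append_cancel_left_eq] at h
  exact ⟨syllable_injective ha hb h1, h⟩

theorem expand_head?_fst {L : List (ℤ × ℤ)} (hL : ∀ e ∈ L, e.1 ≠ 0 ∧ e.2 ≠ 0) {s : Letter}
    (hs : (expand L).head? = some s) : s.1 = 0 := by
  cases L with
  | nil => simp [expand] at hs
  | cons e L =>
    rw [expand_cons, List.append_assoc, List.head?_append,
      syllable_head? (hL e (by simp)).1] at hs
    simp only [Option.some_or, Option.some.injEq] at hs
    rw [← hs]

theorem expand_getLast?_fst {L : List (ℤ × ℤ)} (hL : ∀ e ∈ L, e.1 ≠ 0 ∧ e.2 ≠ 0) {s : Letter}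
    (hs : (expand L).getLast? = some s) : s.1 = 1 := by
  rcases List.eq_nil_or_concat L with rfl | ⟨L', e, rfl⟩
  · simp [expand] at hs
  · rw [List.concat_eq_append] at hs hL
    unfold expand at hs
    rw [List.flatMap_append, List.getLast?_append] at hs
    simp only [List.flatMap_cons, List.flatMap_nil, List.append_nil,
      block_getLast? (hL e (by simp)).2, Option.some_or, Option.some.injEq] at hs
    rw [← hs]

theorem expand_injective {L M : List (ℤ × ℤ)} (hL : ∀ e ∈ L, e.1 ≠ 0 ∧ e.2 ≠ 0)
    (hM : ∀ e ∈ M, e.1 ≠ 0 ∧ e.2 ≠ 0) (h : expand L = expand M) : L = M := by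
  have hnil : ∀ (e : ℤ × ℤ) (L : List (ℤ × ℤ)), e.1 ≠ 0 → expand (e :: L) ≠ [] := by
    intro e L he
    simp [expand_cons, syllable_ne_nil he]
  induction L generalizing M with
  | nil =>
    cases M with
    | nil => rfl
    | cons f M => exact absurd h.symm (hnil f M (hM f (by simp)).1)
  | cons e L ih =>
    cases M with
    | nil => exact absurd h (hnil e L (hL e (by simp)).1)
    | cons f M =>
      have he := hL e (by simp)
      have hf := hM f (by simp)
      have hL' : ∀ e ∈ L, e.1 ≠ 0 ∧ e.2 ≠ 0 := fun e he => hL e (by simp [he])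
      have hM' : ∀ e ∈ M, e.1 ≠ 0 ∧ e.2 ≠ 0 := fun e he => hM e (by simp [he])
      rw [expand_cons, expand_cons, List.append_assoc, List.append_assoc] at h
      have hh : ∀ (b : ℤ) (N : List Letter), b ≠ 0 → ∀ t : Letter,
          (syllable 1 b ++ N).head? = some t → t.1 ≠ 0 := by
        intro b N hb t ht
        rw [List.head?_append, syllable_head? hb] at ht
        simp only [Option.some_or, Option.some.injEq] at ht
        rw [← ht]; simp
      obtain ⟨h1, h2⟩ := append_inj_of_syllable he.1 hf.1 (hh _ _ he.2) (hh _ _ hf.2) h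
      have hh2 : ∀ N : List (ℤ × ℤ), (∀ e ∈ N, e.1 ≠ 0 ∧ e.2 ≠ 0) → ∀ t : Letter,
          (expand N).head? = some t → t.1 ≠ 1 := by
        intro N hN t ht
        rw [expand_head?_fst hN ht]; decide
      obtain ⟨h3, h4⟩ := append_inj_of_syllable he.2 hf.2 (hh2 _ hL') (hh2 _ hM') h2
      rw [ih hL' hM' h4, Prod.ext h1 h3]

theorem compat_of_ne_zero {L : List (ℤ × ℤ)} (hL : ∀ e ∈ L, e.1 ≠ 0 ∧ e.2 ≠ 0) :
    ∀ e ∈ L, ∀ f ∈ L, Compat e f :=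
  fun e he f hf => ⟨(hL e he).2, (hL f hf).2, Or.inl (hL f hf).1⟩

theorem expand_flatten_replicate (k : ℕ) (L : List (ℤ × ℤ)) :
    expand (List.replicate k L).flatten = (List.replicate k (expand L)).flatten := by
  induction k with
  | zero => rfl
  | succ k ih =>
    rw [List.replicate_succ, List.flatten_cons, List.replicate_succ, List.flatten_cons, ← ih]
    simp [expand]

/-- Write w as a conjugate of its cyclic reduction D. The word of `L` is cyclically reduced, so the
conjugator is empty and the word equals D^k. D starts with an x-letter and ends with a y-letter,
hence splits into whole syllable pairs. -/
theorem exists_root_of_W_eq_pow {L : List (ℤ × ℤ)} (hL : ∀ e ∈ L, e.1 ≠ 0 ∧ e.2 ≠ 0)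
    {w : F₂} {k : ℕ} (hk : k ≠ 0) (h : W x y L = w ^ k) :
    ∃ L', L = (List.replicate k L').flatten := by
  have hc := isCyclicallyReduced_expand (compat_of_ne_zero hL)
  have hw : IsReduced.{0} w.toWord := isReduced_toWord
  have h1 : expand L = reduceCyclically.conjugator w.toWord ++
      (List.replicate k (reduceCyclically w.toWord)).flatten ++
      invRev (reduceCyclically.conjugator w.toWord) := by
    have := congrArg toWord h
    rwa [← mk_expand, toWord_mk, hc.isReduced.reduce_eq, toWord_pow,
      reduceCyclically.reduce_flatten_replicate hw, if_neg hk] at this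
  have hD := reduceCyclically.isCyclicallyReduced hw
  generalize reduceCyclically w.toWord = D at h1 hD
  cases hcj : reduceCyclically.conjugator w.toWord with
  -- A nonempty conjugator would make the first and last letters of the word mutually inverse.
  | cons a C =>
    exfalso
    rw [hcj] at h1
    have hhead : (expand L).head? = some a := by rw [h1]; rfl
    have hlast : (expand L).getLast? = some (bar a) := by
      rw [h1, List.getLast?_append]; simp [invRev, bar]
    have := hc.2 _ hlast _ hhead rfl
    simp [bar] at this
  | nil =>
    simp only [hcj, List.nil_append, invRev_empty, List.append_nil] at h1
    obtain ⟨k, rfl⟩ := Nat.exists_eq_succ_of_ne_zero hk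
    obtain ⟨L', hL', rfl⟩ := exists_expand_eq (D := D) hD.isReduced
      (by
        intro s hs
        refine expand_head?_fst hL ?_
        rw [h1, List.replicate_succ, List.flatten_cons, List.head?_append, hs]; rfl)
      (by
        intro s hs
        refine expand_getLast?_fst hL ?_
        rw [h1, List.replicate_succ', List.flatten_append, List.getLast?_append]
        simp [hs])
    refine ⟨L', expand_injective hL ?_ ?_⟩
    · intro e he
      obtain ⟨l, hl, hel⟩ := List.mem_flatten.1 he
      rw [List.mem_replicate] at hl
      exact hL' e (hl.2 ▸ hel)
    · rw [h1, expand_flatten_replicate]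

theorem countP_flatten_replicate (P : ℤ × ℤ → Bool) (k : ℕ) (L : List (ℤ × ℤ)) :
    (List.replicate k L).flatten.countP P = k * L.countP P := by
  simp [List.countP_flatten]

/-- Periodicity of the syllable list makes the exponent k divide every count of syllables; `P` and
`Q` select two types with coprime counts. -/
theorem not_isPower_of_coprime_countP {g h u : F₂} (hb : IsBasisPair g h) {L : List (ℤ × ℤ)}
    (hu : IsConj u (W g h L)) (hL : ∀ e ∈ L, e.1 ≠ 0 ∧ e.2 ≠ 0) (P Q : ℤ × ℤ → Bool)
    (hPQ : (L.countP P).Coprime (L.countP Q)) : ¬ IsPower u := by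
  intro hp
  obtain ⟨e, rfl, rfl⟩ := hb.exists_equiv
  have h1 := (hp.of_isConj hu).map e.symm
  rw [map_W, MulEquiv.symm_apply_apply, MulEquiv.symm_apply_apply] at h1
  obtain ⟨w, k, -, hk, h2⟩ := h1
  obtain ⟨L', rfl⟩ := exists_root_of_W_eq_pow hL (by omega) h2
  rw [countP_flatten_replicate, countP_flatten_replicate] at hPQ
  have : k = 1 := Nat.eq_one_of_dvd_coprimes hPQ (dvd_mul_right _ _) (dvd_mul_right _ _)
  omega

theorem not_isPower_of_countP_eq_one {g h u : F₂} (hb : IsBasisPair g h) {L : List (ℤ × ℤ)}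
    (hu : IsConj u (W g h L)) (hL : ∀ e ∈ L, e.1 ≠ 0 ∧ e.2 ≠ 0) (P : ℤ × ℤ → Bool)
    (hP : L.countP P = 1) : ¬ IsPower u :=
  not_isPower_of_coprime_countP hb hu hL P P (by rw [hP]; decide)

/-! ### Exponent tests in an arbitrary basis -/

theorem not_isPrimitive_of_equiv {u : F₂} (e : F₂ ≃* F₂) (h : NoCutVertex (e u)) :
    ¬ IsPrimitive u :=
  fun hp => not_isPrimitive_of_noCutVertex h (hp.map e)

theorem cycRep_of_isConj {g h u : F₂} {e : F₂ ≃* F₂} (hg : e x = g) (hh : e y = h)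
    {L : List (ℤ × ℤ)} (hu : IsConj u (W g h L)) (hL : ∀ e ∈ L, ∀ f ∈ L, Compat e f) :
    CycRep L (e.symm u) := by
  subst hg hh
  refine ⟨hL, ?_⟩
  have := (e.symm : F₂ →* F₂).map_isConj hu.symm
  simpa [map_W] using this

theorem not_isPrimitive_of_mixed_fst {g h u : F₂} (hb : IsBasisPair g h) {L : List (ℤ × ℤ)}
    (hu : IsConj u (W g h L)) (hL : ∀ e ∈ L, e.1 ≠ 0 ∧ e.2 ≠ 0) (h1 : ∃ e ∈ L, 0 < e.1)
    (h2 : ∃ e ∈ L, e.1 < 0) : ¬ IsPrimitive u := by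
  obtain ⟨e, hg, hh⟩ := hb.exists_equiv
  exact not_isPrimitive_of_equiv e.symm ((cycRep_of_isConj hg hh hu
    (compat_of_ne_zero hL)).noCutVertex_of_mixed_fst (fun e he => (hL e he).1) h1 h2)

theorem not_isPrimitive_of_mixed_snd {g h u : F₂} (hb : IsBasisPair g h) {L : List (ℤ × ℤ)}
    (hu : IsConj u (W g h L)) (hL : ∀ e ∈ L, e.1 ≠ 0 ∧ e.2 ≠ 0) (h1 : ∃ e ∈ L, 0 < e.2)
    (h2 : ∃ e ∈ L, e.2 < 0) : ¬ IsPrimitive u := by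
  obtain ⟨e, hg, hh⟩ := hb.exists_equiv
  exact not_isPrimitive_of_equiv e.symm ((cycRep_of_isConj hg hh hu
    (compat_of_ne_zero hL)).noCutVertex_of_mixed_snd (fun e he => (hL e he).1) h1 h2)

theorem W_neg_fst (g h : F₂) (L : List (ℤ × ℤ)) :
    W g h L = W g⁻¹ h (L.map fun e => (-e.1, e.2)) := by
  simp [W, Function.comp_def]

theorem W_neg_snd (g h : F₂) (L : List (ℤ × ℤ)) :
    W g h L = W g h⁻¹ (L.map fun e => (e.1, -e.2)) := by
  simp [W, Function.comp_def]

theorem not_isPrimitive_of_squares_of_pos {g h u : F₂} (hb : IsBasisPair g h)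
    {L : List (ℤ × ℤ)} (hu : IsConj u (W g h L)) (hL : ∀ e ∈ L, 0 < e.1 ∧ 0 < e.2)
    (h1 : ∃ e ∈ L, 2 ≤ e.1) (h2 : ∃ e ∈ L, 2 ≤ e.2) : ¬ IsPrimitive u := by
  obtain ⟨e, hg, hh⟩ := hb.exists_equiv
  exact not_isPrimitive_of_equiv e.symm ((cycRep_of_isConj hg hh hu
    (compat_of_ne_zero fun e he => ⟨(hL e he).1.ne', (hL e he).2.ne'⟩)).noCutVertex_of_squares
      hL h1 h2)

/-- A cyclic word whose syllables are all nontrivial and in which neither generator has only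
exponents `±1` is not primitive. -/
theorem not_isPrimitive_of_squares {g h u : F₂} (hb : IsBasisPair g h) {L : List (ℤ × ℤ)}
    (hu : IsConj u (W g h L)) (hL : ∀ e ∈ L, e.1 ≠ 0 ∧ e.2 ≠ 0)
    (h1 : ∃ e ∈ L, 2 ≤ |e.1|) (h2 : ∃ e ∈ L, 2 ≤ |e.2|) : ¬ IsPrimitive u := by
  by_cases hm1 : (∃ e ∈ L, 0 < e.1) ∧ ∃ e ∈ L, e.1 < 0
  · exact not_isPrimitive_of_mixed_fst hb hu hL hm1.1 hm1.2
  by_cases hm2 : (∃ e ∈ L, 0 < e.2) ∧ ∃ e ∈ L, e.2 < 0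
  · exact not_isPrimitive_of_mixed_snd hb hu hL hm2.1 hm2.2
  -- With mixed signs excluded, each generator has exponents of one sign. Replacing h, and below
  -- also g, by its inverse reduces to positive words.
  have reduce_snd : ∀ {g h : F₂} {L : List (ℤ × ℤ)}, IsBasisPair g h → IsConj u (W g h L) →
      (∀ e ∈ L, 0 < e.1 ∧ e.2 ≠ 0) → (∃ e ∈ L, 2 ≤ |e.1|) → (∃ e ∈ L, 2 ≤ |e.2|) →
      ¬ ((∃ e ∈ L, 0 < e.2) ∧ ∃ e ∈ L, e.2 < 0) → ¬ IsPrimitive u := by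
    intro g h L hb hu hL h1 h2 hm
    obtain ⟨e, he, he1⟩ := h1
    obtain ⟨f, hf, hf1⟩ := h2
    by_cases hpos : ∃ e ∈ L, 0 < e.2
    · have hall : ∀ e ∈ L, 0 < e.1 ∧ 0 < e.2 := by
        intro e he
        refine ⟨(hL e he).1, ?_⟩
        by_contra hc
        have := (hL e he).2
        exact hm ⟨hpos, e, he, by omega⟩
      refine not_isPrimitive_of_squares_of_pos hb hu hall ⟨e, he, ?_⟩ ⟨f, hf, ?_⟩
      · rwa [abs_of_pos (hall e he).1] at he1
      · rwa [abs_of_pos (hall f hf).2] at hf1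
    · have hall : ∀ e ∈ L, 0 < e.1 ∧ e.2 < 0 := by
        intro e he
        refine ⟨(hL e he).1, ?_⟩
        by_contra hc
        have := (hL e he).2
        exact hpos ⟨e, he, by omega⟩
      rw [W_neg_snd] at hu
      refine not_isPrimitive_of_squares_of_pos hb.inv_right hu ?_ ⟨_, List.mem_map_of_mem he, ?_⟩
        ⟨_, List.mem_map_of_mem hf, ?_⟩
      · intro e he
        obtain ⟨e', he', rfl⟩ := List.mem_map.1 he
        have := hall e' he'
        exact ⟨this.1, by simpa using this.2⟩
      · rwa [abs_of_pos (hall e he).1] at he1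
      · rwa [abs_of_neg (hall f hf).2] at hf1
  by_cases hpos : ∃ e ∈ L, 0 < e.1
  · refine reduce_snd hb hu ?_ h1 h2 hm2
    intro e he
    refine ⟨?_, (hL e he).2⟩
    by_contra hc
    have := (hL e he).1
    exact hm1 ⟨hpos, e, he, by omega⟩
  · rw [W_neg_fst] at hu
    refine reduce_snd hb.inv_left hu ?_ ?_ ?_ ?_
    · intro e he
      obtain ⟨e', he', rfl⟩ := List.mem_map.1 he
      have := hL e' he'
      refine ⟨?_, this.2⟩
      by_contra hc
      have h3 := this.1
      simp only [Left.neg_pos_iff] at hc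
      exact hpos ⟨e', he', by omega⟩
    · obtain ⟨e, he, he1⟩ := h1
      exact ⟨_, List.mem_map_of_mem he, by simpa using he1⟩
    · obtain ⟨e, he, he1⟩ := h2
      exact ⟨_, List.mem_map_of_mem he, by simpa using he1⟩
    · rintro ⟨⟨e, he, he1⟩, f, hf, hf1⟩
      obtain ⟨e', he', rfl⟩ := List.mem_map.1 he
      obtain ⟨f', hf', rfl⟩ := List.mem_map.1 hf
      exact hm2 ⟨⟨e', he', he1⟩, f', hf', hf1⟩

/-- The product `g ^ a₁ h g ^ a₂ h ⋯`. -/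
def V (g h : F₂) (l : List ℤ) : F₂ := (l.map fun a => g ^ a * h).prod

@[simp] theorem V_nil (g h : F₂) : V g h [] = 1 := rfl

@[simp] theorem V_cons (g h : F₂) (a : ℤ) (l : List ℤ) :
    V g h (a :: l) = g ^ a * h * V g h l := by simp [V]

@[simp] theorem V_append (g h : F₂) (l m : List ℤ) : V g h (l ++ m) = V g h l * V g h m := by
  simp [V]

@[simp] theorem V_flatten_replicate (g h : F₂) (m : ℕ) (l : List ℤ) :
    V g h (List.replicate m l).flatten = V g h l ^ m := by
  induction m with
  | zero => simp
  | succ m ih => simp [List.replicate_succ, ih, pow_succ']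

/-- Replacing h by g^k h lowers every exponent of g by k; this is how exponents are made nonzero or
of both signs. -/
theorem V_eq_W (g h : F₂) (l : List ℤ) (k : ℤ) :
    V g h l = W g (g ^ k * h) (l.map fun a => (a - k, 1)) := by
  simp only [V, W, List.map_map, Function.comp_def, zpow_one]
  congr 2
  funext a
  rw [← mul_assoc, ← zpow_add, sub_add_cancel]

/-- If the exponents of one generator are all `1` and those of the other differ by at least two,
the cyclic word is not primitive. -/
theorem not_isPrimitive_of_spread {g h u : F₂} (hb : IsBasisPair g h) {l : List ℤ}
    (hu : IsConj u (V g h l)) {a b : ℤ} (ha : a ∈ l) (hb' : b ∈ l) (hab : a + 2 ≤ b) :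
    ¬ IsPrimitive u := by
  -- The shift by a + 1 sends a to −1 and b to a positive number, so both signs occur.
  rw [V_eq_W g h l (a + 1)] at hu
  obtain ⟨e, hg, hh⟩ := (hb.zpow_mul (a + 1)).exists_equiv
  have hpos : ∀ e ∈ l.map (fun c => (c - (a + 1), (1 : ℤ))), 0 < e.2 := by
    intro e he
    obtain ⟨c, hc, rfl⟩ := List.mem_map.1 he
    exact one_pos
  refine not_isPrimitive_of_equiv e.symm ((cycRep_of_isConj hg hh hu
    (fun e he f hf => ⟨(hpos e he).ne', (hpos f hf).ne', Or.inr ⟨hpos e he, hpos f hf⟩⟩)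
      ).noCutVertex_of_pos_snd hpos ⟨_, List.mem_map_of_mem hb', ?_⟩
        ⟨_, List.mem_map_of_mem ha, ?_⟩)
  · show 0 < b - (a + 1)
    omega
  · show a - (a + 1) < 0
    omega

theorem not_isPower_of_coprime_count {g h u : F₂} (hb : IsBasisPair g h) {l : List ℤ}
    (hu : IsConj u (V g h l)) (a b : ℤ) (hab : (l.count a).Coprime (l.count b)) :
    ¬ IsPower u := by
  -- Shifting by a number below all exponents makes every syllable nontrivial, as the counting test
  -- requires.
  obtain ⟨K, hK⟩ : ∃ K : ℤ, ∀ c ∈ l, K < c := by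
    have hfin : (↑l.toFinset : Set ℤ).Finite := Finset.finite_toSet _
    obtain ⟨K, hK⟩ := hfin.bddBelow
    exact ⟨K - 1, fun c hc => by have := hK (show c ∈ _ by simpa using hc); omega⟩
  rw [V_eq_W g h l K] at hu
  have hc : ∀ a : ℤ, (l.map fun c => (c - K, (1 : ℤ))).countP (fun e => e.1 == a - K) =
      l.count a := by
    intro a
    rw [List.countP_map, List.count]
    congr 1
    funext c
    simp
  refine not_isPower_of_coprime_countP (hb.zpow_mul K) hu ?_ (fun e => e.1 == a - K)
    (fun e => e.1 == b - K) (by rwa [hc, hc])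
  intro e he
  obtain ⟨c, hc, rfl⟩ := List.mem_map.1 he
  have := hK c hc
  exact ⟨by simp only; omega, one_ne_zero⟩

theorem not_isPower_of_count_eq_one {g h u : F₂} (hb : IsBasisPair g h) {l : List ℤ}
    (hu : IsConj u (V g h l)) (a : ℤ) (ha : l.count a = 1) : ¬ IsPower u :=
  not_isPower_of_coprime_count hb hu a a (by rw [ha]; decide)

/-! ### Conjugacy up to inversion and the shape of normal forms -/

/-- `u` or its inverse is conjugate to `v`. -/
def SameClass (u v : F₂) : Prop := IsConj u v ∨ IsConj u⁻¹ v

theorem SameClass.isPrimitive {u v : F₂} (h : SameClass u v) (hv : IsPrimitive v) :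
    IsPrimitive u := by
  rcases h with h | h
  · exact hv.of_isConj h.symm
  · simpa using (hv.of_isConj h.symm).inv

theorem SameClass.isPower {u v : F₂} (h : SameClass u v) (hv : IsPower v) : IsPower u := by
  rcases h with h | h
  · exact hv.of_isConj h.symm
  · simpa using (hv.of_isConj h.symm).inv

theorem SameClass.not_isPrimitive {u v : F₂} (h : SameClass u v) (hv : ¬ IsPrimitive v) :
    ¬ IsPrimitive u := by
  intro hu
  rcases h with h | h
  · exact hv (hu.of_isConj h)
  · exact hv (hu.inv.of_isConj h)

theorem SameClass.not_isPower {u v : F₂} (h : SameClass u v) (hv : ¬ IsPower v) :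
    ¬ IsPower u := by
  intro hu
  rcases h with h | h
  · exact hv (hu.of_isConj h)
  · exact hv (hu.inv.of_isConj h)

/-- `u` is neither primitive nor a power. -/
def IsNeither (u : F₂) : Prop := ¬ IsPrimitive u ∧ ¬ IsPower u

theorem sameClass_of_eq {u v : F₂} (c : F₂) (h : c * u * c⁻¹ = v) : SameClass u v :=
  Or.inl (isConj_iff.2 ⟨c, h⟩)

theorem sameClass_of_inv_eq {u v : F₂} (c : F₂) (h : c * u⁻¹ * c⁻¹ = v) : SameClass u v :=
  Or.inr (isConj_iff.2 ⟨c, h⟩)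

/-- The element d conjugates the block M to B, and `hd` identifies the remaining cyclic factor G F
with d C A d⁻¹. Thus F B^m G is conjugate to A M^m C, and only two identities independent of m need
checking. -/
theorem sameClass_W {g h u B : F₂} {A M C : List (ℤ × ℤ)} {m : ℕ} (F G d : F₂)
    (hu : u = F * B ^ m * G ∨ u⁻¹ = F * B ^ m * G) (hB : d * W g h M = B * d)
    (hd : d * (W g h C * W g h A) = G * F * d) :
    SameClass u (W g h (A ++ (List.replicate m M).flatten ++ C)) := by
  have hB' : W g h M ^ m = d⁻¹ * B ^ m * d := by
    have h1 : W g h M = d⁻¹ * B * d⁻¹⁻¹ := by rw [inv_inv, mul_assoc, ← hB, inv_mul_cancel_left]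
    rw [h1, conj_pow, inv_inv]
  have hG : G = d * W g h C * W g h A * d⁻¹ * F⁻¹ := by
    rw [mul_assoc d, hd]; group
  have h1 : W g h A * d⁻¹ * F⁻¹ * (F * B ^ m * G) * (W g h A * d⁻¹ * F⁻¹)⁻¹ =
      W g h (A ++ (List.replicate m M).flatten ++ C) := by
    rw [W_append, W_append, W_flatten_replicate, hB', hG]
    generalize B ^ m = T
    group
  rcases hu with hu | hu
  · exact sameClass_of_eq (W g h A * d⁻¹ * F⁻¹) (by rw [hu, h1])
  · exact sameClass_of_inv_eq (W g h A * d⁻¹ * F⁻¹) (by rw [hu, h1])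

theorem sameClass_V {g h u B : F₂} {A M C : List ℤ} {m : ℕ} (F G d : F₂)
    (hu : u = F * B ^ m * G ∨ u⁻¹ = F * B ^ m * G) (hB : d * V g h M = B * d)
    (hd : d * (V g h C * V g h A) = G * F * d) :
    SameClass u (V g h (A ++ (List.replicate m M).flatten ++ C)) := by
  have hB' : V g h M ^ m = d⁻¹ * B ^ m * d := by
    have h1 : V g h M = d⁻¹ * B * d⁻¹⁻¹ := by rw [inv_inv, mul_assoc, ← hB, inv_mul_cancel_left]
    rw [h1, conj_pow, inv_inv]
  have hG : G = d * V g h C * V g h A * d⁻¹ * F⁻¹ := by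
    rw [mul_assoc d, hd]; group
  have h1 : V g h A * d⁻¹ * F⁻¹ * (F * B ^ m * G) * (V g h A * d⁻¹ * F⁻¹)⁻¹ =
      V g h (A ++ (List.replicate m M).flatten ++ C) := by
    rw [V_append, V_append, V_flatten_replicate, hB', hG]
    generalize B ^ m = T
    group
  rcases hu with hu | hu
  · exact sameClass_of_eq (V g h A * d⁻¹ * F⁻¹) (by rw [hu, h1])
  · exact sameClass_of_inv_eq (V g h A * d⁻¹ * F⁻¹) (by rw [hu, h1])

theorem zpow_natCast_succ (B : F₂) (m : ℕ) : B ^ ((m : ℤ) + 1) = B * B ^ m := by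
  rw [← Nat.cast_succ, zpow_natCast, pow_succ']

theorem zpow_neg_natCast_succ (B : F₂) (m : ℕ) : B ^ (-((m : ℤ) + 1)) = (B * B ^ m)⁻¹ := by
  rw [zpow_neg, zpow_natCast_succ]

/-! ### Leading factors and repeated blocks of the four families -/

/-- The initial factor of `c₀'`. -/
def lead₀' (p _q : ℤ) : F₂ := x ^ p

/-- The block repeated in `c₀'`. -/
def block₀' (p q : ℤ) : F₂ :=
  x ^ (p + 1) * y * x ^ p * y ^ (q + 1) * x ^ p * y

theorem c₀'_eq (n p q : ℤ) : c₀' n p q = lead₀' p q * block₀' p q ^ n := rfl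

theorem c₀'_succ (m : ℕ) (p q : ℤ) :
    c₀' (m + 1) p q = lead₀' p q * (block₀' p q * block₀' p q ^ m) := by
  rw [c₀'_eq, zpow_natCast_succ]

theorem c₀'_neg_succ (m : ℕ) (p q : ℤ) : (c₀' (-(m + 1)) p q)⁻¹ =
    block₀' p q * block₀' p q ^ m * (lead₀' p q)⁻¹ := by
  rw [c₀'_eq, zpow_neg_natCast_succ, mul_inv_rev, inv_inv]

/-- The initial factor of `c₀''`. -/
def lead₀'' (p _q : ℤ) : F₂ := x ^ p * y * x * y

/-- The block repeated in `c₀''`. -/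
def block₀'' (p q : ℤ) : F₂ :=
  y⁻¹ * x ^ p * y * x ^ p * y ^ q * x ^ p * y * x ^ p * y⁻¹ * x ^ (-p)

theorem c₀''_eq (n p q : ℤ) : c₀'' n p q = lead₀'' p q * block₀'' p q ^ n := rfl

theorem c₀''_succ (m : ℕ) (p q : ℤ) :
    c₀'' (m + 1) p q = lead₀'' p q * (block₀'' p q * block₀'' p q ^ m) := by
  rw [c₀''_eq, zpow_natCast_succ]

theorem c₀''_neg_succ (m : ℕ) (p q : ℤ) : (c₀'' (-(m + 1)) p q)⁻¹ =
    block₀'' p q * block₀'' p q ^ m * (lead₀'' p q)⁻¹ := by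
  rw [c₀''_eq, zpow_neg_natCast_succ, mul_inv_rev, inv_inv]

/-- The initial factor of `c₁'`. -/
def lead₁' (p q : ℤ) : F₂ := y * x ^ (-p) * y⁻¹ * x ^ (-p) * y ^ (-q)

/-- The block repeated in `c₁'`. -/
def block₁' (p q : ℤ) : F₂ :=
  y ^ (q + 1) * x ^ p * y * x ^ (p + 1) * y * x ^ p

theorem c₁'_eq (n p q : ℤ) : c₁' n p q = lead₁' p q * block₁' p q ^ n := rfl

theorem c₁'_succ (m : ℕ) (p q : ℤ) :
    c₁' (m + 1) p q = lead₁' p q * (block₁' p q * block₁' p q ^ m) := by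
  rw [c₁'_eq, zpow_natCast_succ]

theorem c₁'_neg_succ (m : ℕ) (p q : ℤ) : (c₁' (-(m + 1)) p q)⁻¹ =
    block₁' p q * block₁' p q ^ m * (lead₁' p q)⁻¹ := by
  rw [c₁'_eq, zpow_neg_natCast_succ, mul_inv_rev, inv_inv]

/-- The initial factor of `c₁''`. -/
def lead₁'' (p q : ℤ) : F₂ := y ^ (-q) * x ^ (-p) * y⁻¹ * x ^ (-p)

/-- The block repeated in `c₁''`. -/
def block₁'' (p q : ℤ) : F₂ :=
  x ^ p * y * x ^ p * y ^ q * x ^ p * y * x ^ p * y⁻¹ * x ^ (-p) * y⁻¹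

theorem c₁''_eq (n p q : ℤ) : c₁'' n p q = lead₁'' p q * block₁'' p q ^ n := rfl

theorem c₁''_succ (m : ℕ) (p q : ℤ) :
    c₁'' (m + 1) p q = lead₁'' p q * (block₁'' p q * block₁'' p q ^ m) := by
  rw [c₁''_eq, zpow_natCast_succ]

theorem c₁''_neg_succ (m : ℕ) (p q : ℤ) : (c₁'' (-(m + 1)) p q)⁻¹ =
    block₁'' p q * block₁'' p q ^ m * (lead₁'' p q)⁻¹ := by
  rw [c₁''_eq, zpow_neg_natCast_succ, mul_inv_rev, inv_inv]

/-! ### Normal forms of the words for positive and negative n -/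

theorem c₀'_succ_W (m : ℕ) (p q : ℤ) : SameClass (c₀' (m + 1) p q)
    (W x y ([(2 * p + 1, 1), (p, q + 1), (p, 1)] ++
      (List.replicate m [(p + 1, 1), (p, q + 1), (p, 1)]).flatten ++ [])) := by
  refine sameClass_W (B := block₀' p q)
    (lead₀' p q * block₀' p q) 1 1
    (Or.inl ?_) ?_ ?_
  · rw [c₀'_succ]
    group
  all_goals
    simp only [lead₀', block₀', W_cons, W_nil, zpow_neg, zpow_ofNat, zpow_one, pow_succ,
      pow_zero, one_mul]
    group

/-- For q = 0 all exponents of y are 1, so the spread test becomes available. -/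
theorem c₀'_succ_V_zero (m : ℕ) (p : ℤ) : SameClass (c₀' (m + 1) p 0)
    (V x y ([2 * p + 1, p, p] ++
      (List.replicate m [p + 1, p, p]).flatten ++ [])) := by
  refine sameClass_V (B := block₀' p 0)
    (lead₀' p 0 * block₀' p 0) 1 1
    (Or.inl ?_) ?_ ?_
  · rw [c₀'_succ]
    group
  all_goals
    simp only [lead₀', block₀', V_cons, V_nil, zpow_neg, zpow_ofNat, zpow_one, pow_succ,
      pow_zero, one_mul]
    group

theorem c₀'_succ_V_neg_one (m : ℕ) (p : ℤ) : SameClass (c₀' (m + 1) p (-1))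
    (V x y ([2 * p + 1, 2 * p] ++
      (List.replicate m [p + 1, 2 * p]).flatten ++ [])) := by
  refine sameClass_V (B := block₀' p (-1))
    (lead₀' p (-1) * block₀' p (-1)) 1 1
    (Or.inl ?_) ?_ ?_
  · rw [c₀'_succ]
    group
  all_goals
    simp only [lead₀', block₀', V_cons, V_nil, zpow_neg, zpow_ofNat, zpow_one, pow_succ,
      pow_zero, one_mul]
    group

theorem c₀'_succ_V_of_neg_one (m : ℕ) (q : ℤ) : SameClass (c₀' (m + 1) (-1) q)
    (V y x⁻¹ ([1, q + 1] ++
      (List.replicate m [2, q + 1]).flatten ++ [1])) := by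
  refine sameClass_V (B := block₀' (-1) q)
    (lead₀' (-1) q * block₀' (-1) q) 1 y⁻¹
    (Or.inl ?_) ?_ ?_
  · rw [c₀'_succ]
    group
  all_goals
    simp only [lead₀', block₀', V_cons, V_nil, zpow_neg, zpow_ofNat, zpow_one, pow_succ,
      pow_zero, one_mul]
    group

/-- In the basis (y, x⁻¹) only the exponents 1 and 2 occur, with no spread. In (x⁻¹y, y) the leading
factor merges two blocks into a single exponent 5, which is why two blocks are split off. -/
theorem c₀'_succ_succ_neg_one_zero (m : ℕ) : SameClass (c₀' (m + 1 + 1) (-1) 0)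
    (V (x⁻¹ * y) y ([5] ++
      (List.replicate m [2]).flatten ++ [])) := by
  refine sameClass_V (B := block₀' (-1) 0)
    (lead₀' (-1) 0 * block₀' (-1) 0) (block₀' (-1) 0) y
    (Or.inl ?_) ?_ ?_
  · have h := c₀'_succ (m + 1) (-1) 0
    push_cast at h
    rw [h]
    group
  all_goals
    simp only [lead₀', block₀', V_cons, V_nil, zpow_neg, zpow_ofNat, zpow_one, pow_succ,
      pow_zero, one_mul]
    group

theorem c₀'_succ_neg_one_one (m : ℕ) : SameClass (c₀' (m + 1) (-1) 1)
    (V (x⁻¹ * y) y ([3] ++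
      (List.replicate m [1, 1]).flatten ++ [])) := by
  refine sameClass_V (B := block₀' (-1) 1)
    (lead₀' (-1) 1 * block₀' (-1) 1) 1 (y⁻¹ * x)
    (Or.inl ?_) ?_ ?_
  · rw [c₀'_succ]
    group
  all_goals
    simp only [lead₀', block₀', V_cons, V_nil, zpow_neg, zpow_ofNat, zpow_one, pow_succ,
      pow_zero, one_mul]
    group
  all_goals simp only [zpow_ofNat, pow_succ, pow_zero, one_mul, mul_assoc]

theorem c₀'_neg_succ_W (m : ℕ) (p q : ℤ) : SameClass (c₀' (-(m + 1)) p q)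
    (W x y ([(1, 1), (p, q + 1), (p, 1)] ++
      (List.replicate m [(p + 1, 1), (p, q + 1), (p, 1)]).flatten ++ [])) := by
  refine sameClass_W (B := block₀' p q)
    (block₀' p q) ((lead₀' p q)⁻¹) 1
    (Or.inr ?_) ?_ ?_
  · exact c₀'_neg_succ m p q
  all_goals
    simp only [lead₀', block₀', W_cons, W_nil, zpow_neg, zpow_ofNat, zpow_one, pow_succ,
      pow_zero, one_mul]
    group

theorem c₀'_neg_succ_V_zero (m : ℕ) (p : ℤ) : SameClass (c₀' (-(m + 1)) p 0)
    (V x y ([1, p, p] ++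
      (List.replicate m [p + 1, p, p]).flatten ++ [])) := by
  refine sameClass_V (B := block₀' p 0)
    (block₀' p 0) ((lead₀' p 0)⁻¹) 1
    (Or.inr ?_) ?_ ?_
  · exact c₀'_neg_succ m p 0
  all_goals
    simp only [lead₀', block₀', V_cons, V_nil, zpow_neg, zpow_ofNat, zpow_one, pow_succ,
      pow_zero, one_mul]
    group

theorem c₀'_neg_succ_V_neg_one (m : ℕ) (p : ℤ) : SameClass (c₀' (-(m + 1)) p (-1))
    (V x y ([1, 2 * p] ++
      (List.replicate m [p + 1, 2 * p]).flatten ++ [])) := by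
  refine sameClass_V (B := block₀' p (-1))
    (block₀' p (-1)) ((lead₀' p (-1))⁻¹) 1
    (Or.inr ?_) ?_ ?_
  · exact c₀'_neg_succ m p (-1)
  all_goals
    simp only [lead₀', block₀', V_cons, V_nil, zpow_neg, zpow_ofNat, zpow_one, pow_succ,
      pow_zero, one_mul]
    group

theorem c₀'_neg_succ_W_of_neg_one (m : ℕ) (q : ℤ) : SameClass (c₀' (-(m + 1)) (-1) q)
    (W x y ([(1, 1), (-1, q + 1)] ++
      (List.replicate m [(-1, 2), (-1, q + 1)]).flatten ++ [(-1, 1)])) := by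
  refine sameClass_W (B := block₀' (-1) q)
    (block₀' (-1) q) ((lead₀' (-1) q)⁻¹) (y⁻¹ * x)
    (Or.inr ?_) ?_ ?_
  · exact c₀'_neg_succ m (-1) q
  all_goals
    simp only [lead₀', block₀', W_cons, W_nil, zpow_neg, zpow_ofNat, zpow_one, pow_succ,
      pow_zero, one_mul]
    group

theorem c₀'_neg_succ_succ_one_zero (m : ℕ) : SameClass (c₀' (-(m + 1 + 1)) 1 0)
    (V (x * y) x ([6] ++
      (List.replicate m [3]).flatten ++ [])) := by
  refine sameClass_V (B := block₀' 1 0)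
    (block₀' 1 0) (block₀' 1 0 * (lead₀' 1 0)⁻¹) x
    (Or.inr ?_) ?_ ?_
  · have h := c₀'_neg_succ (m + 1) 1 0
    push_cast at h
    rw [h]
    group
  all_goals
    simp only [lead₀', block₀', V_cons, V_nil, zpow_neg, zpow_ofNat, zpow_one, pow_succ,
      pow_zero, one_mul]
    group
  all_goals simp only [zpow_ofNat, pow_succ, pow_zero, one_mul, mul_assoc]

theorem c₀''_succ_W (m : ℕ) (p q : ℤ) : SameClass (c₀'' (m + 1) p q)
    (W x y ([(2 * p + 1, 1), (p, q), (p, 1)] ++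
      (List.replicate m [(p, -1), (-p, -1), (p, 1), (p, q), (p, 1)]).flatten ++ [])) := by
  refine sameClass_W (B := block₀'' p q)
    (lead₀'' p q * block₀'' p q) 1 (x ^ p * y * x ^ (-p))
    (Or.inl ?_) ?_ ?_
  · rw [c₀''_succ]
    group
  all_goals
    simp only [lead₀'', block₀'', W_cons, W_nil, zpow_neg, zpow_ofNat, zpow_one, pow_succ,
      pow_zero, one_mul]
    group

theorem c₀''_succ_W_zero (m : ℕ) (p : ℤ) : SameClass (c₀'' (m + 1) p 0)
    (W x y ([(2 * p + 1, 1), (2 * p, 1)] ++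
      (List.replicate m [(p, -1), (-p, -1), (p, 1), (2 * p, 1)]).flatten ++ [])) := by
  refine sameClass_W (B := block₀'' p 0)
    (lead₀'' p 0 * block₀'' p 0) 1 (x ^ p * y * x ^ (-p))
    (Or.inl ?_) ?_ ?_
  · rw [c₀''_succ]
    group
  all_goals
    simp only [lead₀'', block₀'', W_cons, W_nil, zpow_neg, zpow_ofNat, zpow_one, pow_succ,
      pow_zero, one_mul]
    group

/-- Mixed signs are already visible in the basis (x, y), but the syllable counts there may share the
factor 3. The new basis has a single exponent 6, which excludes powers. -/
theorem c₀''_succ_succ_neg_one_one (m : ℕ) : SameClass (c₀'' (m + 1 + 1) (-1) 1)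
    (W x (x⁻¹ * y) ([(-1, -2), (-1, 6)] ++
      (List.replicate m [(-1, -2), (-1, 3)]).flatten ++ [])) := by
  refine sameClass_W (B := block₀'' (-1) 1)
    (lead₀'' (-1) 1 * block₀'' (-1) 1) (block₀'' (-1) 1) (x⁻¹ * y * x)
    (Or.inl ?_) ?_ ?_
  · have h := c₀''_succ (m + 1) (-1) 1
    push_cast at h
    rw [h]
    group
  all_goals
    simp only [lead₀'', block₀'', W_cons, W_nil, zpow_neg, zpow_ofNat, zpow_one, pow_succ,
      pow_zero, one_mul]
    group

theorem c₀''_neg_succ_W (m : ℕ) (p q : ℤ) : SameClass (c₀'' (-(m + 1)) p q)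
    (W x y ([] ++
      (List.replicate (m + 1) [(-p, -1), (p, 1), (p, q), (p, 1), (p, -1)]).flatten ++
        [(-p, -1), (-1, -1)])) := by
  refine sameClass_W (B := block₀'' p q)
    1 ((lead₀'' p q)⁻¹) (x ^ p)
    (Or.inr ?_) ?_ ?_
  · rw [c₀''_neg_succ]
    group
  all_goals
    simp only [lead₀'', block₀'', W_cons, W_nil, zpow_neg, zpow_ofNat, zpow_one, pow_succ,
      pow_zero, one_mul]
    group

theorem c₀''_neg_succ_W_zero (m : ℕ) (p : ℤ) : SameClass (c₀'' (-(m + 1)) p 0)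
    (W x y ([] ++
      (List.replicate (m + 1) [(-p, -1), (p, 1), (2 * p, 1), (p, -1)]).flatten ++
        [(-p, -1), (-1, -1)])) := by
  refine sameClass_W (B := block₀'' p 0)
    1 ((lead₀'' p 0)⁻¹) (x ^ p)
    (Or.inr ?_) ?_ ?_
  · rw [c₀''_neg_succ]
    group
  all_goals
    simp only [lead₀'', block₀'', W_cons, W_nil, zpow_neg, zpow_ofNat, zpow_one, pow_succ,
      pow_zero, one_mul]
    group

/-- For p = 1 the counts in the basis (x, y) may all be even; here the exponent −3 occurs exactly
once. -/
theorem c₀''_neg_succ_one (m : ℕ) (q : ℤ) : SameClass (c₀'' (-(m + 1)) 1 q)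
    (W (y * x) y ([(-3, -1), (2, q - 1), (2, -1)] ++
      (List.replicate m [(-1, -1), (2, q - 1), (2, -1)]).flatten ++ [])) := by
  refine sameClass_W (B := block₀'' 1 q)
    (block₀'' 1 q) ((lead₀'' 1 q)⁻¹) x
    (Or.inr ?_) ?_ ?_
  · exact c₀''_neg_succ m 1 q
  all_goals
    simp only [lead₀'', block₀'', W_cons, W_nil, zpow_neg, zpow_ofNat, zpow_one, pow_succ,
      pow_zero, one_mul]
    group

theorem c₀''_neg_succ_one_one (m : ℕ) : SameClass (c₀'' (-(m + 1)) 1 1)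
    (W (y * x) y ([(-3, -1), (4, -1)] ++
      (List.replicate m [(-1, -1), (4, -1)]).flatten ++ [])) := by
  refine sameClass_W (B := block₀'' 1 1)
    (block₀'' 1 1) ((lead₀'' 1 1)⁻¹) x
    (Or.inr ?_) ?_ ?_
  · exact c₀''_neg_succ m 1 1
  all_goals
    simp only [lead₀'', block₀'', W_cons, W_nil, zpow_neg, zpow_ofNat, zpow_one, pow_succ,
      pow_zero, one_mul]
    group

theorem c₀''_neg_succ_neg_one_one (m : ℕ) : SameClass (c₀'' (-(m + 1)) (-1) 1)
    (W x (x⁻¹ * y) ([(-2, -2), (-1, 3)] ++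
      (List.replicate m [(-1, -2), (-1, 3)]).flatten ++ [(-1, -2)])) := by
  refine sameClass_W (B := block₀'' (-1) 1)
    (block₀'' (-1) 1) ((lead₀'' (-1) 1)⁻¹) (x⁻¹ * y * x)
    (Or.inr ?_) ?_ ?_
  · exact c₀''_neg_succ m (-1) 1
  all_goals
    simp only [lead₀'', block₀'', W_cons, W_nil, zpow_neg, zpow_ofNat, zpow_one, pow_succ,
      pow_zero, one_mul]
    group

theorem c₁'_succ_W (m : ℕ) (p q : ℤ) : SameClass (c₁' (m + 1) p q)
    (W x y ([(-p, -1), (-p, 1), (p, 1), (p + 1, 1)] ++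
      (List.replicate m [(p, q + 1), (p, 1), (p + 1, 1)]).flatten ++ [(p, 1)])) := by
  refine sameClass_W (B := block₁' p q)
    (lead₁' p q * block₁' p q) 1 (x ^ (-p))
    (Or.inl ?_) ?_ ?_
  · rw [c₁'_succ]
    group
  all_goals
    simp only [lead₁', block₁', W_cons, W_nil, zpow_neg, zpow_ofNat, zpow_one, pow_succ,
      pow_zero, one_mul]
    group

theorem c₁'_succ_W_of_neg_one (m : ℕ) (q : ℤ) : SameClass (c₁' (m + 1) (-1) q)
    (W x y ([(1, -1), (1, 1), (-1, 2)] ++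
      (List.replicate m [(-1, q + 1), (-1, 2)]).flatten ++ [(-1, 1)])) := by
  refine sameClass_W (B := block₁' (-1) q)
    (lead₁' (-1) q * block₁' (-1) q) 1 x
    (Or.inl ?_) ?_ ?_
  · rw [c₁'_succ]
    group
  all_goals
    simp only [lead₁', block₁', W_cons, W_nil, zpow_neg, zpow_ofNat, zpow_one, pow_succ,
      pow_zero, one_mul]
    group

theorem c₁'_succ_W_neg_one (m : ℕ) (p : ℤ) : SameClass (c₁' (m + 1) p (-1))
    (W x y ([(-p, -1), (-p, 1), (p, 1), (p + 1, 1)] ++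
      (List.replicate m [(2 * p, 1), (p + 1, 1)]).flatten ++ [(p, 1)])) := by
  refine sameClass_W (B := block₁' p (-1))
    (lead₁' p (-1) * block₁' p (-1)) 1 (x ^ (-p))
    (Or.inl ?_) ?_ ?_
  · rw [c₁'_succ]
    group
  all_goals
    simp only [lead₁', block₁', W_cons, W_nil, zpow_neg, zpow_ofNat, zpow_one, pow_succ,
      pow_zero, one_mul]
    group

theorem c₁'_succ_W_neg_one_neg_one (m : ℕ) : SameClass (c₁' (m + 1) (-1) (-1))
    (W x y ([(1, -1), (1, 1), (-1, 2)] ++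
      (List.replicate m [(-2, 2)]).flatten ++ [(-1, 1)])) := by
  refine sameClass_W (B := block₁' (-1) (-1))
    (lead₁' (-1) (-1) * block₁' (-1) (-1)) 1 x
    (Or.inl ?_) ?_ ?_
  · rw [c₁'_succ]
    group
  all_goals
    simp only [lead₁', block₁', W_cons, W_nil, zpow_neg, zpow_ofNat, zpow_one, pow_succ,
      pow_zero, one_mul]
    group

theorem c₁'_neg_succ_W (m : ℕ) (p q : ℤ) : SameClass (c₁' (-(m + 1)) p q)
    (W x y ([(p, 1), (p + 1, 1)] ++
      (List.replicate m [(p, q + 1), (p, 1), (p + 1, 1)]).flatten ++ [(p, q), (p, 1), (p, q)])) := by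
  refine sameClass_W (B := block₁' p q)
    (block₁' p q) ((lead₁' p q)⁻¹) (x ^ (-p))
    (Or.inr ?_) ?_ ?_
  · exact c₁'_neg_succ m p q
  all_goals
    simp only [lead₁', block₁', W_cons, W_nil, zpow_neg, zpow_ofNat, zpow_one, pow_succ,
      pow_zero, one_mul]
    group

theorem c₁'_neg_succ_W_neg_one (m : ℕ) (p : ℤ) : SameClass (c₁' (-(m + 1)) p (-1))
    (W x y ([(p, 1), (p + 1, 1)] ++
      (List.replicate m [(2 * p, 1), (p + 1, 1)]).flatten ++ [(p, -1), (p, 1), (p, -1)])) := by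
  refine sameClass_W (B := block₁' p (-1))
    (block₁' p (-1)) ((lead₁' p (-1))⁻¹) (x ^ (-p))
    (Or.inr ?_) ?_ ?_
  · exact c₁'_neg_succ m p (-1)
  all_goals
    simp only [lead₁', block₁', W_cons, W_nil, zpow_neg, zpow_ofNat, zpow_one, pow_succ,
      pow_zero, one_mul]
    group

theorem c₁'_neg_succ_V_of_neg_one (m : ℕ) (q : ℤ) : SameClass (c₁' (-(m + 1)) (-1) q)
    (V y x⁻¹ ([2] ++
      (List.replicate m [q + 1, 2]).flatten ++ [q, 1, q])) := by
  refine sameClass_V (B := block₁' (-1) q)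
    (block₁' (-1) q) ((lead₁' (-1) q)⁻¹) 1
    (Or.inr ?_) ?_ ?_
  · exact c₁'_neg_succ m (-1) q
  all_goals
    simp only [lead₁', block₁', V_cons, V_nil, zpow_neg, zpow_ofNat, zpow_one, pow_succ,
      pow_zero, one_mul]
    group

theorem c₁'_neg_succ_neg_one_one (m : ℕ) : SameClass (c₁' (-(m + 1)) (-1) 1)
    (V (x⁻¹ * y) y ([4] ++
      (List.replicate m [1, 1]).flatten ++ [])) := by
  refine sameClass_V (B := block₁' (-1) 1)
    (block₁' (-1) 1) ((lead₁' (-1) 1)⁻¹) x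
    (Or.inr ?_) ?_ ?_
  · exact c₁'_neg_succ m (-1) 1
  all_goals
    simp only [lead₁', block₁', V_cons, V_nil, zpow_neg, zpow_ofNat, zpow_one, pow_succ,
      pow_zero, one_mul]
    group
  all_goals simp only [zpow_ofNat, pow_succ, pow_zero, one_mul, mul_assoc]

theorem c₁'_neg_succ_V_zero (m : ℕ) (p : ℤ) : SameClass (c₁' (-(m + 1)) p 0)
    (V x y ([2 * p, p + 1] ++
      (List.replicate m [p, p, p + 1]).flatten ++ [2 * p])) := by
  refine sameClass_V (B := block₁' p 0)
    (block₁' p 0) ((lead₁' p 0)⁻¹) (x ^ (-p))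
    (Or.inr ?_) ?_ ?_
  · exact c₁'_neg_succ m p 0
  all_goals
    simp only [lead₁', block₁', V_cons, V_nil, zpow_neg, zpow_ofNat, zpow_one, pow_succ,
      pow_zero, one_mul]
    group

/-- For p = 1, q = 0 the word has only the exponents 1 and 2, so it is a positive word in xy and
x²y, where squares of both generators appear. -/
theorem c₁'_neg_succ_succ_one_zero (m : ℕ) : SameClass (c₁' (-(m + 1 + 1)) 1 0)
    (W (x ^ 2 * y) (x * y) ([(4, 2)] ++
      (List.replicate m [(1, 2)]).flatten ++ [])) := by
  refine sameClass_W (B := block₁' 1 0)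
    (block₁' 1 0 * block₁' 1 0) ((lead₁' 1 0)⁻¹) (x⁻¹ * (x * x * y)⁻¹)
    (Or.inr ?_) ?_ ?_
  · have h := c₁'_neg_succ (m + 1) 1 0
    push_cast at h
    rw [h]
    group
  all_goals
    simp only [lead₁', block₁', W_cons, W_nil, zpow_neg, zpow_ofNat, zpow_one, pow_succ,
      pow_zero, one_mul]
    group
  all_goals simp only [zpow_ofNat, pow_succ, pow_zero, one_mul, mul_assoc]

/-- This form serves the power test. The shift by 2p kills the two adjacent exponents 2p, fusing
three factors of the second generator into a unique exponent 3. -/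
theorem c₁'_neg_succ_succ_W_zero (m : ℕ) (p : ℤ) : SameClass (c₁' (-(m + 1 + 1)) p 0)
    (W x (x ^ (2 * p) * y) ([(1 - p, 1)] ++
      (List.replicate m [(-p, 1), (-p, 1), (1 - p, 1)]).flatten ++
        [(-p, 1), (-p, 1), (1 - p, 3)])) := by
  refine sameClass_W (B := block₁' p 0)
    (block₁' p 0) (block₁' p 0 * (lead₁' p 0)⁻¹) (x ^ (-p))
    (Or.inr ?_) ?_ ?_
  · have h := c₁'_neg_succ (m + 1) p 0
    push_cast at h
    rw [h]
    group
  all_goals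
    simp only [lead₁', block₁', W_cons, W_nil, zpow_neg, zpow_ofNat, zpow_one, pow_succ,
      pow_zero, one_mul]
    group

theorem c₁''_succ_W (m : ℕ) (p q : ℤ) : SameClass (c₁'' (m + 1) p q)
    (W x y ([(p, 1), (p, -1), (-p, -1)] ++
      (List.replicate m [(p, 1), (p, q), (p, 1), (p, -1), (-p, -1)]).flatten ++ [])) := by
  refine sameClass_W (B := block₁'' p q)
    (lead₁'' p q * block₁'' p q) 1 1
    (Or.inl ?_) ?_ ?_
  · rw [c₁''_succ]
    group
  all_goals
    simp only [lead₁'', block₁'', W_cons, W_nil, zpow_neg, zpow_ofNat, zpow_one, pow_succ,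
      pow_zero, one_mul]
    group

/-- For q = 1 the counts in the basis (x, y) may be even together; in this basis the second exponent
1 occurs once. -/
theorem c₁''_succ_one (m : ℕ) (p : ℤ) : SameClass (c₁'' (m + 1) p 1)
    (W x (x ^ p * y) ([] ++
      (List.replicate m [(p, -2), (p, 3)]).flatten ++ [(p, -2), (p, 1)])) := by
  refine sameClass_W (B := block₁'' p 1)
    (lead₁'' p 1 * block₁'' p 1) 1 (y * x ^ p * y * x ^ (-p))
    (Or.inl ?_) ?_ ?_
  · rw [c₁''_succ]
    group
  all_goals
    simp only [lead₁'', block₁'', W_cons, W_nil, zpow_neg, zpow_ofNat, zpow_one, pow_succ,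
      pow_zero, one_mul]
    group

theorem c₁''_succ_W_zero (m : ℕ) (p : ℤ) : SameClass (c₁'' (m + 1) p 0)
    (W x y ([(p, 1), (p, -1), (-p, -1)] ++
      (List.replicate m [(p, 1), (2 * p, 1), (p, -1), (-p, -1)]).flatten ++ [])) := by
  refine sameClass_W (B := block₁'' p 0)
    (lead₁'' p 0 * block₁'' p 0) 1 1
    (Or.inl ?_) ?_ ?_
  · rw [c₁''_succ]
    group
  all_goals
    simp only [lead₁'', block₁'', W_cons, W_nil, zpow_neg, zpow_ofNat, zpow_one, pow_succ,
      pow_zero, one_mul]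
    group

theorem c₁''_neg_succ_W (m : ℕ) (p q : ℤ) : SameClass (c₁'' (-(m + 1)) p q)
    (W x y ([] ++
      (List.replicate (m + 1) [(p, 1), (p, q), (p, 1), (p, -1), (-p, -1)]).flatten ++
        [(p, 1), (p, q)])) := by
  refine sameClass_W (B := block₁'' p q)
    1 ((lead₁'' p q)⁻¹) 1
    (Or.inr ?_) ?_ ?_
  · rw [c₁''_neg_succ]
    group
  all_goals
    simp only [lead₁'', block₁'', W_cons, W_nil, zpow_neg, zpow_ofNat, zpow_one, pow_succ,
      pow_zero, one_mul]
    group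

theorem c₁''_neg_succ_one (m : ℕ) (p : ℤ) : SameClass (c₁'' (-(m + 1)) p 1)
    (W x (x ^ p * y) ([] ++
      (List.replicate m [(p, -2), (p, 3)]).flatten ++ [(p, -2), (p, 5)])) := by
  refine sameClass_W (B := block₁'' p 1)
    (block₁'' p 1) ((lead₁'' p 1)⁻¹) (y * x ^ p * y * x ^ (-p))
    (Or.inr ?_) ?_ ?_
  · exact c₁''_neg_succ m p 1
  all_goals
    simp only [lead₁'', block₁'', W_cons, W_nil, zpow_neg, zpow_ofNat, zpow_one, pow_succ,
      pow_zero, one_mul]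
    group

theorem c₁''_neg_succ_W_zero (m : ℕ) (p : ℤ) : SameClass (c₁'' (-(m + 1)) p 0)
    (W x y ([(2 * p, 1), (2 * p, 1), (p, -1), (-p, -1)] ++
      (List.replicate m [(p, 1), (2 * p, 1), (p, -1), (-p, -1)]).flatten ++ [(p, 1)])) := by
  refine sameClass_W (B := block₁'' p 0)
    (block₁'' p 0) ((lead₁'' p 0)⁻¹) 1
    (Or.inr ?_) ?_ ?_
  · exact c₁''_neg_succ m p 0
  all_goals
    simp only [lead₁'', block₁'', W_cons, W_nil, zpow_neg, zpow_ofNat, zpow_one, pow_succ,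
      pow_zero, one_mul]
    group

/-! ### Combined tests for blockwise words -/

theorem forall_mem_blocks {α : Type*} {Q : α → Prop} {A M C : List α} {m : ℕ}
    (hA : ∀ e ∈ A, Q e) (hM : ∀ e ∈ M, Q e) (hC : ∀ e ∈ C, Q e) :
    ∀ e ∈ A ++ (List.replicate m M).flatten ++ C, Q e := by
  intro e he
  simp only [List.mem_append, List.mem_flatten, List.mem_replicate] at he
  rcases he with (he | ⟨l, ⟨-, rfl⟩, he⟩) | he
  exacts [hA e he, hM e he, hC e he]

theorem countP_blocks {α : Type*} (P : α → Bool) (A M C : List α) (m : ℕ) :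
    (A ++ (List.replicate m M).flatten ++ C).countP P =
      A.countP P + m * M.countP P + C.countP P := by
  simp [List.countP_flatten, Nat.add_assoc]

/-- The counts depend linearly on m, so coprimality is certified by an explicit Bézout relation with
coefficients s, t. -/
theorem coprime_of_mul_eq_mul_add_one {a b s t : ℕ} (h : s * a = t * b + 1) : a.Coprime b := by
  refine Nat.Coprime.symm (Nat.coprime_of_dvd' fun k _ h1 h2 => ?_)
  have h3 : k ∣ t * b + 1 := h ▸ h2.mul_left s
  exact (Nat.dvd_add_right (h1.mul_left t)).1 h3

theorem isNeither_of_sameClass_W {g h u : F₂} {A M C : List (ℤ × ℤ)} {m : ℕ}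
    (hs : SameClass u (W g h (A ++ (List.replicate m M).flatten ++ C))) (hb : IsBasisPair g h)
    (hA : ∀ e ∈ A, e.1 ≠ 0 ∧ e.2 ≠ 0) (hM : ∀ e ∈ M, e.1 ≠ 0 ∧ e.2 ≠ 0)
    (hC : ∀ e ∈ C, e.1 ≠ 0 ∧ e.2 ≠ 0)
    (hprim : (∀ e ∈ A ++ (List.replicate m M).flatten ++ C, e.1 ≠ 0 ∧ e.2 ≠ 0) →
      ¬ IsPrimitive (W g h (A ++ (List.replicate m M).flatten ++ C)))
    (P Q : ℤ × ℤ → Prop) [DecidablePred P] [DecidablePred Q] {a b : ℕ} (s t : ℕ)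
    (hP : A.countP P + m * M.countP P + C.countP P = a)
    (hQ : A.countP Q + m * M.countP Q + C.countP Q = b) (hst : s * a = t * b + 1) :
    IsNeither u := by
  have hL := forall_mem_blocks (m := m) hA hM hC
  refine ⟨hs.not_isPrimitive (hprim hL), hs.not_isPower ?_⟩
  refine not_isPower_of_coprime_countP hb (IsConj.refl _) hL P Q ?_
  rw [countP_blocks, countP_blocks, hP, hQ]
  exact coprime_of_mul_eq_mul_add_one hst

theorem isNeither_of_sameClass_W_of_unique {g h u : F₂} {A M C : List (ℤ × ℤ)} {m : ℕ}
    (hs : SameClass u (W g h (A ++ (List.replicate m M).flatten ++ C))) (hb : IsBasisPair g h)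
    (hA : ∀ e ∈ A, e.1 ≠ 0 ∧ e.2 ≠ 0) (hM : ∀ e ∈ M, e.1 ≠ 0 ∧ e.2 ≠ 0)
    (hC : ∀ e ∈ C, e.1 ≠ 0 ∧ e.2 ≠ 0)
    (hprim : (∀ e ∈ A ++ (List.replicate m M).flatten ++ C, e.1 ≠ 0 ∧ e.2 ≠ 0) →
      ¬ IsPrimitive (W g h (A ++ (List.replicate m M).flatten ++ C)))
    (P : ℤ × ℤ → Prop) [DecidablePred P]
    (hP : A.countP P + m * M.countP P + C.countP P = 1) : IsNeither u :=
  isNeither_of_sameClass_W hs hb hA hM hC hprim P P 1 0 hP hP rfl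

theorem isNeither_of_sameClass_V {g h u : F₂} {A M C : List ℤ} {m : ℕ}
    (hs : SameClass u (V g h (A ++ (List.replicate m M).flatten ++ C))) (hb : IsBasisPair g h)
    (a b : ℤ) (ha : a ∈ A ++ (List.replicate m M).flatten ++ C)
    (hb' : b ∈ A ++ (List.replicate m M).flatten ++ C) (hab : a + 2 ≤ b)
    (c d : ℤ) {k l : ℕ} (s t : ℕ) (hc : A.count c + m * M.count c + C.count c = k)
    (hd : A.count d + m * M.count d + C.count d = l) (hst : s * k = t * l + 1) :
    IsNeither u := by
  refine ⟨hs.not_isPrimitive (not_isPrimitive_of_spread hb (IsConj.refl _) ha hb' hab),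
    hs.not_isPower ?_⟩
  refine not_isPower_of_coprime_count hb (IsConj.refl _) c d ?_
  unfold List.count at *
  rw [countP_blocks, countP_blocks, hc, hd]
  exact coprime_of_mul_eq_mul_add_one hst

theorem isNeither_of_sameClass_V_of_unique {g h u : F₂} {A M C : List ℤ} {m : ℕ}
    (hs : SameClass u (V g h (A ++ (List.replicate m M).flatten ++ C))) (hb : IsBasisPair g h)
    (a b : ℤ) (ha : a ∈ A ++ (List.replicate m M).flatten ++ C)
    (hb' : b ∈ A ++ (List.replicate m M).flatten ++ C) (hab : a + 2 ≤ b) (c : ℤ)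
    (hc : A.count c + m * M.count c + C.count c = 1) : IsNeither u :=
  isNeither_of_sameClass_V hs hb a b ha hb' hab c c 1 0 hc hc rfl

/-! ### Elementary primitive elements and auxiliary bases -/

theorem IsBasisPair.isPrimitive_mul_pow {g h : F₂} (hb : IsBasisPair g h) (k : ℕ) :
    IsPrimitive (g * h ^ k) := by
  rw [← zpow_natCast]
  exact (hb.swap.mul_zpow k).isPrimitive_right

theorem IsPrimitive.ne_one {u : F₂} (hu : IsPrimitive u) : u ≠ 1 := by
  obtain ⟨v, b, rfl, -⟩ := hu
  intro h
  have := congrArg b.repr h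
  rw [FreeGroupBasis.repr_apply_coe, _root_.map_one] at this
  exact of_ne_one _ this

theorem IsPrimitive.isPower_pow {u : F₂} (hu : IsPrimitive u) {k : ℕ} (hk : 2 ≤ k) :
    IsPower (u ^ k) :=
  ⟨u, k, hu.ne_one, hk, rfl⟩

theorem isBasisPair_x_zpow_mul_y (p : ℤ) : IsBasisPair x (x ^ p * y) :=
  isBasisPair_x_y.zpow_mul p

theorem isBasisPair_inv_x_mul_y_y : IsBasisPair (x⁻¹ * y) y := by
  simpa using (isBasisPair_x_y.inv_left.swap.mul_zpow 1).swap

theorem isBasisPair_x_mul_y_x : IsBasisPair (x * y) x := by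
  simpa using (isBasisPair_x_y.zpow_mul 1).swap

theorem isBasisPair_y_inv_x : IsBasisPair y x⁻¹ := isBasisPair_x_y.swap.inv_right

/-! ### Parameters for which the words are neither primitive nor powers -/

theorem c₀'_succ_isNeither {m : ℕ} {p q : ℤ} (hp : p ≠ 0) (hp1 : p ≠ -1) (hq : q ≠ 0)
    (hq1 : q ≠ -1) : IsNeither (c₀' (m + 1) p q) := by
  refine isNeither_of_sameClass_W_of_unique (c₀'_succ_W m p q) isBasisPair_x_y
    (by simp; omega) (by simp; omega) (by simp) (fun hL => ?_) (fun e => e.1 = 2 * p + 1) ?_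
  · by_cases h : q < -1
    · exact not_isPrimitive_of_mixed_snd isBasisPair_x_y (IsConj.refl _) hL
        ⟨(p, 1), by simp, by simp⟩ ⟨(p, q + 1), by simp, by simp; omega⟩
    · exact not_isPrimitive_of_squares isBasisPair_x_y (IsConj.refl _) hL
        ⟨(2 * p + 1, 1), by simp, le_abs.2 (by simp; omega)⟩
        ⟨(p, q + 1), by simp, le_abs.2 (by simp; omega)⟩
  · have h1 : p ≠ 2 * p + 1 := by omega
    have h2 : p + 1 ≠ 2 * p + 1 := by omega
    simp [h1, h2]

theorem c₀'_succ_zero_isNeither {m : ℕ} {p : ℤ} (hp : p ≠ 0) (hp1 : p ≠ -1)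
    (h : p = -2 → m ≠ 0) : IsNeither (c₀' (m + 1) p 0) := by
  have hc : ([2 * p + 1, p, p] : List ℤ).count (2 * p + 1) +
      m * ([p + 1, p, p] : List ℤ).count (2 * p + 1) + ([] : List ℤ).count (2 * p + 1) = 1 := by
    have h1 : p ≠ 2 * p + 1 := by omega
    have h2 : p + 1 ≠ 2 * p + 1 := by omega
    simp [h1, h2]
  have hs := c₀'_succ_V_zero m p
  rcases lt_or_ge 0 p with h0 | h0
  · exact isNeither_of_sameClass_V_of_unique hs isBasisPair_x_y p (2 * p + 1) (by simp) (by simp)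
      (by omega) _ hc
  rcases eq_or_ne p (-2) with rfl | h2
  · obtain ⟨m, rfl⟩ := Nat.exists_eq_succ_of_ne_zero (h rfl)
    exact isNeither_of_sameClass_V_of_unique hs isBasisPair_x_y (-3) (-1) (by simp)
      (by simp [List.replicate_succ]) (by omega) _ hc
  · exact isNeither_of_sameClass_V_of_unique hs isBasisPair_x_y (2 * p + 1) p (by simp) (by simp)
      (by omega) _ hc

theorem c₀'_succ_neg_one_isNeither {m : ℕ} {p : ℤ} (hp : p ≠ 0) (hp1 : p ≠ 1) (hm : m ≠ 0) :
    IsNeither (c₀' (m + 1) p (-1)) := by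
  have hc : ([2 * p + 1, 2 * p] : List ℤ).count (2 * p + 1) +
      m * ([p + 1, 2 * p] : List ℤ).count (2 * p + 1) + ([] : List ℤ).count (2 * p + 1) = 1 := by
    have h2 : p + 1 ≠ 2 * p + 1 := by omega
    simp [h2]
  have hs := c₀'_succ_V_neg_one m p
  obtain ⟨m, rfl⟩ := Nat.exists_eq_succ_of_ne_zero hm
  rcases lt_or_ge 0 p with h0 | h0
  · exact isNeither_of_sameClass_V_of_unique hs isBasisPair_x_y (p + 1) (2 * p + 1)
      (by simp [List.replicate_succ]) (by simp) (by omega) _ hc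
  · rcases eq_or_ne p (-1) with rfl | h2
    · exact isNeither_of_sameClass_V_of_unique hs isBasisPair_x_y (-2) 0
        (by simp) (by simp [List.replicate_succ]) (by omega) _ hc
    · exact isNeither_of_sameClass_V_of_unique hs isBasisPair_x_y (2 * p + 1) (p + 1)
        (by simp) (by simp [List.replicate_succ]) (by omega) _ hc

theorem c₀'_succ_of_neg_one_isNeither {m : ℕ} {q : ℤ} (hq : q ≠ 0) (hq1 : q ≠ 1)
    (hq2 : q = -1 → m ≠ 0) : IsNeither (c₀' (m + 1) (-1) q) := by
  by_cases hq' : q = -1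
  · subst hq'
    exact c₀'_succ_neg_one_isNeither (by decide) (by decide) (hq2 rfl)
  have hs := c₀'_succ_V_of_neg_one m q
  have hc : ([1, q + 1] : List ℤ).count (q + 1) +
      m * ([2, q + 1] : List ℤ).count (q + 1) + ([1] : List ℤ).count (q + 1) = m + 1 := by
    have h2 : 2 ≠ q + 1 := by omega
    have h3 : 1 ≠ q + 1 := by omega
    simp [h2, h3]
    omega
  have hd : ([1, q + 1] : List ℤ).count 2 +
      m * ([2, q + 1] : List ℤ).count 2 + ([1] : List ℤ).count 2 = m := by
    have h2 : q + 1 ≠ 2 := by omega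
    simp [h2]
  rcases lt_or_ge 0 q with h0 | h0
  · exact isNeither_of_sameClass_V hs isBasisPair_y_inv_x 1 (q + 1)
      (by simp) (by simp) (by omega) _ _ 1 1 hc hd (by omega)
  · exact isNeither_of_sameClass_V hs isBasisPair_y_inv_x (q + 1) 1
      (by simp) (by simp) (by omega) _ _ 1 1 hc hd (by omega)

theorem c₀'_succ_neg_one_one_isNeither {m : ℕ} (hm : m ≠ 0) :
    IsNeither (c₀' (m + 1) (-1) 1) := by
  obtain ⟨m, rfl⟩ := Nat.exists_eq_succ_of_ne_zero hm
  exact isNeither_of_sameClass_V_of_unique (c₀'_succ_neg_one_one _) isBasisPair_inv_x_mul_y_y 1 3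
    (by simp [List.replicate_succ]) (by simp) (by decide) 3 (by simp)

theorem c₀'_succ_succ_neg_one_zero_isNeither {m : ℕ} (hm : m ≠ 0) :
    IsNeither (c₀' (m + 1 + 1) (-1) 0) := by
  obtain ⟨m, rfl⟩ := Nat.exists_eq_succ_of_ne_zero hm
  exact isNeither_of_sameClass_V_of_unique (c₀'_succ_succ_neg_one_zero _)
    isBasisPair_inv_x_mul_y_y 2 5
    (by simp [List.replicate_succ]) (by simp) (by decide) 5 (by simp)

theorem c₀'_neg_succ_isNeither {m : ℕ} {p q : ℤ} (hp : p ≠ 0) (hp1 : p ≠ 1) (hp2 : p ≠ -1)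
    (hq : q ≠ 0) (hq1 : q ≠ -1) : IsNeither (c₀' (-(m + 1)) p q) := by
  refine isNeither_of_sameClass_W_of_unique (c₀'_neg_succ_W m p q) isBasisPair_x_y
    (by simp; omega) (by simp; omega) (by simp) (fun hL => ?_) (fun e => e.1 = 1) ?_
  · by_cases h : q < -1
    · exact not_isPrimitive_of_mixed_snd isBasisPair_x_y (IsConj.refl _) hL
        ⟨(p, 1), by simp, by simp⟩ ⟨(p, q + 1), by simp, by simp; omega⟩
    · exact not_isPrimitive_of_squares isBasisPair_x_y (IsConj.refl _) hL
        ⟨(p, 1), by simp, le_abs.2 (by simp; omega)⟩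
        ⟨(p, q + 1), by simp, le_abs.2 (by simp; omega)⟩
  · simp [hp1, hp]

theorem c₀'_neg_succ_of_one_isNeither {m : ℕ} {q : ℤ} (hq : q ≠ 0) (hq1 : q ≠ -1)
    (h : q = 1 → m ≠ 0) : IsNeither (c₀' (-(m + 1)) 1 q) := by
  refine isNeither_of_sameClass_W (c₀'_neg_succ_W m 1 q) isBasisPair_x_y
    (by simp; omega) (by simp; omega) (by simp) (fun hL => ?_) (fun e => e.2 = q + 1)
    (fun e => e.1 = 2) (a := m + 1) (b := m) 1 1 ?_ ?_ (by omega)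
  · by_cases h : q < -1
    · exact not_isPrimitive_of_mixed_snd isBasisPair_x_y (IsConj.refl _) hL
        ⟨(1, 1), by simp, by simp⟩ ⟨(1, q + 1), by simp, by simp; omega⟩
    -- For m = 0 no exponent of x exceeds 1, so the square test fails. Here q ≥ 2, and the exponents
    -- 1 and q + 1 of y are spread instead.
    · rcases Nat.eq_zero_or_pos m with rfl | hm
      · have : W x y ([(1, 1), (1, q + 1), (1, 1)] ++
            (List.replicate 0 [(1 + 1, 1), (1, q + 1), (1, 1)]).flatten ++ []) =
            x * V y x [1, q + 1, 1] * x⁻¹ := by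
          simp only [List.replicate_zero, List.flatten_nil, List.append_nil, W_cons, W_nil, V_cons,
            V_nil]
          group
        exact not_isPrimitive_of_spread isBasisPair_x_y.swap
          (this ▸ (isConj_iff.2 ⟨x, rfl⟩ : IsConj (V y x [1, q + 1, 1]) _).symm)
          (a := 1) (b := q + 1) (by simp) (by simp) (by omega)
      · obtain ⟨m, rfl⟩ := Nat.exists_eq_succ_of_ne_zero hm.ne'
        exact not_isPrimitive_of_squares isBasisPair_x_y (IsConj.refl _) hL
          ⟨(2, 1), by simp [List.replicate_succ], by simp⟩
          ⟨(1, q + 1), by simp, le_abs.2 (by simp; omega)⟩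
  · have h1 : 1 ≠ q + 1 := by omega
    simp [h1]
    omega
  · simp

theorem c₀'_neg_succ_of_neg_one_isNeither {m : ℕ} {q : ℤ} (hq1 : q ≠ -1) :
    IsNeither (c₀' (-(m + 1)) (-1) q) := by
  refine isNeither_of_sameClass_W_of_unique (c₀'_neg_succ_W_of_neg_one m q) isBasisPair_x_y
    (by simp; omega) (by simp; omega) (by simp) (fun hL => ?_) (fun e => e.1 = 1) ?_
  · exact not_isPrimitive_of_mixed_fst isBasisPair_x_y (IsConj.refl _) hL
      ⟨(1, 1), by simp, by simp⟩ ⟨(-1, q + 1), by simp, by simp⟩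
  · simp

theorem c₀'_neg_succ_neg_one_isNeither {m : ℕ} {p : ℤ} (hp : p ≠ 0) (hp1 : p ≠ 1) :
    IsNeither (c₀' (-(m + 1)) p (-1)) := by
  have hc : ([1, 2 * p] : List ℤ).count 1 +
      m * ([p + 1, 2 * p] : List ℤ).count 1 + ([] : List ℤ).count 1 = 1 := by
    have h2 : 2 * p ≠ 1 := by omega
    simp [h2, hp]
  have hs := c₀'_neg_succ_V_neg_one m p
  rcases lt_or_ge 0 p with h0 | h0
  · exact isNeither_of_sameClass_V_of_unique hs isBasisPair_x_y 1 (2 * p)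
      (by simp) (by simp) (by omega) _ hc
  · exact isNeither_of_sameClass_V_of_unique hs isBasisPair_x_y (2 * p) 1
      (by simp) (by simp) (by omega) _ hc

theorem c₀'_neg_succ_zero_isNeither {m : ℕ} {p : ℤ} (hp : p ≠ 0) (hp1 : p ≠ 1)
    (hp2 : p = 2 → m ≠ 0) : IsNeither (c₀' (-(m + 1)) p 0) := by
  have hc : ([1, p, p] : List ℤ).count 1 +
      m * ([p + 1, p, p] : List ℤ).count 1 + ([] : List ℤ).count 1 = 1 := by
    simp [hp, hp1]
  have hs := c₀'_neg_succ_V_zero m p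
  rcases eq_or_ne p 2 with rfl | h2
  · obtain ⟨m, rfl⟩ := Nat.exists_eq_succ_of_ne_zero (hp2 rfl)
    exact isNeither_of_sameClass_V_of_unique hs isBasisPair_x_y 1 3
      (by simp) (by simp [List.replicate_succ]) (by omega) _ hc
  rcases lt_or_ge 0 p with h0 | h0
  · exact isNeither_of_sameClass_V_of_unique hs isBasisPair_x_y 1 p
      (by simp) (by simp) (by omega) _ hc
  · exact isNeither_of_sameClass_V_of_unique hs isBasisPair_x_y p 1
      (by simp) (by simp) (by omega) _ hc

theorem c₀'_neg_succ_succ_one_zero_isNeither {m : ℕ} (hm : m ≠ 0) :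
    IsNeither (c₀' (-(m + 1 + 1)) 1 0) := by
  obtain ⟨m, rfl⟩ := Nat.exists_eq_succ_of_ne_zero hm
  exact isNeither_of_sameClass_V_of_unique (c₀'_neg_succ_succ_one_zero _)
    isBasisPair_x_mul_y_x 3 6
    (by simp [List.replicate_succ]) (by simp) (by decide) 6 (by simp)

theorem isBasisPair_y_mul_x_y : IsBasisPair (y * x) y := by
  simpa using (isBasisPair_x_y.swap.zpow_mul 1).swap

theorem isBasisPair_x_inv_x_mul_y : IsBasisPair x (x⁻¹ * y) := by
  simpa using isBasisPair_x_zpow_mul_y (-1)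

theorem isBasisPair_x_sq_mul_y_x_mul_y : IsBasisPair (x ^ 2 * y) (x * y) := by
  have := (isBasisPair_x_mul_y_x.mul_zpow 1).swap
  rw [zpow_one, ← mul_assoc, ← pow_two] at this
  exact this

theorem c₀''_succ_isNeither {m : ℕ} {p q : ℤ} (hp : p ≠ 0) (hp1 : p ≠ -1) (hq : q ≠ 0)
    (hm : m ≠ 0) : IsNeither (c₀'' (m + 1) p q) := by
  obtain ⟨m, rfl⟩ := Nat.exists_eq_succ_of_ne_zero hm
  refine isNeither_of_sameClass_W_of_unique (c₀''_succ_W _ p q) isBasisPair_x_y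
    (by simp; omega) (by simp; omega) (by simp) (fun hL => ?_) (fun e => e.1 = 2 * p + 1) ?_
  · exact not_isPrimitive_of_mixed_snd isBasisPair_x_y (IsConj.refl _) hL
      ⟨(p, 1), by simp, by simp⟩ ⟨(p, -1), by simp [List.replicate_succ], by simp⟩
  · have h1 : p ≠ 2 * p + 1 := by omega
    have h2 : -p ≠ 2 * p + 1 := by omega
    simp [h1, h2]

theorem c₀''_succ_of_neg_one_isNeither {m : ℕ} {q : ℤ} (hq : q ≠ 0) (hm : m ≠ 0) :
    IsNeither (c₀'' (m + 1) (-1) q) := by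
  obtain ⟨m, rfl⟩ := Nat.exists_eq_succ_of_ne_zero hm
  rcases eq_or_ne q 1 with rfl | hq1
  · have := c₀''_succ_succ_neg_one_one m
    push_cast
    refine isNeither_of_sameClass_W_of_unique this isBasisPair_x_inv_x_mul_y
      (by simp) (by simp) (by simp) (fun hL => ?_) (fun e => e.2 = 6) (by simp)
    exact not_isPrimitive_of_mixed_snd isBasisPair_x_inv_x_mul_y (IsConj.refl _) hL
      ⟨(-1, 6), by simp, by simp⟩ ⟨(-1, -2), by simp, by simp⟩
  have hs := c₀''_succ_W (m + 1) (-1) q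
  have hprim := fun hL => not_isPrimitive_of_mixed_snd isBasisPair_x_y (IsConj.refl _)
    (L := [(2 * (-1) + 1, 1), (-1, q), (-1, 1)] ++ (List.replicate (m + 1)
      [(-1, -1), (-(-1), -1), (-1, 1), (-1, q), (-1, 1)]).flatten ++ []) hL
      ⟨(-1, 1), by simp, by simp⟩ ⟨(-1, -1), by simp [List.replicate_succ], by simp⟩
  -- For q = −1 the syllable y^q cannot be told apart from the other y⁻¹, so these are counted
  -- together: 2m + 3 against m + 1.
  rcases eq_or_ne q (-1) with rfl | hq2
  · exact isNeither_of_sameClass_W hs isBasisPair_x_y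
      (by simp) (by simp) (by simp) hprim (fun e => e.1 = -1 ∧ e.2 = -1) (fun e => e.1 = 1)
      (a := 2 * (m + 1) + 1) (b := m + 1) 1 2 (by simp; omega) (by simp) (by omega)
  · have h1 : 1 ≠ q := by omega
    have h2 : -1 ≠ q := by omega
    exact isNeither_of_sameClass_W hs isBasisPair_x_y
      (by simp; omega) (by simp; omega) (by simp) hprim (fun e => e.2 = q) (fun e => e.1 = 1)
      (a := m + 2) (b := m + 1) 1 1 (by simp [h1, h2]; omega) (by simp) (by omega)

theorem c₀''_succ_zero_isNeither {m : ℕ} {p : ℤ} (hp : p ≠ 0) (hm : m ≠ 0) :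
    IsNeither (c₀'' (m + 1) p 0) := by
  obtain ⟨m, rfl⟩ := Nat.exists_eq_succ_of_ne_zero hm
  have hs := c₀''_succ_W_zero (m + 1) p
  have hprim := fun hL => not_isPrimitive_of_mixed_snd isBasisPair_x_y (IsConj.refl _)
    (L := [(2 * p + 1, 1), (2 * p, 1)] ++ (List.replicate (m + 1)
      [(p, -1), (-p, -1), (p, 1), (2 * p, 1)]).flatten ++ []) hL
      ⟨(2 * p, 1), by simp, by simp⟩ ⟨(p, -1), by simp [List.replicate_succ], by simp⟩
  rcases eq_or_ne p (-1) with rfl | hp1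
  · exact isNeither_of_sameClass_W hs isBasisPair_x_y
      (by simp) (by simp) (by simp) hprim (fun e => e.1 = -2) (fun e => e.1 = 1)
      (a := m + 2) (b := m + 1) 1 1 (by simp; omega) (by simp) (by omega)
  · have h1 : p ≠ 2 * p + 1 := by omega
    have h2 : -p ≠ 2 * p + 1 := by omega
    exact isNeither_of_sameClass_W_of_unique hs isBasisPair_x_y
      (by simp; omega) (by simp; omega) (by simp) hprim (fun e => e.1 = 2 * p + 1)
      (by simp [h1, h2])

theorem c₀''_neg_succ_of_one_isNeither {m : ℕ} {q : ℤ} : IsNeither (c₀'' (-(m + 1)) 1 q) := by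
  rcases eq_or_ne q 1 with rfl | hq1
  · refine isNeither_of_sameClass_W_of_unique (c₀''_neg_succ_one_one m) isBasisPair_y_mul_x_y
      (by simp) (by simp) (by simp) (fun hL => ?_) (fun e => e.1 = -3) (by simp)
    exact not_isPrimitive_of_mixed_fst isBasisPair_y_mul_x_y (IsConj.refl _) hL
      ⟨(4, -1), by simp, by simp⟩ ⟨(-3, -1), by simp, by simp⟩
  · refine isNeither_of_sameClass_W_of_unique (c₀''_neg_succ_one m q) isBasisPair_y_mul_x_y
      (by simp; omega) (by simp; omega) (by simp) (fun hL => ?_) (fun e => e.1 = -3) (by simp)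
    exact not_isPrimitive_of_mixed_fst isBasisPair_y_mul_x_y (IsConj.refl _) hL
      ⟨(2, -1), by simp, by simp⟩ ⟨(-3, -1), by simp, by simp⟩

theorem c₀''_neg_succ_of_neg_one_isNeither {m : ℕ} {q : ℤ} (hq : q ≠ 0) :
    IsNeither (c₀'' (-(m + 1)) (-1) q) := by
  rcases eq_or_ne q 1 with rfl | hq1
  · refine isNeither_of_sameClass_W_of_unique (c₀''_neg_succ_neg_one_one m)
      isBasisPair_x_inv_x_mul_y
      (by simp) (by simp) (by simp) (fun hL => ?_) (fun e => e.1 = -2) (by simp)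
    exact not_isPrimitive_of_mixed_snd isBasisPair_x_inv_x_mul_y (IsConj.refl _) hL
      ⟨(-1, 3), by simp, by simp⟩ ⟨(-1, -2), by simp, by simp⟩
  have hs := c₀''_neg_succ_W m (-1) q
  have hprim := fun hL => not_isPrimitive_of_mixed_snd isBasisPair_x_y (IsConj.refl _)
    (L := [] ++ (List.replicate (m + 1)
      [(-(-1), -1), (-1, 1), (-1, q), (-1, 1), (-1, -1)]).flatten ++ [(-(-1), -1), (-1, -1)]) hL
      ⟨(-1, 1), by simp [List.replicate_succ], by simp⟩ ⟨(-1, -1), by simp, by simp⟩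
  rcases eq_or_ne q (-1) with rfl | hq2
  · exact isNeither_of_sameClass_W hs isBasisPair_x_y
      (by simp) (by simp) (by simp) hprim (fun e => e.1 = 1) (fun e => e.1 = -1 ∧ e.2 = -1)
      (a := m + 2) (b := 2 * m + 3) 2 1 (by simp) (by simp; omega) (by omega)
  · have h1 : 1 ≠ q := by omega
    have h2 : -1 ≠ q := by omega
    exact isNeither_of_sameClass_W hs isBasisPair_x_y
      (by simp) (by simp; omega) (by simp) hprim (fun e => e.1 = 1) (fun e => e.2 = q)
      (a := m + 2) (b := m + 1) 1 1 (by simp) (by simp [h1, h2]) (by omega)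

theorem c₀''_neg_succ_isNeither {m : ℕ} {p q : ℤ} (hp : p ≠ 0) (hp1 : p ≠ 1) (hp2 : p ≠ -1)
    (hq : q ≠ 0) : IsNeither (c₀'' (-(m + 1)) p q) := by
  have h1 : -p ≠ -1 := by omega
  refine isNeither_of_sameClass_W_of_unique (c₀''_neg_succ_W m p q) isBasisPair_x_y
    (by simp) (by simp; omega) (by simp; omega) (fun hL => ?_) (fun e => e.1 = -1)
    (by simp [h1, hp2])
  exact not_isPrimitive_of_mixed_snd isBasisPair_x_y (IsConj.refl _) hL
    ⟨(p, 1), by simp [List.replicate_succ], by simp⟩ ⟨(-p, -1), by simp, by simp⟩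

theorem c₀''_neg_succ_zero_isNeither {m : ℕ} {p : ℤ} (hp : p ≠ 0) (hp1 : p ≠ 1) :
    IsNeither (c₀'' (-(m + 1)) p 0) := by
  have hs := c₀''_neg_succ_W_zero m p
  have hprim := fun hL => not_isPrimitive_of_mixed_snd isBasisPair_x_y (IsConj.refl _)
    (L := [] ++ (List.replicate (m + 1)
      [(-p, -1), (p, 1), (2 * p, 1), (p, -1)]).flatten ++ [(-p, -1), (-1, -1)]) hL
      ⟨(p, 1), by simp [List.replicate_succ], by simp⟩ ⟨(-p, -1), by simp, by simp⟩
  rcases eq_or_ne p (-1) with rfl | hp2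
  · exact isNeither_of_sameClass_W hs isBasisPair_x_y
      (by simp) (by simp) (by simp) hprim (fun e => e.1 = 1) (fun e => e.1 = -2)
      (a := m + 2) (b := m + 1) 1 1 (by simp) (by simp) (by omega)
  · have h1 : -p ≠ -1 := by omega
    have h2 : 2 * p ≠ -1 := by omega
    exact isNeither_of_sameClass_W_of_unique hs isBasisPair_x_y
      (by simp) (by simp; omega) (by simp; omega) hprim (fun e => e.1 = -1)
      (by simp [h1, h2, hp2])

theorem c₁'_succ_isNeither {m : ℕ} {p q : ℤ} (hp : p ≠ 0) : IsNeither (c₁' (m + 1) p q) := by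
  have h1 : p ≠ -p := by omega
  have h2 : p + 1 ≠ -p := by omega
  have h3 : 2 * p ≠ -p := by omega
  rcases eq_or_ne q (-1) with rfl | hq
  · rcases eq_or_ne p (-1) with rfl | hp1
    · refine isNeither_of_sameClass_W_of_unique (c₁'_succ_W_neg_one_neg_one m) isBasisPair_x_y
        (by simp) (by simp) (by simp) (fun hL => ?_) (fun e => e.2 = -1) (by simp)
      exact not_isPrimitive_of_mixed_snd isBasisPair_x_y (IsConj.refl _) hL
        ⟨(-1, 2), by simp, by simp⟩ ⟨(1, -1), by simp, by simp⟩
    · refine isNeither_of_sameClass_W_of_unique (c₁'_succ_W_neg_one m p) isBasisPair_x_y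
        (by simp; omega) (by simp; omega) (by simp; omega) (fun hL => ?_) (fun e => e.2 = -1)
        (by simp)
      exact not_isPrimitive_of_mixed_snd isBasisPair_x_y (IsConj.refl _) hL
        ⟨(p, 1), by simp, by simp⟩ ⟨(-p, -1), by simp, by simp⟩
  · rcases eq_or_ne p (-1) with rfl | hp1
    · refine isNeither_of_sameClass_W_of_unique (c₁'_succ_W_of_neg_one m q) isBasisPair_x_y
        (by simp) (by simp; omega) (by simp) (fun hL => ?_) (fun e => e.1 = 1 ∧ e.2 = -1) (by simp)
      exact not_isPrimitive_of_mixed_snd isBasisPair_x_y (IsConj.refl _) hL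
        ⟨(-1, 2), by simp, by simp⟩ ⟨(1, -1), by simp, by simp⟩
    · refine isNeither_of_sameClass_W_of_unique (c₁'_succ_W m p q) isBasisPair_x_y
        (by simp; omega) (by simp; omega) (by simp; omega) (fun hL => ?_)
        (fun e => e.1 = -p ∧ e.2 = -1) (by simp [h1, h2])
      exact not_isPrimitive_of_mixed_snd isBasisPair_x_y (IsConj.refl _) hL
        ⟨(p, 1), by simp, by simp⟩ ⟨(-p, -1), by simp, by simp⟩

theorem c₁'_neg_succ_isNeither {m : ℕ} {p q : ℤ} (hp : p ≠ 0) (hp1 : p ≠ -1) (hq : q ≠ 0)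
    (hq1 : q ≠ -1) (h : q = 1 → m ≠ 0) : IsNeither (c₁' (-(m + 1)) p q) := by
  have h1 : 1 ≠ q + 1 := by omega
  refine isNeither_of_sameClass_W (c₁'_neg_succ_W m p q) isBasisPair_x_y
    (by simp; omega) (by simp; omega) (by simp; omega) (fun hL => ?_)
    (fun e => e.1 = p + 1) (fun e => e.2 = q + 1) (a := m + 1) (b := m) 1 1
    (by simp; omega) (by simp [h1]) (by omega)
  by_cases hneg : q < 0
  · exact not_isPrimitive_of_mixed_snd isBasisPair_x_y (IsConj.refl _) hL
      ⟨(p, 1), by simp, by simp⟩ ⟨(p, q), by simp, by simp; omega⟩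
  have hfst : ∃ e ∈ [(p, 1), (p + 1, 1)] ++
      (List.replicate m [(p, q + 1), (p, 1), (p + 1, 1)]).flatten ++
      [(p, q), (p, 1), (p, q)], 2 ≤ |e.1| := by
    by_cases hp' : p = 1
    · exact ⟨(p + 1, 1), by simp, le_abs.2 (by simp; omega)⟩
    · exact ⟨(p, 1), by simp, le_abs.2 (by simp; omega)⟩
  refine not_isPrimitive_of_squares isBasisPair_x_y (IsConj.refl _) hL hfst ?_
  by_cases hq' : q = 1
  · obtain ⟨m, rfl⟩ := Nat.exists_eq_succ_of_ne_zero (h hq')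
    exact ⟨(p, q + 1), by simp [List.replicate_succ], le_abs.2 (by simp; omega)⟩
  · exact ⟨(p, q), by simp, le_abs.2 (by simp; omega)⟩

theorem c₁'_neg_succ_neg_one_isNeither {m : ℕ} {p : ℤ} (hp : p ≠ 0) (hp1 : p ≠ -1) :
    IsNeither (c₁' (-(m + 1)) p (-1)) := by
  have hs := c₁'_neg_succ_W_neg_one m p
  have hprim := fun hL => not_isPrimitive_of_mixed_snd isBasisPair_x_y (IsConj.refl _)
    (L := [(p, 1), (p + 1, 1)] ++ (List.replicate m [(2 * p, 1), (p + 1, 1)]).flatten ++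
      [(p, -1), (p, 1), (p, -1)]) hL
      ⟨(p, 1), by simp, by simp⟩ ⟨(p, -1), by simp, by simp⟩
  -- For p = 1 the exponents p + 1 and 2p coincide and are counted together, against the two
  -- negative exponents of y.
  rcases eq_or_ne p 1 with rfl | hp2
  · exact isNeither_of_sameClass_W hs isBasisPair_x_y
      (by simp) (by simp) (by simp) hprim (fun e => e.1 = 2) (fun e => e.2 = -1)
      (a := 2 * m + 1) (b := 2) 1 m (by simp; omega) (by simp) (by omega)
  · have h1 : p ≠ 2 * p := by omega
    have h2 : p + 1 ≠ 2 * p := by omega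
    exact isNeither_of_sameClass_W hs isBasisPair_x_y
      (by simp; omega) (by simp; omega) (by simp; omega) hprim (fun e => e.1 = p + 1)
      (fun e => e.1 = 2 * p) (a := m + 1) (b := m) 1 1 (by simp [h2.symm]; omega)
      (by simp [h2, hp]) (by omega)

theorem c₁'_neg_succ_of_neg_one_isNeither {m : ℕ} {q : ℤ} (hq : q ≠ 0)
    (hm : q = 1 ∨ q = 2 → m ≠ 0) : IsNeither (c₁' (-(m + 1)) (-1) q) := by
  rcases eq_or_ne q 1 with rfl | hq1
  · obtain ⟨m, rfl⟩ := Nat.exists_eq_succ_of_ne_zero (hm (by simp))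
    exact isNeither_of_sameClass_V_of_unique (c₁'_neg_succ_neg_one_one _)
      isBasisPair_inv_x_mul_y_y 1 4 (by simp [List.replicate_succ]) (by simp) (by omega) 4
      (by simp)
  have hs := c₁'_neg_succ_V_of_neg_one m q
  have hc : ([2] : List ℤ).count 1 + m * ([q + 1, 2] : List ℤ).count 1 +
      ([q, 1, q] : List ℤ).count 1 = 1 := by
    simp [hq, hq1]
  rcases eq_or_ne q 2 with rfl | hq2
  · obtain ⟨m, rfl⟩ := Nat.exists_eq_succ_of_ne_zero (hm (by simp))
    exact isNeither_of_sameClass_V_of_unique hs isBasisPair_y_inv_x 1 3 (by simp)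
      (by simp [List.replicate_succ]) (by omega) 1 hc
  rcases lt_or_ge 0 q with h0 | h0
  · exact isNeither_of_sameClass_V_of_unique hs isBasisPair_y_inv_x 1 q (by simp)
      (by simp) (by omega) 1 hc
  · exact isNeither_of_sameClass_V_of_unique hs isBasisPair_y_inv_x q 1 (by simp)
      (by simp) (by omega) 1 hc

theorem c₁'_neg_succ_zero_isNeither {m : ℕ} {p : ℤ} (hp : p ≠ 0) (hp1 : p ≠ 1)
    (hm : p = 2 → m ≠ 0) : IsNeither (c₁' (-(m + 1)) p 0) := by
  have hs := c₁'_neg_succ_V_zero m p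
  refine ⟨hs.not_isPrimitive ?_, ?_⟩
  · rcases eq_or_ne p 2 with rfl | hp2
    · obtain ⟨m, rfl⟩ := Nat.exists_eq_succ_of_ne_zero (hm rfl)
      exact not_isPrimitive_of_spread isBasisPair_x_y (IsConj.refl _) (a := 2) (b := 4)
        (by simp [List.replicate_succ]) (by simp) (by omega)
    rcases lt_or_ge 0 p with h0 | h0
    · exact not_isPrimitive_of_spread isBasisPair_x_y (IsConj.refl _) (a := p + 1) (b := 2 * p)
        (by simp) (by simp) (by omega)
    · exact not_isPrimitive_of_spread isBasisPair_x_y (IsConj.refl _) (a := 2 * p) (b := p + 1)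
        (by simp) (by simp) (by omega)
  · rcases Nat.eq_zero_or_pos m with rfl | h0
    · refine hs.not_isPower
        (not_isPower_of_count_eq_one isBasisPair_x_y (IsConj.refl _) (p + 1) ?_)
      have h1 : 2 * p ≠ p + 1 := by omega
      simp [h1]
    · obtain ⟨m, rfl⟩ := Nat.exists_eq_succ_of_ne_zero h0.ne'
      push_cast
      refine (c₁'_neg_succ_succ_W_zero m p).not_isPower
        (not_isPower_of_countP_eq_one (isBasisPair_x_zpow_mul_y (2 * p)) (IsConj.refl _)
          (forall_mem_blocks (by simp; omega) (by simp; omega) (by simp; omega))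
          (fun e => e.2 = 3) ?_)
      rw [countP_blocks]
      simp

theorem c₁'_neg_succ_one_zero_isNeither {m : ℕ} (hm : m ≠ 0) :
    IsNeither (c₁' (-(m + 1)) 1 0) := by
  obtain ⟨m, rfl⟩ := Nat.exists_eq_succ_of_ne_zero hm
  push_cast
  refine isNeither_of_sameClass_W_of_unique (c₁'_neg_succ_succ_one_zero m)
    isBasisPair_x_sq_mul_y_x_mul_y
    (by simp) (by simp) (by simp) (fun hL => ?_) (fun e => e.1 = 4) (by simp)
  exact not_isPrimitive_of_squares isBasisPair_x_sq_mul_y_x_mul_y (IsConj.refl _) hL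
    ⟨(4, 2), by simp, by simp⟩ ⟨(4, 2), by simp, by simp⟩

theorem c₁''_succ_isNeither {m : ℕ} {p q : ℤ} (hp : p ≠ 0) : IsNeither (c₁'' (m + 1) p q) := by
  have h1 : p ≠ -p := by omega
  have h2 : 2 * p ≠ -p := by omega
  have h3 : p ≠ 2 * p := by omega
  rcases eq_or_ne q 1 with rfl | hq1
  · refine isNeither_of_sameClass_W_of_unique (c₁''_succ_one m p) (isBasisPair_x_zpow_mul_y p)
      (by simp) (by simp; omega) (by simp; omega) (fun hL => ?_) (fun e => e.2 = 1) (by simp)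
    exact not_isPrimitive_of_mixed_snd (isBasisPair_x_zpow_mul_y p) (IsConj.refl _) hL
      ⟨(p, 1), by simp, by simp⟩ ⟨(p, -2), by simp, by simp⟩
  rcases eq_or_ne q 0 with rfl | hq0
  · refine isNeither_of_sameClass_W (c₁''_succ_W_zero m p) isBasisPair_x_y
      (by simp; omega) (by simp; omega) (by simp) (fun hL => ?_) (fun e => e.1 = -p)
      (fun e => e.1 = 2 * p) (a := m + 1) (b := m) 1 1 (by simp [h1, h2]; omega)
      (by simp [h2.symm, hp]) (by omega)
    exact not_isPrimitive_of_mixed_snd isBasisPair_x_y (IsConj.refl _) hL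
      ⟨(p, 1), by simp, by simp⟩ ⟨(p, -1), by simp, by simp⟩
  have hs := c₁''_succ_W m p q
  have hprim := fun hL => not_isPrimitive_of_mixed_snd isBasisPair_x_y (IsConj.refl _)
    (L := [(p, 1), (p, -1), (-p, -1)] ++ (List.replicate m
      [(p, 1), (p, q), (p, 1), (p, -1), (-p, -1)]).flatten ++ []) hL
      ⟨(p, 1), by simp, by simp⟩ ⟨(p, -1), by simp, by simp⟩
  rcases eq_or_ne q (-1) with rfl | hq2
  · exact isNeither_of_sameClass_W hs isBasisPair_x_y
      (by simp; omega) (by simp; omega) (by simp) hprim (fun e => e.1 = -p)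
      (fun e => e.2 = 1) (a := m + 1) (b := 2 * m + 1) 2 1 (by simp [h1]; omega)
      (by simp; omega) (by omega)
  · exact isNeither_of_sameClass_W hs isBasisPair_x_y
      (by simp; omega) (by simp; omega) (by simp) hprim (fun e => e.1 = -p)
      (fun e => e.2 = q) (a := m + 1) (b := m) 1 1 (by simp [h1]; omega)
      (by simp [hq1.symm, hq2.symm]) (by omega)

theorem c₁''_neg_succ_isNeither {m : ℕ} {p q : ℤ} (hp : p ≠ 0) :
    IsNeither (c₁'' (-(m + 1)) p q) := by
  have h1 : p ≠ -p := by omega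
  have h2 : 2 * p ≠ -p := by omega
  have h3 : p ≠ 2 * p := by omega
  rcases eq_or_ne q 1 with rfl | hq1
  · refine isNeither_of_sameClass_W_of_unique (c₁''_neg_succ_one m p) (isBasisPair_x_zpow_mul_y p)
      (by simp) (by simp; omega) (by simp; omega) (fun hL => ?_) (fun e => e.2 = 5) (by simp)
    exact not_isPrimitive_of_mixed_snd (isBasisPair_x_zpow_mul_y p) (IsConj.refl _) hL
      ⟨(p, 5), by simp, by simp⟩ ⟨(p, -2), by simp, by simp⟩
  rcases eq_or_ne q 0 with rfl | hq0
  · refine isNeither_of_sameClass_W (c₁''_neg_succ_W_zero m p) isBasisPair_x_y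
      (by simp; omega) (by simp; omega) (by simp; omega) (fun hL => ?_)
      (fun e => e.1 = 2 * p) (fun e => e.1 = -p) (a := m + 2) (b := m + 1) 1 1
      (by simp [h2.symm, hp]; omega) (by simp [h1, h2]; omega) (by omega)
    exact not_isPrimitive_of_mixed_snd isBasisPair_x_y (IsConj.refl _) hL
      ⟨(p, 1), by simp, by simp⟩ ⟨(p, -1), by simp, by simp⟩
  have hs := c₁''_neg_succ_W m p q
  have hprim := fun hL => not_isPrimitive_of_mixed_snd isBasisPair_x_y (IsConj.refl _)
    (L := [] ++ (List.replicate (m + 1)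
      [(p, 1), (p, q), (p, 1), (p, -1), (-p, -1)]).flatten ++ [(p, 1), (p, q)]) hL
      ⟨(p, 1), by simp, by simp⟩ ⟨(p, -1), by simp [List.replicate_succ], by simp⟩
  rcases eq_or_ne q (-1) with rfl | hq2
  · exact isNeither_of_sameClass_W hs isBasisPair_x_y
      (by simp) (by simp; omega) (by simp; omega) hprim (fun e => e.2 = 1)
      (fun e => e.1 = -p) (a := 2 * m + 3) (b := m + 1) 1 2 (by simp; omega)
      (by simp [h1]) (by omega)
  · exact isNeither_of_sameClass_W hs isBasisPair_x_y
      (by simp) (by simp; omega) (by simp; omega) hprim (fun e => e.2 = q)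
      (fun e => e.1 = -p) (a := m + 2) (b := m + 1) 1 1 (by simp [hq1.symm, hq2.symm])
      (by simp [h1]) (by omega)

/-- This settles n = 0 for c₁' and c₁''. If p = ±1, then (y, x^p) is a basis and the exponents 1, r
are spread; if |p| ≥ 2, either the signs are mixed (r = −1) or both generators have large exponents.
-/
theorem isNeither_of_sameClass_pair {u : F₂} {p r : ℤ} (hs : SameClass u (W x y [(p, 1), (p, r)]))
    (hp : p ≠ 0) (hr0 : r ≠ 0) (hr1 : r ≠ 1) (h : r = 2 → p ≠ 1 ∧ p ≠ -1) : IsNeither u := by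
  refine isNeither_of_sameClass_W_of_unique (A := [(p, 1), (p, r)]) (m := 0) (M := []) (C := [])
    hs isBasisPair_x_y (by simp; omega) (by simp) (by simp) (fun hL => ?_) (fun e => e.2 = 1)
    (by simp [hr1])
  have hspread : ∀ h, IsBasisPair y h → IsConj (W x y [(p, 1), (p, r)]) (V y h [1, r]) → r ≠ 2 →
      ¬ IsPrimitive (W x y [(p, 1), (p, r)]) := by
    intro h hb hc hr2
    rcases lt_or_ge 0 r with h0 | h0
    · exact not_isPrimitive_of_spread hb hc (a := 1) (b := r) (by simp) (by simp) (by omega)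
    · exact not_isPrimitive_of_spread hb hc (a := r) (b := 1) (by simp) (by simp) (by omega)
  have hconj : IsConj (W x y [(p, 1), (p, r)]) (V y (x ^ p) [1, r]) := by
    refine isConj_iff.2 ⟨x ^ (-p), ?_⟩
    simp only [W_cons, W_nil, V_cons, V_nil]
    group
  rcases eq_or_ne p 1 with rfl | hp1
  · exact hspread _ (by simpa using isBasisPair_x_y.swap) hconj (fun h2 => (h h2).1 rfl)
  rcases eq_or_ne p (-1) with rfl | hp2
  · exact hspread _ (by simpa using isBasisPair_y_inv_x) hconj (fun h2 => (h h2).2 rfl)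
  by_cases h2 : r = -1
  · exact not_isPrimitive_of_mixed_snd isBasisPair_x_y (IsConj.refl _) hL
      ⟨(p, 1), by simp, by simp⟩ ⟨(p, r), by simp, by simp; omega⟩
  · exact not_isPrimitive_of_squares isBasisPair_x_y (IsConj.refl _) hL
      ⟨(p, r), by simp, le_abs.2 (by simp; omega)⟩ ⟨(p, r), by simp, le_abs.2 (by simp; omega)⟩

/-! ### The listed parameters and the complete case analysis -/

theorem isPrimitive_x : IsPrimitive x := isBasisPair_x_y.isPrimitive_left

theorem isPrimitive_x_zpow {p : ℤ} (hp : p = 1 ∨ p = -1) : IsPrimitive (x ^ p) := by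
  rcases hp with rfl | rfl
  · simpa using isPrimitive_x
  · simpa using isPrimitive_x.inv

theorem isPower_x_zpow {p : ℤ} (hp : 2 ≤ |p|) : IsPower (x ^ p) := by
  rcases le_abs.1 hp with h | h
  · obtain ⟨k, rfl⟩ := Int.eq_ofNat_of_zero_le (by omega : 0 ≤ p)
    rw [zpow_natCast]
    exact isPrimitive_x.isPower_pow (by omega)
  · obtain ⟨k, hk⟩ := Int.eq_ofNat_of_zero_le (by omega : 0 ≤ -p)
    obtain rfl : p = -k := by omega
    rw [zpow_neg, ← inv_zpow, zpow_natCast]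
    exact isPrimitive_x.inv.isPower_pow (by omega)

theorem sameClass_pair_of_one {p : ℤ} :
    SameClass (W x y [(p, 1), (p, 1)]) ((x ^ p * y) ^ 2) :=
  sameClass_of_eq 1 (by simp only [W_cons, W_nil, pow_two]; group)

theorem c₀'_zero (p q : ℤ) : c₀' 0 p q = x ^ p := by simp [c₀']

theorem c₀''_zero (p q : ℤ) : c₀'' 0 p q = V x y [p, 1] := by
  simp only [c₀'', V_cons, V_nil]; group

theorem c₁'_zero (p q : ℤ) : SameClass (c₁' 0 p q) (W x y [(p, 1), (p, q - 1)]) :=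
  sameClass_of_inv_eq (y ^ (-q)) (by simp only [c₁', W_cons, W_nil]; group)

theorem c₁''_zero (p q : ℤ) : SameClass (c₁'' 0 p q) (W x y [(p, 1), (p, q)]) :=
  sameClass_of_inv_eq 1 (by simp only [c₁'', W_cons, W_nil]; group)

/-- This reduces the case n = 1 of (b) to the case n = 1 of (a), with q lowered by one. -/
theorem c₀''_one_isConj (p q : ℤ) : IsConj (c₀'' 1 p q) (c₀' 1 p (q - 1)) :=
  isConj_iff.2 ⟨x ^ p * y⁻¹ * x ^ (-p), by simp only [c₀', c₀'']; group⟩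

theorem isPrimitive_pair_zero {p : ℤ} : IsPrimitive (W x y [(p, 1), (p, 0)]) := by
  refine (sameClass_of_eq (v := x ^ (2 * p) * y) (x ^ p) ?_).isPrimitive
    (isBasisPair_x_zpow_mul_y _).isPrimitive_right
  simp only [W_cons, W_nil]; group

theorem isPrimitive_pair_two {p : ℤ} (hp : p = 1 ∨ p = -1) :
    IsPrimitive (W x y [(p, 1), (p, 2)]) := by
  have hb : IsBasisPair y (x ^ p * y) := by
    rcases hp with rfl | rfl
    · simpa using (isBasisPair_x_y.swap.mul_zpow 1)
    · simpa using (isBasisPair_x_y.swap.inv_right.mul_zpow 1)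
  refine (sameClass_of_eq y ?_).isPrimitive (hb.isPrimitive_mul_pow 2)
  simp only [W_cons, W_nil, pow_two]; group

/-- Apart from n = 0, each word is, up to conjugacy and inversion, g h^k for a basis (g, h); the
conjugators exhibit this form. -/
theorem c₀'_isPrimitive {n p q : ℤ}
    (h : (n = 0 ∧ (p = 1 ∨ p = -1)) ∨ (n = 1 ∧ p = -2 ∧ q = 0) ∨ (n = 1 ∧ p = -1 ∧ q = 1) ∨
      (n = 1 ∧ q = -1) ∨ (n = -1 ∧ p = 2 ∧ q = 0) ∨ (n = -1 ∧ p = 1 ∧ q = 1) ∨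
      (n = 2 ∧ p = -1 ∧ q = 0) ∨ (n = -2 ∧ p = 1 ∧ q = 0) ∨ (p = 1 ∧ q = -1)) :
    IsPrimitive (c₀' n p q) := by
  rcases h with ⟨rfl, h⟩ | ⟨rfl, rfl, rfl⟩ | ⟨rfl, rfl, rfl⟩ | ⟨rfl, rfl⟩ | ⟨rfl, rfl, rfl⟩ |
    ⟨rfl, rfl, rfl⟩ | ⟨rfl, rfl, rfl⟩ | ⟨rfl, rfl, rfl⟩ | ⟨rfl, rfl⟩
  · rw [c₀'_zero]; exact isPrimitive_x_zpow h
  · refine (sameClass_of_eq 1 ?_).isPrimitive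
      ((isBasisPair_x_zpow_mul_y (-2)).inv_left.isPrimitive_mul_pow 3)
    simp only [c₀', pow_succ, pow_zero]; group
  · refine (sameClass_of_eq (x * y⁻¹ * x) ?_).isPrimitive
      ((isBasisPair_y_inv_x.zpow_mul 1).isPrimitive_mul_pow 3)
    simp only [c₀', pow_succ, pow_zero]; group
    simp only [zpow_ofNat, pow_succ, pow_zero, one_mul, mul_assoc]
  · refine (sameClass_of_eq 1 ?_).isPrimitive
      ((isBasisPair_x_zpow_mul_y (2 * p)).isPrimitive_mul_pow 2)
    simp only [c₀', pow_succ, pow_zero]; group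
  · refine (sameClass_of_inv_eq (x ^ (-2 : ℤ)) ?_).isPrimitive
      ((isBasisPair_x_zpow_mul_y 2).inv_left.isPrimitive_mul_pow 3)
    simp only [c₀', pow_succ, pow_zero]; group
  · refine (sameClass_of_inv_eq (x⁻¹ * y⁻¹ * x ^ (-2 : ℤ)) ?_).isPrimitive
      ((isBasisPair_x_y.swap.zpow_mul 1).isPrimitive_mul_pow 3)
    simp only [c₀', pow_succ, pow_zero]; group
    simp only [zpow_ofNat, pow_succ, pow_zero, one_mul, mul_assoc]
  · refine (sameClass_of_eq (x⁻¹ * y * x⁻¹ * y * x⁻¹ * y)⁻¹ ?_).isPrimitive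
      (isBasisPair_inv_x_mul_y_y.swap.isPrimitive_mul_pow 5)
    simp only [c₀', pow_succ, pow_zero, zpow_ofNat]; group
  · refine (sameClass_of_inv_eq (x * x * y * x * y * x * y)⁻¹ ?_).isPrimitive
      (isBasisPair_x_mul_y_x.swap.isPrimitive_mul_pow 6)
    simp only [c₀', pow_succ, pow_zero, zpow_ofNat, zpow_neg]; group
    simp only [zpow_ofNat, pow_succ, pow_zero, one_mul, mul_assoc]
  -- For p = 1, q = −1 the block is the square of x²y, so the word is x times a power of x²y for
  -- every n.
  · have h : c₀' n 1 (-1) = x * (x ^ (2 : ℤ) * y) ^ (2 * n) := by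
      have hB : block₀' 1 (-1) = (x ^ (2 : ℤ) * y) ^ (2 : ℤ) := by
        rw [zpow_two, block₀']; group
        simp only [zpow_ofNat, pow_succ, pow_zero, one_mul, mul_assoc]
      rw [c₀'_eq, zpow_mul, hB, lead₀', zpow_one]
    rw [h]
    exact ((isBasisPair_x_zpow_mul_y 2).swap.mul_zpow (2 * n)).isPrimitive_right

theorem c₀'_isPower {n p q : ℤ}
    (h : (n = 0 ∧ 2 ≤ |p|) ∨ (n = 1 ∧ p = -1 ∧ q = 0) ∨ (n = -1 ∧ p = 1 ∧ q = 0)) :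
    IsPower (c₀' n p q) := by
  rcases h with ⟨rfl, h⟩ | ⟨rfl, rfl, rfl⟩ | ⟨rfl, rfl, rfl⟩
  · rw [c₀'_zero]; exact isPower_x_zpow h
  · refine (sameClass_of_eq 1 ?_).isPower
      ((isBasisPair_x_zpow_mul_y (-1)).isPrimitive_right.isPower_pow (k := 3) (by omega))
    simp only [c₀', pow_succ, pow_zero]; group
  · refine (sameClass_of_inv_eq x⁻¹ ?_).isPower
      ((isBasisPair_x_zpow_mul_y 1).isPrimitive_right.isPower_pow (k := 3) (by omega))
    simp only [c₀', pow_succ, pow_zero]; group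

theorem eq_zero_or_succ_or_neg_succ (n : ℤ) :
    n = 0 ∨ (∃ m : ℕ, n = m + 1) ∨ ∃ m : ℕ, n = -(m + 1) := by
  rcases lt_trichotomy n 0 with h | h | h
  · obtain ⟨m, hm⟩ := Int.eq_ofNat_of_zero_le (by omega : 0 ≤ -n - 1)
    exact Or.inr (Or.inr ⟨m, by omega⟩)
  · exact Or.inl h
  · obtain ⟨m, hm⟩ := Int.eq_ofNat_of_zero_le (by omega : 0 ≤ n - 1)
    exact Or.inr (Or.inl ⟨m, by omega⟩)

theorem c₀'_isNeither {n p q : ℤ} (hp : p ≠ 0)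
    (h1 : ¬ ((n = 0 ∧ (p = 1 ∨ p = -1)) ∨ (n = 1 ∧ p = -2 ∧ q = 0) ∨ (n = 1 ∧ p = -1 ∧ q = 1) ∨
      (n = 1 ∧ q = -1) ∨ (n = -1 ∧ p = 2 ∧ q = 0) ∨ (n = -1 ∧ p = 1 ∧ q = 1) ∨
      (n = 2 ∧ p = -1 ∧ q = 0) ∨ (n = -2 ∧ p = 1 ∧ q = 0) ∨ (p = 1 ∧ q = -1)))
    (h2 : ¬ ((n = 0 ∧ 2 ≤ |p|) ∨ (n = 1 ∧ p = -1 ∧ q = 0) ∨ (n = -1 ∧ p = 1 ∧ q = 0))) :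
    IsNeither (c₀' n p q) := by
  simp only [not_or] at h1 h2
  obtain ⟨a₁, a₂, a₃, a₄, a₅, a₆, a₇, a₈, a₉⟩ := h1
  obtain ⟨b₁, b₂, b₃⟩ := h2
  rcases eq_zero_or_succ_or_neg_succ n with rfl | ⟨m, rfl⟩ | ⟨m, rfl⟩
  · rw [le_abs] at b₁
    clear * - a₁ b₁ hp
    omega
  · by_cases hp1 : p = -1
    · subst hp1
      by_cases hq0 : q = 0
      · subst hq0
        obtain ⟨m, rfl⟩ := Nat.exists_eq_succ_of_ne_zero (by clear * - b₂; omega : m ≠ 0)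
        push_cast
        exact c₀'_succ_succ_neg_one_zero_isNeither (by clear * - a₇; omega)
      by_cases hq1 : q = 1
      · subst hq1
        exact c₀'_succ_neg_one_one_isNeither (by clear * - a₃; omega)
      · exact c₀'_succ_of_neg_one_isNeither hq0 hq1 (by clear * - a₄; omega)
    by_cases hq0 : q = 0
    · subst hq0
      exact c₀'_succ_zero_isNeither hp hp1 (by clear * - a₂; omega)
    by_cases hq1 : q = -1
    · subst hq1
      exact c₀'_succ_neg_one_isNeither hp (by clear * - a₉; omega) (by clear * - a₄; omega)
    exact c₀'_succ_isNeither hp hp1 hq0 hq1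
  · by_cases hq1 : q = -1
    · subst hq1
      exact c₀'_neg_succ_neg_one_isNeither hp (by clear * - a₉; omega)
    by_cases hp1 : p = -1
    · subst hp1
      exact c₀'_neg_succ_of_neg_one_isNeither hq1
    by_cases hp2 : p = 1
    · subst hp2
      by_cases hq0 : q = 0
      · subst hq0
        obtain ⟨m, rfl⟩ := Nat.exists_eq_succ_of_ne_zero (by clear * - b₃; omega : m ≠ 0)
        push_cast
        exact c₀'_neg_succ_succ_one_zero_isNeither (by clear * - a₈; omega)
      · exact c₀'_neg_succ_of_one_isNeither hq0 hq1 (by clear * - a₆; omega)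
    by_cases hq0 : q = 0
    · subst hq0
      exact c₀'_neg_succ_zero_isNeither hp hp2 (by clear * - a₅; omega)
    exact c₀'_neg_succ_isNeither hp hp2 hp1 hq0 hq1

theorem c₀''_isPrimitive {n p q : ℤ}
    (h : (n = 0 ∧ p = 2) ∨ (n = 1 ∧ q = 0) ∨ (n = 1 ∧ p = -1 ∧ q = 2) ∨
      (n = 1 ∧ p = -2 ∧ q = 1)) : IsPrimitive (c₀'' n p q) := by
  rcases h with ⟨rfl, rfl⟩ | ⟨rfl, rfl⟩ | ⟨rfl, rfl, rfl⟩ | ⟨rfl, rfl, rfl⟩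
  · rw [c₀''_zero]
    refine (sameClass_of_eq 1 ?_).isPrimitive
      ((isBasisPair_x_zpow_mul_y 1).isPrimitive_mul_pow 2)
    simp only [V_cons, V_nil, pow_succ, pow_zero]; group
    simp only [zpow_ofNat, pow_succ, pow_zero, one_mul, mul_assoc]
  all_goals
    exact (c₀'_isPrimitive (by norm_num)).of_isConj (c₀''_one_isConj _ _).symm

theorem c₀''_isPower {n p q : ℤ} (h : (n = 0 ∧ p = 1) ∨ (n = 1 ∧ p = -1 ∧ q = 1)) :
    IsPower (c₀'' n p q) := by
  rcases h with ⟨rfl, rfl⟩ | ⟨rfl, rfl, rfl⟩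
  · rw [c₀''_zero]
    refine (sameClass_of_eq 1 ?_).isPower
      ((isBasisPair_x_zpow_mul_y 1).isPrimitive_right.isPower_pow (k := 2) le_rfl)
    simp only [V_cons, V_nil, pow_succ, pow_zero]; group
  · exact (c₀'_isPower (by norm_num)).of_isConj (c₀''_one_isConj (-1) 1).symm

theorem c₀''_isNeither {n p q : ℤ} (hp : p ≠ 0)
    (h1 : ¬ ((n = 0 ∧ p = 2) ∨ (n = 1 ∧ q = 0) ∨ (n = 1 ∧ p = -1 ∧ q = 2) ∨
      (n = 1 ∧ p = -2 ∧ q = 1)))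
    (h2 : ¬ ((n = 0 ∧ p = 1) ∨ (n = 1 ∧ p = -1 ∧ q = 1))) : IsNeither (c₀'' n p q) := by
  by_cases hn : n = 1
  · subst hn
    by_cases hpq : p = 1 ∧ q = 0
    · omega
    have h := c₀'_isNeither (n := 1) (p := p) (q := q - 1) hp (by omega) (by omega)
    exact ⟨fun hc => h.1 (hc.of_isConj (c₀''_one_isConj p q)),
      fun hc => h.2 (hc.of_isConj (c₀''_one_isConj p q))⟩
  rcases eq_zero_or_succ_or_neg_succ n with rfl | ⟨m, rfl⟩ | ⟨m, rfl⟩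
  · have hs : SameClass (c₀'' 0 p q) (V x y ([p, 1] ++ (List.replicate 0 []).flatten ++ [])) :=
      sameClass_of_eq 1 (by rw [c₀''_zero]; simp)
    have hc : ([p, 1] : List ℤ).count 1 + 0 * ([] : List ℤ).count 1 + ([] : List ℤ).count 1 = 1 := by
      have : p ≠ 1 := by omega
      simp [this]
    rcases lt_or_ge 0 p with h0 | h0
    · exact isNeither_of_sameClass_V_of_unique hs isBasisPair_x_y 1 p (by simp) (by simp)
        (by omega) 1 hc
    · exact isNeither_of_sameClass_V_of_unique hs isBasisPair_x_y p 1 (by simp) (by simp)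
        (by omega) 1 hc
  · by_cases hq : q = 0
    · subst hq
      exact c₀''_succ_zero_isNeither hp (by omega)
    by_cases hp1 : p = -1
    · subst hp1
      exact c₀''_succ_of_neg_one_isNeither hq (by omega)
    exact c₀''_succ_isNeither hp hp1 hq (by omega)
  · by_cases hp1 : p = 1
    · subst hp1
      exact c₀''_neg_succ_of_one_isNeither
    by_cases hq : q = 0
    · subst hq
      exact c₀''_neg_succ_zero_isNeither hp hp1
    by_cases hp2 : p = -1
    · subst hp2
      exact c₀''_neg_succ_of_neg_one_isNeither hq
    exact c₀''_neg_succ_isNeither hp hp1 hp2 hq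

theorem c₁'_isPrimitive {n p q : ℤ}
    (h : (n = 0 ∧ q = 1) ∨ (n = 0 ∧ (p = 1 ∨ p = -1) ∧ q = 3) ∨ (n = -1 ∧ p = 2 ∧ q = 0) ∨
      (n = -1 ∧ p = -1 ∧ q = 2) ∨ (n = -1 ∧ q = 1)) : IsPrimitive (c₁' n p q) := by
  rcases h with ⟨rfl, rfl⟩ | ⟨rfl, h, rfl⟩ | ⟨rfl, rfl, rfl⟩ | ⟨rfl, rfl, rfl⟩ | ⟨rfl, rfl⟩
  · exact (c₁'_zero p 1).isPrimitive isPrimitive_pair_zero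
  · exact (c₁'_zero p 3).isPrimitive (isPrimitive_pair_two h)
  · refine (c₁'_neg_succ_V_zero 0 2).isPrimitive ?_
    refine (sameClass_of_eq (y⁻¹ * x ^ (-4 : ℤ)) ?_).isPrimitive
      ((isBasisPair_x_zpow_mul_y 4).inv_left.isPrimitive_mul_pow 3)
    simp only [List.replicate_zero, List.flatten_nil, List.append_nil, List.cons_append,
      List.nil_append, V_cons, V_nil, pow_succ, pow_zero]
    group
  · refine (c₁'_neg_succ_V_of_neg_one 0 2).isPrimitive ?_
    refine (sameClass_of_eq (x * y ^ (-2 : ℤ) * x * y ^ (-2 : ℤ)) ?_).isPrimitive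
      ((isBasisPair_y_inv_x.zpow_mul 2).inv_left.isPrimitive_mul_pow 4)
    simp only [List.replicate_zero, List.flatten_nil, List.append_nil, List.cons_append,
      List.nil_append, V_cons, V_nil, pow_succ, pow_zero]
    group
  · refine (sameClass_of_inv_eq (y⁻¹ * x ^ (-p) * y⁻¹ * y⁻¹) ?_).isPrimitive
      ((isBasisPair_x_zpow_mul_y p).isPrimitive_mul_pow 5)
    simp only [c₁', pow_succ, pow_zero]; group

theorem c₁'_isPower {n p q : ℤ} (h : (n = -1 ∧ p = 1 ∧ q = 0) ∨ (n = 0 ∧ q = 2)) :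
    IsPower (c₁' n p q) := by
  rcases h with ⟨rfl, rfl, rfl⟩ | ⟨rfl, rfl⟩
  · refine (c₁'_neg_succ_V_zero 0 1).isPower ?_
    refine (sameClass_of_eq 1 ?_).isPower
      ((isBasisPair_x_zpow_mul_y 2).isPrimitive_right.isPower_pow (k := 3) (by omega))
    simp only [List.replicate_zero, List.flatten_nil, List.append_nil, List.cons_append,
      List.nil_append, V_cons, V_nil, pow_succ, pow_zero]
    group
  · exact (c₁'_zero p 2).isPower (sameClass_pair_of_one.isPower
      ((isBasisPair_x_zpow_mul_y p).isPrimitive_right.isPower_pow le_rfl))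

theorem c₁'_isNeither {n p q : ℤ} (hp : p ≠ 0)
    (h1 : ¬ ((n = 0 ∧ q = 1) ∨ (n = 0 ∧ (p = 1 ∨ p = -1) ∧ q = 3) ∨ (n = -1 ∧ p = 2 ∧ q = 0) ∨
      (n = -1 ∧ p = -1 ∧ q = 2) ∨ (n = -1 ∧ q = 1)))
    (h2 : ¬ ((n = -1 ∧ p = 1 ∧ q = 0) ∨ (n = 0 ∧ q = 2))) : IsNeither (c₁' n p q) := by
  rcases eq_zero_or_succ_or_neg_succ n with rfl | ⟨m, rfl⟩ | ⟨m, rfl⟩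
  · exact isNeither_of_sameClass_pair (c₁'_zero p q) hp (by omega) (by omega) (by omega)
  · exact c₁'_succ_isNeither hp
  · by_cases hq0 : q = 0
    · subst hq0
      by_cases hp1 : p = 1
      · subst hp1
        exact c₁'_neg_succ_one_zero_isNeither (by omega)
      · exact c₁'_neg_succ_zero_isNeither hp hp1 (by omega)
    by_cases hp1 : p = -1
    · subst hp1
      exact c₁'_neg_succ_of_neg_one_isNeither hq0 (by omega)
    by_cases hq1 : q = -1
    · subst hq1
      exact c₁'_neg_succ_neg_one_isNeither hp hp1
    exact c₁'_neg_succ_isNeither hp hp1 hq0 hq1 (by omega)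

theorem c₁''_isPrimitive {n p q : ℤ}
    (h : (n = 0 ∧ (p = 1 ∨ p = -1) ∧ q = 2) ∨ (n = 0 ∧ q = 0)) : IsPrimitive (c₁'' n p q) := by
  rcases h with ⟨rfl, h, rfl⟩ | ⟨rfl, rfl⟩
  · exact (c₁''_zero p 2).isPrimitive (isPrimitive_pair_two h)
  · exact (c₁''_zero p 0).isPrimitive isPrimitive_pair_zero

theorem c₁''_isPower {n p q : ℤ} (h : n = 0 ∧ q = 1) : IsPower (c₁'' n p q) := by
  obtain ⟨rfl, rfl⟩ := h
  exact (c₁''_zero p 1).isPower (sameClass_pair_of_one.isPower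
    ((isBasisPair_x_zpow_mul_y p).isPrimitive_right.isPower_pow le_rfl))

theorem c₁''_isNeither {n p q : ℤ} (hp : p ≠ 0)
    (h1 : ¬ ((n = 0 ∧ (p = 1 ∨ p = -1) ∧ q = 2) ∨ (n = 0 ∧ q = 0))) (h2 : ¬ (n = 0 ∧ q = 1)) :
    IsNeither (c₁'' n p q) := by
  rcases eq_zero_or_succ_or_neg_succ n with rfl | ⟨m, rfl⟩ | ⟨m, rfl⟩
  · exact isNeither_of_sameClass_pair (c₁''_zero p q) hp (by omega) (by omega) (by omega)
  · exact c₁''_succ_isNeither hp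
  · exact c₁''_neg_succ_isNeither hp

/-- Since primitive elements are not powers, R and S exclude the opposite property, and the
remaining parameters are covered by `hN`. -/
theorem isPrimitive_iff_and_isPower_iff {u : F₂} {R S : Prop} (hR : R → IsPrimitive u)
    (hS : S → IsPower u) (hN : ¬ R → ¬ S → IsNeither u) :
    (IsPrimitive u ↔ R) ∧ (IsPower u ↔ S) := by
  refine ⟨⟨fun h => ?_, hR⟩, ⟨fun h => ?_, hS⟩⟩
  · by_contra hc
    exact (hN hc fun hs => h.not_isPower (hS hs)).1 h
  · by_contra hc
    exact (hN (fun hr => (hR hr).not_isPower h) hc).2 h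

end KleinWords

theorem mainTheorem6 (n p q : ℤ) (hp : p ≠ 0) :
    -- (a)
    (KleinWords.IsPrimitive (KleinWords.c₀' n p q) ↔
      (n = 0 ∧ (p = 1 ∨ p = -1)) ∨
      (n = 1 ∧ p = -2 ∧ q = 0) ∨
      (n = 1 ∧ p = -1 ∧ q = 1) ∨
      (n = 1 ∧ q = -1) ∨
      (n = -1 ∧ p = 2 ∧ q = 0) ∨
      (n = -1 ∧ p = 1 ∧ q = 1) ∨
      (n = 2 ∧ p = -1 ∧ q = 0) ∨
      (n = -2 ∧ p = 1 ∧ q = 0) ∨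
      (p = 1 ∧ q = -1)) ∧
    (KleinWords.IsPower (KleinWords.c₀' n p q) ↔
      (n = 0 ∧ 2 ≤ |p|) ∨
      (n = 1 ∧ p = -1 ∧ q = 0) ∨
      (n = -1 ∧ p = 1 ∧ q = 0)) ∧
    -- (b)
    (KleinWords.IsPrimitive (KleinWords.c₀'' n p q) ↔
      (n = 0 ∧ p = 2) ∨
      (n = 1 ∧ q = 0) ∨
      (n = 1 ∧ p = -1 ∧ q = 2) ∨
      (n = 1 ∧ p = -2 ∧ q = 1)) ∧
    (KleinWords.IsPower (KleinWords.c₀'' n p q) ↔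
      (n = 0 ∧ p = 1) ∨
      (n = 1 ∧ p = -1 ∧ q = 1)) ∧
    -- (c)
    (KleinWords.IsPrimitive (KleinWords.c₁' n p q) ↔
      (n = 0 ∧ q = 1) ∨
      (n = 0 ∧ (p = 1 ∨ p = -1) ∧ q = 3) ∨
      (n = -1 ∧ p = 2 ∧ q = 0) ∨
      (n = -1 ∧ p = -1 ∧ q = 2) ∨
      (n = -1 ∧ q = 1)) ∧
    (KleinWords.IsPower (KleinWords.c₁' n p q) ↔
      (n = -1 ∧ p = 1 ∧ q = 0) ∨
      (n = 0 ∧ q = 2)) ∧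
    -- (d)
    (KleinWords.IsPrimitive (KleinWords.c₁'' n p q) ↔
      (n = 0 ∧ (p = 1 ∨ p = -1) ∧ q = 2) ∨
      (n = 0 ∧ q = 0)) ∧
    (KleinWords.IsPower (KleinWords.c₁'' n p q) ↔
      (n = 0 ∧ q = 1)) := by
  obtain ⟨a₁, a₂⟩ := KleinWords.isPrimitive_iff_and_isPower_iff
    (KleinWords.c₀'_isPrimitive (n := n) (p := p) (q := q)) KleinWords.c₀'_isPower
    (KleinWords.c₀'_isNeither hp)
  obtain ⟨b₁, b₂⟩ := KleinWords.isPrimitive_iff_and_isPower_iff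
    (KleinWords.c₀''_isPrimitive (n := n) (p := p) (q := q)) KleinWords.c₀''_isPower
    (KleinWords.c₀''_isNeither hp)
  obtain ⟨c₁, c₂⟩ := KleinWords.isPrimitive_iff_and_isPower_iff
    (KleinWords.c₁'_isPrimitive (n := n) (p := p) (q := q)) KleinWords.c₁'_isPower
    (KleinWords.c₁'_isNeither hp)
  obtain ⟨d₁, d₂⟩ := KleinWords.isPrimitive_iff_and_isPower_iff
    (KleinWords.c₁''_isPrimitive (n := n) (p := p) (q := q)) KleinWords.c₁''_isPower
    (KleinWords.c₁''_isNeither hp)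
  exact ⟨a₁, a₂, b₁, b₂, c₁, c₂, d₁, d₂⟩
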